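/- **Setting.** Formulas are in separated linear form $F=\mathcal L_0\wedge\mathcal N$ over $x_1,\dots,x_n$: $\mathcal L_0$ is a finite set of clauses (disjunctions of atoms $q+c_1x_1+\dots+c_nx_n\diamond 0$ with rational $q,c_i$), $\mathcal N$ is a finite set of constraints $P: f(x_{i_1},\dots,x_{i_k})\diamond 0$, where $f:\mathbb R^k\to\mathbb R$ is a partial computable function; everywhere $\diamond\in\{>,\ge\}$. Each $f$ is given by a function-oracle machine $M_f^?$: for every $\vec x\in\operatorname{dom} f$, every name $\varphi$ of $\vec x$ (rational vectors with $\|\varphi_m-\vec x\|_\infty\le 2^{-m}$) and every $p\in\mathbb N$, $M_f^{\varphi}(p)$ halts with a rational $y$, $|y-f(\vec x)|\le 2^{-p}$. Let $B_i\subseteq\mathbb R$ be defined by the clauses of $\mathcal L_0$ univariate in $x_i$. $F$ is a *bounded instance* if $\prod_{i\le n}B_i$ is bounded and, for each $P\in\mathcal N$, the closure of $D_P=\prod_j B_{i_j}$ is contained in $\operatorname{dom} f$. For rational $\delta>0$, the $\delta$-weakening $F_\delta$ replaces each $f(\vec x)\diamond 0$ in $\mathcal N$ by $f(\vec x)+\delta\diamond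 0$. **The calculus $\delta$-ksmt.** Non-final states are $(\alpha,\mathcal L,\mathcal N)$ with $\alpha$ a sequence of assignments of rationals to variables; the initial state is $(\mathrm{nil},\mathcal L_0,\mathcal N)$; an atom has a truth value under $\alpha$ only when all its variables are assigned, and clauses and sets of clauses are evaluated accordingly. The rules are: * (A) if $\mathcal L$ is not false under $\alpha$, append $z\mapsto q$ ($z$ unassigned, $q\in\mathbb Q$) so that $\mathcal L$ is still not false; * (R) if $\mathcal L$ is not false under $\alpha$ but, for some unassigned $z$, is false under $\alpha::z\mapsto q$ for all $q\in\mathbb Q$, add a resolvent on $z$: a non-empty finite set of clauses without $z$, implied by $\mathcal L$, false under $\alpha$, and derived from $\mathcal L$ by arithmetical resolution on $z$ (from $(cz+t\diamond0)\vee C$ and $(-c'z+t'\diamond'0)\vee D$ with $c,c'>0$, derive $(c't+ct'\diamond''0)\vee C\vee D$, where $\diamond''$ is $>$ iff $\diamond$ or $\diamond'$ is; clauses are sets of atoms); * (B) if $\mathcal L$ is false under $\alpha$, replace $\alpha$ by its longest prefix under which $\mathcal L$ is not false, if there is one; * (L) if $\mathcal L$ is not false under $\alpha$ and some $P\in\mathcal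 N$ is, add a linearisation of $P$ at $\alpha$: a clause over variables of $P$ that is implied by $P$ and false under $\alpha$; * go to SAT if $\alpha$ is total, $\mathcal L$ is true under $\alpha$ and none of (A), (R), (B), (L) applies; go to UNSAT if $\mathcal L$ is false under the empty assignment; go to $\delta$-SAT if $\alpha$ is total and $\mathcal L\wedge\mathcal N_\delta$ is true under $\alpha$. **Local linearisations.** Fix $p\in\mathbb N$ with $p\ge-\lfloor\log_2\min\{1,\delta/4\}\rfloor$ and a computable rounding $\lfloor\cdot\rceil:\mathbb Q\to\mathbb Z$ with $|\lfloor q\rceil-q|\le\frac12$. For $P:f(\vec x)\diamond0$ and $\alpha$ assigning $\vec c$ to $\vec x$, let $\varphi_m=\lfloor 2^{m+1}\vec c\,\rceil/2^{m+1}$ (componentwise; a $\xi$-name of $\vec c$, i.e. in each component $\varphi_m\in\mathbb Z\cdot2^{-(m+1)}$, $|\varphi_i-\varphi_{i+j}|\le2^{-(i+1)}$, with limit $\vec c$). Run $M_f^\varphi(p+2)$; let $\tilde y$ be its output and $k$ its maximum oracle query ($0$ if there is none). Return *none* if $\tilde y\diamond-\delta/2$, and otherwise the clause $\vec x\notin B(\vec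 c,2^{-(k+1)})$, where $B$ is the open maximum-norm ball. *$\delta$-ksmt with local linearisations* is $\delta$-ksmt where the rules (L) and $\delta$-SAT are applied only as follows: when $\alpha$ is total and $\mathcal L$ is true under $\alpha$, either add a clause returned for some $P\in\mathcal N$, or go to $\delta$-SAT if *none* is returned for all $P\in\mathcal N$; and where rule (A) assigns the variables in a fixed (arbitrary) order. **Corollary.** $\delta$-ksmt with local linearisations is a $\delta$-complete decision procedure. That is, let $\delta\in\mathbb Q_{>0}$. For every bounded instance $F$ and every order of its variables: 1. every step, from a state reachable from the initial one, of $\delta$-ksmt with local linearisations is a step of $\delta$-ksmt; 2. there is no infinite run from the initial state; 3. every reachable state in which no step is possible is final and a correct answer: if it is UNSAT, then no real assignment satisfies $F$; if it is $\delta$-SAT, then some rational assignment satisfies $F_\delta$; if it is SAT, then some rational assignment satisfies $F$ (and $F_\delta$). Moreover the procedure is effective: there is an algorithm (depending only on $\delta$, $p$ and the rounding) that, given a bounded instance $F$ (each non-linear function being given by its machine) and an order of its variables, computes a run from the initial state to a final state, which is a correct answer. -/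

import Mathlib

namespace Ksmt

/-! ### Linear constraints -/

/-- An atomic linear constraint `q + c₀ x₀ + c₁ x₁ + … ⋄ 0` with rational `q`, `cᵢ`
(the list `coeffs` holds `c₀, c₁, …`; missing entries are `0`);
`⋄` is `>` if `strict` is true and `≥` otherwise. Variables are natural numbers. -/
structure Atom where
  const : ℚ
  coeffs : List ℚ
  strict : Bool

/-- The relation `⋄ 0`: `> 0` if `strict`, `≥ 0` otherwise. -/
def Rel {K : Type*} [Zero K] [LT K] [LE K] (strict : Bool) (t : K) : Prop :=
  if strict = true then 0 < t else 0 ≤ t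

/-- The coefficient of the variable `i`. -/
def Atom.coeff (a : Atom) (i : ℕ) : ℚ := a.coeffs.getD i 0

/-- The variables that occur in `a`. -/
def Atom.vars (a : Atom) : Set ℕ := {i | a.coeff i ≠ 0}

/-- The value of the linear term of `a` at a total real assignment. -/
def Atom.value (a : Atom) (β : ℕ → ℝ) : ℝ :=
  a.const + ∑ i ∈ Finset.range a.coeffs.length, (a.coeff i : ℝ) * β i

/-- `a` is true at the total real assignment `β`. -/
def Atom.Holds (a : Atom) (β : ℕ → ℝ) : Prop := Rel a.strict (a.value β)

/-- A linear clause: a disjunction of atomic linear constraints. -/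
abbrev Clause := List Atom

def Clause.vars (C : Clause) : Set ℕ := {i | ∃ a ∈ C, i ∈ a.vars}

def Clause.Holds (C : Clause) (β : ℕ → ℝ) : Prop := ∃ a ∈ C, a.Holds β

/-! ### Partial rational assignments and three-valued evaluation -/

/-- A partial assignment of rationals to variables, as the sequence `x ↦ q :: y ↦ r :: …` of
its bindings, the oldest binding first. -/
abbrev Assign := List (ℕ × ℚ)

/-- `z` is assigned by `α`. -/
def Assign.Assigned (α : Assign) (z : ℕ) : Prop := z ∈ α.map Prod.fst

/-- The value of the variable `z` under `α` (`0` where `z` is unassigned). -/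
def Assign.val (α : Assign) (z : ℕ) : ℚ := (List.lookup z α).getD 0

def Assign.toReal (α : Assign) : ℕ → ℝ := fun z => (α.val z : ℝ)

/-- An atom has a truth value under `α` only if all its variables are assigned. -/
def Atom.IsTrue (α : Assign) (a : Atom) : Prop :=
  (∀ i ∈ a.vars, α.Assigned i) ∧ a.Holds α.toReal

def Atom.IsFalse (α : Assign) (a : Atom) : Prop :=
  (∀ i ∈ a.vars, α.Assigned i) ∧ ¬ a.Holds α.toReal

def Clause.IsTrue (α : Assign) (C : Clause) : Prop := ∃ a ∈ C, a.IsTrue α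

def Clause.IsFalse (α : Assign) (C : Clause) : Prop := ∀ a ∈ C, a.IsFalse α

/-- Evaluation of a (finite) conjunction of clauses. -/
def LinTrue (α : Assign) (L : List Clause) : Prop := ∀ C ∈ L, C.IsTrue α

def LinFalse (α : Assign) (L : List Clause) : Prop := ∃ C ∈ L, C.IsFalse α

/-! ### Function-oracle machines

The behaviour of a function-oracle machine with argument `p` is its sequence of moves: after
having received a finite list of oracle answers it either poses another query or halts with a
rational output (or runs forever). Which of these happens is a partial recursive function of `p`
and of the answers received so far; the machine is given by a program `M` for that function. -/

/-- Rationals are handed to programs as a pair (numerator, denominator). -/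
abbrev RCode := ℤ × ℕ

def ratCode (q : ℚ) : RCode := (q.num, q.den)

def ratOfCode (c : RCode) : ℚ := (c.1 : ℚ) / (c.2 : ℚ)

/-- The oracle's answers to the queries `qs`, in order, as they are seen by the machine. -/
def answers {k : ℕ} (φ : ℕ → Fin k → ℚ) (qs : List ℕ) : List (List RCode) :=
  qs.map fun m => List.ofFn fun j => ratCode (φ m j)

/-- On argument `p`, having received the answers `h`, the machine makes the move `a`:
`Sum.inl m` is the query `m`, and `Sum.inr c` halts with the output coded by `c`. -/
def Moves (M : Nat.Partrec.Code) (p : ℕ) (h : List (List RCode)) (a : ℕ ⊕ RCode) : Prop :=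
  Encodable.encode a ∈ M.eval (Encodable.encode (p, h))

/-- On argument `p` and with oracle `φ`, the first queries posed by the machine are `qs`. -/
inductive Asks (M : Nat.Partrec.Code) {k : ℕ} (φ : ℕ → Fin k → ℚ) (p : ℕ) : List ℕ → Prop
  | start : Asks M φ p []
  | query {qs : List ℕ} {m : ℕ} : Asks M φ p qs → Moves M p (answers φ qs) (Sum.inl m) →
      Asks M φ p (qs ++ [m])

/-- The run `M^φ(p)` poses exactly the queries `qs`, in this order, and halts with output `y`. -/
def Outputs (M : Nat.Partrec.Code) {k : ℕ} (φ : ℕ → Fin k → ℚ) (p : ℕ) (qs : List ℕ) (y : ℚ) :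
    Prop :=
  Asks M φ p qs ∧ ∃ c : RCode, Moves M p (answers φ qs) (Sum.inr c) ∧ y = ratOfCode c

/-- `φ` is a (Cauchy) name of `x ∈ ℝᵏ`; the norm is the maximum norm. -/
def IsName {k : ℕ} (φ : ℕ → Fin k → ℚ) (x : Fin k → ℝ) : Prop :=
  ∀ m : ℕ, ‖(fun j => (φ m j : ℝ)) - x‖ ≤ (1 / 2 : ℝ) ^ m

/-- The machine `M` computes the partial function `f : ℝᵏ → ℝ`. -/
def Computes (M : Nat.Partrec.Code) {k : ℕ} (f : (Fin k → ℝ) →. ℝ) : Prop :=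
  ∀ (x : Fin k → ℝ) (v : ℝ), v ∈ f x → ∀ φ : ℕ → Fin k → ℚ, IsName φ x →
    ∀ p : ℕ, ∃ (qs : List ℕ) (y : ℚ), Outputs M φ p qs y ∧ |(y : ℝ) - v| ≤ (1 / 2 : ℝ) ^ p

/-- `φ` is a `ξ`-name of the real number `x`: a sequence `φₘ ∈ ℤ·2^{-(m+1)}` with limit `x` and
`|φᵢ - φ_{i+j}| ≤ 2^{-(i+1)}` for all `i, j`. -/
def IsXiName (φ : ℕ → ℚ) (x : ℝ) : Prop :=
  (∀ m, ∃ a : ℤ, φ m = (a : ℚ) / 2 ^ (m + 1)) ∧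
  (∀ i j, |φ i - φ (i + j)| ≤ 1 / 2 ^ (i + 1)) ∧
  Filter.Tendsto (fun m => (φ m : ℝ)) Filter.atTop (nhds x)

/-- The dyadic approximation of `q` obtained with the rounding operation `rnd`. -/
def approx (rnd : ℚ → ℤ) (q : ℚ) (m : ℕ) : ℚ := (rnd (q * 2 ^ (m + 1)) : ℚ) / 2 ^ (m + 1)

theorem abs_approx_sub_le {rnd : ℚ → ℤ} (h : ∀ q : ℚ, |(rnd q : ℚ) - q| ≤ 1 / 2) (q : ℚ) (m : ℕ) :
    |approx rnd q m - q| ≤ 1 / 2 ^ (m + 2) := by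
  have h2 : (0 : ℚ) < 2 ^ (m + 1) := by positivity
  have e : approx rnd q m - q = ((rnd (q * 2 ^ (m + 1)) : ℚ) - q * 2 ^ (m + 1)) / 2 ^ (m + 1) := by
    unfold approx; field_simp
  rw [e, abs_div, abs_of_pos h2, div_le_iff₀ h2]
  refine (h _).trans (le_of_eq ?_)
  field_simp
  ring

/-- The approximations of a rational number form a `ξ`-name of it. -/
theorem isXiName_approx {rnd : ℚ → ℤ} (h : ∀ q : ℚ, |(rnd q : ℚ) - q| ≤ 1 / 2) (q : ℚ) :
    IsXiName (approx rnd q) (q : ℝ) := by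
  refine ⟨fun m => ⟨_, rfl⟩, fun i j => ?_, ?_⟩
  · have h1 := abs_approx_sub_le h q i
    have h2 := abs_approx_sub_le h q (i + j)
    have h3 : (1 : ℚ) / 2 ^ (i + j + 2) ≤ 1 / 2 ^ (i + 2) := by
      apply one_div_le_one_div_of_le (by positivity)
      exact pow_le_pow_right₀ (by norm_num) (by omega)
    have h4 : (1 : ℚ) / 2 ^ (i + 1) = 1 / 2 ^ (i + 2) + 1 / 2 ^ (i + 2) := by
      field_simp; ring
    rw [h4]
    rw [abs_le] at *
    constructor <;> linarith [h1.1, h1.2, h2.1, h2.2]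
  · rw [tendsto_iff_norm_sub_tendsto_zero]
    refine squeeze_zero (fun _ => norm_nonneg _) (g := fun m : ℕ => (1 / 2 : ℝ) ^ m) (fun m => ?_)
      (tendsto_pow_atTop_nhds_zero_of_lt_one (by norm_num) (by norm_num))
    have h1 : |(approx rnd q m : ℝ) - q| ≤ 1 / 2 ^ (m + 2) := by
      have h0 : ((|approx rnd q m - q| : ℚ) : ℝ) ≤ ((1 / 2 ^ (m + 2) : ℚ) : ℝ) :=
        Rat.cast_le.mpr (abs_approx_sub_le h q m)
      push_cast at h0
      exact h0
    rw [Real.norm_eq_abs]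
    refine h1.trans ?_
    rw [one_div_pow]
    apply one_div_le_one_div_of_le (by positivity)
    exact pow_le_pow_right₀ (by norm_num) (by omega)

/-! ### Non-linear constraints and formulas in separated linear form -/

/-- A non-linear constraint `f(x_{i₁}, …, x_{iₖ}) ⋄ 0` with `⋄ ∈ {>, ≥}`; `f` is a partial
computable real function, given with a machine computing it, and `args = [i₁, …, iₖ]`. -/
structure NlConstraint where
  args : List ℕ
  fn : (Fin args.length → ℝ) →. ℝ
  machine : Nat.Partrec.Code
  computes : Computes machine fn
  strict : Bool

/-- The arguments of the constraint at a total assignment. -/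
def NlConstraint.point (P : NlConstraint) {K : Type*} (β : ℕ → K) : Fin P.args.length → K :=
  fun j => β (P.args.get j)

/-- `f(x) + e ⋄ 0` is true at `β` (in particular `f` is defined there). For `e = 0` this is the
truth of the constraint, for `e = δ` that of its `δ`-weakening. -/
def NlConstraint.HoldsUpTo (P : NlConstraint) (e : ℚ) (β : ℕ → ℝ) : Prop :=
  ∃ v ∈ P.fn (P.point β), Rel P.strict (v + (e : ℝ))

/-- The constraint evaluates to false under a partial assignment. -/
def NlConstraint.IsFalse (α : Assign) (P : NlConstraint) : Prop :=
  (∀ i ∈ P.args, α.Assigned i) ∧ ∃ v ∈ P.fn (P.point α.toReal), ¬ Rel P.strict v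

/-- A formula `L₀ ∧ N` in separated linear form over the variables `0, …, n - 1`. -/
structure Formula where
  n : ℕ
  lin : List Clause
  nl : List NlConstraint
  lin_vars : ∀ C ∈ lin, ∀ i ∈ Clause.vars C, i < n
  nl_vars : ∀ P ∈ nl, ∀ i ∈ P.args, i < n

/-- `L₀ ∧ N_e` is true at `β`: for `e = 0` the formula, for `e = δ` its `δ`-weakening. -/
def Formula.HoldsUpTo (F : Formula) (e : ℚ) (β : ℕ → ℝ) : Prop :=
  (∀ C ∈ F.lin, Clause.Holds C β) ∧ ∀ P ∈ F.nl, P.HoldsUpTo e β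

/-- The set `Bᵢ` defined by the clauses of `L₀` that are univariate in the variable `i`. -/
def Formula.box (F : Formula) (i : ℕ) : Set ℝ :=
  {t | ∀ C ∈ F.lin, Clause.vars C = {i} → Clause.Holds C (fun _ => t)}

/-- Bounded instances: `D_F = ∏ Bᵢ` is bounded, and every non-linear function is defined on the
closure of `D_P = ∏ B_{i_j}`. -/
def Formula.IsBounded (F : Formula) : Prop :=
  Bornology.IsBounded (Set.univ.pi fun i : Fin F.n => F.box i) ∧
  ∀ P ∈ F.nl, closure (Set.univ.pi fun j => F.box (P.args.get j)) ⊆ P.fn.Dom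

/-! ### The calculus -/

/-- States; the non-linear part of a state is fixed during a run, hence left implicit. -/
inductive State
  | run (α : Assign) (L : List Clause)
  | sat
  | deltaSat
  | unsat

def Formula.init (F : Formula) : State := State.run [] F.lin

/-- All variables of the formula are assigned. -/
def Formula.Total (F : Formula) (α : Assign) : Prop := ∀ i < F.n, α.Assigned i

/-- Fourier-Motzkin combination of `l` and `u` eliminating `z`, for
`l : c z + t ⋄ 0` and `u : -c' z + t' ⋄' 0` with `c, c' > 0`: the atom `c' t + c t' ⋄'' 0`, which
is strict iff one of `l`, `u` is. -/
def fmResolve (z : ℕ) (l u : Atom) : Atom where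
  const := -u.coeff z * l.const + l.coeff z * u.const
  coeffs := (List.range (max l.coeffs.length u.coeffs.length)).map fun i =>
    -u.coeff z * l.coeff i + l.coeff z * u.coeff i
  strict := l.strict || u.strict

/-- Clauses, as sets of atoms, derivable from `L` by arithmetical resolution on `z`:
from `l ∨ C` and `u ∨ D` derive `fmResolve z l u ∨ C ∨ D`. -/
inductive ResDerivable (z : ℕ) (L : List Clause) : Set Atom → Prop
  | base {C : Clause} : C ∈ L → ResDerivable z L {a | a ∈ C}
  | resolve {C D : Set Atom} {l u : Atom} : ResDerivable z L C → ResDerivable z L D →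
      l ∈ C → u ∈ D → 0 < l.coeff z → u.coeff z < 0 →
      ResDerivable z L ((C \ {l}) ∪ (D \ {u}) ∪ {fmResolve z l u})

/-- `R` is a resolvent on `z`: a non-empty set of clauses not containing `z`, implied by `L`, false
under `α`, and derived from `L` by arithmetical resolution on `z`. -/
def IsResolvent (α : Assign) (L : List Clause) (z : ℕ) (R : List Clause) : Prop :=
  R ≠ [] ∧ ∀ C ∈ R, z ∉ Clause.vars C ∧
    (∀ β : ℕ → ℝ, (∀ D ∈ L, Clause.Holds D β) → Clause.Holds C β) ∧
    Clause.IsFalse α C ∧ C.Nodup ∧ ResDerivable z L {a | a ∈ C}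

/-- `C` is a linearisation of `P` at `α`. -/
def IsLinearisation (P : NlConstraint) (α : Assign) (C : Clause) : Prop :=
  (∀ β : ℕ → ℝ, P.HoldsUpTo 0 β → Clause.Holds C β) ∧ Clause.IsFalse α C ∧
    ∀ i ∈ Clause.vars C, i ∈ P.args

/-- Rule (A) with the variable `z`. -/
def RuleA (F : Formula) (z : ℕ) : State → State → Prop
  | .run α L, S' => ¬ LinFalse α L ∧ z < F.n ∧ ¬ α.Assigned z ∧
      ∃ q : ℚ, ¬ LinFalse (α ++ [(z, q)]) L ∧ S' = .run (α ++ [(z, q)]) L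
  | _, _ => False

/-- Rule (R). -/
def RuleR (F : Formula) : State → State → Prop
  | .run α L, S' => ¬ LinFalse α L ∧ ∃ z < F.n, ¬ α.Assigned z ∧
      (∀ q : ℚ, LinFalse (α ++ [(z, q)]) L) ∧
      ∃ R, IsResolvent α L z R ∧ S' = .run α (R ++ L)
  | _, _ => False

/-- Rule (B): `γ` is the maximal prefix of `α` under which `L` is not false. -/
def RuleB : State → State → Prop
  | .run α L, S' => LinFalse α L ∧ ∃ γ : Assign, γ <+: α ∧ ¬ LinFalse γ L ∧
      (∀ γ' : Assign, γ' <+: α → ¬ LinFalse γ' L → γ' <+: γ) ∧ S' = .run γ L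
  | _, _ => False

/-- Rule (L), with arbitrary linearisations. -/
def RuleL (F : Formula) : State → State → Prop
  | .run α L, S' => ¬ LinFalse α L ∧ ∃ P ∈ F.nl, P.IsFalse α ∧
      ∃ C, IsLinearisation P α C ∧ S' = .run α (C :: L)
  | _, _ => False

/-- Rule for the final state SAT. -/
def RuleSat (F : Formula) : State → State → Prop
  | .run α L, S' => F.Total α ∧ LinTrue α L ∧
      (∀ T, ¬ (∃ z, RuleA F z (.run α L) T) ∧ ¬ RuleR F (.run α L) T ∧
        ¬ RuleB (.run α L) T ∧ ¬ RuleL F (.run α L) T) ∧ S' = .sat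
  | _, _ => False

/-- Rule for the final state UNSAT. -/
def RuleUnsat : State → State → Prop
  | .run _ L, S' => LinFalse [] L ∧ S' = .unsat
  | _, _ => False

/-- Rule for the final state `δ`-SAT. -/
def RuleDeltaSat (F : Formula) (δ : ℚ) : State → State → Prop
  | .run α L, S' => F.Total α ∧ LinTrue α L ∧ (∀ P ∈ F.nl, P.HoldsUpTo δ α.toReal) ∧
      S' = .deltaSat
  | _, _ => False

/-- One step of the calculus `δ`-ksmt. -/
def DeltaKsmtStep (F : Formula) (δ : ℚ) (S S' : State) : Prop :=
  (∃ z, RuleA F z S S') ∨ RuleR F S S' ∨ RuleB S S' ∨ RuleL F S S' ∨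
    RuleSat F S S' ∨ RuleUnsat S S' ∨ RuleDeltaSat F δ S S'

/-! ### Local linearisations -/

/-- The atom `s * xᵢ + c ≥ 0`. -/
def boundAtom (i : ℕ) (s c : ℚ) : Atom where
  const := c
  coeffs := List.replicate i 0 ++ [s]
  strict := false

/-- The clause `x ∉ B(c, r)` for the open ball `B(c, r)` of the maximum norm: the disjunction
of `x_{i_j} ≥ c_j + r` and `x_{i_j} ≤ c_j - r` over all `j`. -/
def outsideBall (args : List ℕ) (c : ℕ → ℚ) (r : ℚ) : Clause :=
  args.flatMap fun i => [boundAtom i 1 (-(c i) - r), boundAtom i (-1) (c i - r)]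

/-- `r` is the result of the local linearisation of `P` at `α`: run the machine with precision
`p + 2` on the `ξ`-name `m ↦ approx(x, m)` of the point `x` assigned to the arguments; let `y` be
its output, and `k` its maximum query (`0` if there is none). The result is none if
`y ⋄ -δ/2`, and the clause `x ∉ B(x, 2^{-(k+1)})` otherwise. -/
def LineariseLocal (δ : ℚ) (p : ℕ) (rnd : ℚ → ℤ) (P : NlConstraint) (α : Assign)
    (r : Option Clause) : Prop :=
  ∃ (qs : List ℕ) (y : ℚ),
    Outputs P.machine (fun m j => approx rnd (P.point α.val j) m) (p + 2) qs y ∧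
    (Rel P.strict (y + δ / 2) ∧ r = none ∨
      ¬ Rel P.strict (y + δ / 2) ∧
        r = some (outsideBall P.args α.val ((1 / 2) ^ (qs.foldr max 0 + 1))))

/-- The step taken on a total assignment satisfying the linear part: add a computed
linearisation of some constraint, or conclude `δ`-SAT if no constraint yields one. -/
def NlinStepLocal (F : Formula) (δ : ℚ) (p : ℕ) (rnd : ℚ → ℤ) : State → State → Prop
  | .run α L, S' => F.Total α ∧ LinTrue α L ∧
      ((∃ P ∈ F.nl, ∃ C, LineariseLocal δ p rnd P α (some C) ∧ S' = .run α (C :: L)) ∨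
        (∀ P ∈ F.nl, LineariseLocal δ p rnd P α none) ∧ S' = .deltaSat)
  | _, _ => False

/-- `z` is the next variable to be assigned, in the order `ord`. -/
def NextVar (ord : List ℕ) (z : ℕ) : State → Prop
  | .run α _ => α.map Prod.fst ++ [z] <+: ord
  | _ => False

/-- One step of `δ`-ksmt with local linearisations: the applications of (L) and of the `δ`-SAT rule
are performed by `NlinStepLocal`, and variables are assigned in the order `ord`. -/
def LocalStep (F : Formula) (ord : List ℕ) (δ : ℚ) (p : ℕ) (rnd : ℚ → ℤ) (S S' : State) : Prop :=
  (∃ z, NextVar ord z S ∧ RuleA F z S S') ∨ RuleR F S S' ∨ RuleB S S' ∨ RuleSat F S S' ∨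
    RuleUnsat S S' ∨ NlinStepLocal F δ p rnd S S'

/-- The state is a final one, and is a correct answer for the `δ`-decision problem of `F`:
UNSAT if there is no solution, even over the reals; (`δ`-)SAT if some rational assignment
satisfies `F` (`F_δ`). -/
def CorrectAnswer (F : Formula) (δ : ℚ) : State → Prop
  | .run _ _ => False
  | .unsat => ∀ β : ℕ → ℝ, ¬ F.HoldsUpTo 0 β
  | .deltaSat => ∃ v : ℕ → ℚ, F.HoldsUpTo δ (fun i => (v i : ℝ))
  | .sat => ∃ v : ℕ → ℚ, F.HoldsUpTo 0 (fun i => (v i : ℝ)) ∧ F.HoldsUpTo δ (fun i => (v i : ℝ))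

/-! ### Finite descriptions of formulas and states, as inputs and outputs of programs -/

abbrev ACode := RCode × List RCode × Bool

def Atom.code (a : Atom) : ACode := (ratCode a.const, a.coeffs.map ratCode, a.strict)

def linCode (L : List Clause) : List (List ACode) := L.map (List.map Atom.code)

/-- A non-linear constraint is given by its arguments, its machine and its predicate. -/
abbrev NCode := List ℕ × Nat.Partrec.Code × Bool

def NlConstraint.code (P : NlConstraint) : NCode := (P.args, P.machine, P.strict)

abbrev FCode := ℕ × List (List ACode) × List NCode

def Formula.code (F : Formula) : FCode := (F.n, linCode F.lin, F.nl.map NlConstraint.code)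

abbrev SCode := (List (ℕ × RCode) × List (List ACode)) ⊕ ℕ

def State.code : State → SCode
  | .run α L => Sum.inl (α.map (fun b => (b.1, ratCode b.2)), linCode L)
  | .sat => Sum.inr 0
  | .deltaSat => Sum.inr 1
  | .unsat => Sum.inr 2

end Ksmt

/-! Correctness rests on an invariant of reachable states: the assignment is a prefix of the
variable order, and `L` contains the clauses of `L₀` and follows from `F`. If `L` is true under a
total `α`, the clauses of `L₀` put the point into the boxes, so every `f` is defined there and its
machine halts on the name used. The output `y` is within `δ/16` of the value of `f`, so `y ⋄ -δ/2`
gives `f + δ ⋄ 0`. Otherwise `f ⋄ 0` fails on the whole ball around the point: any point of the ball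
has a name agreeing with the given one up to the largest query, on which the machine produces the
same `y` (`LineariseLocal.isLinearisation`).

Progress needs completeness of resolution on one variable: if every value of `z` falsifies some
clause, then a clause free of `z` and false under `α` is derivable. It is found by sweeping `z` from
`-∞` upwards (`Deriv.exists_conflict`).

Termination splits in two. With infinitely many linearisation steps, the points accumulate at some
`c` in the closure of the box, where `f` is defined. The machine halts on a limit name of `c` after
finitely many queries, so almost all radii (in the sense of an ultrafilter) coincide, and some later
point lies in an earlier excluded ball (`no_infinite_linearisation`). Otherwise only (A), (R), (B)
occur from some step on. Resolution on `z` combines atoms containing `z` into atoms over variables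
that precede `z` in the order, so at most `n` levels of combination arise; there are finitely many
possible clauses and a numerical measure decreases (`no_infinite_linear`).

Effectivity is obtained by unbounded search: a finished run, with all its justifications, is a
finite object whose correctness is recursively enumerable. The universal premise of (R) is replaced
by a derivation certifying it (`Deriv.linFalse_snoc`), the maximality in (B) by inspecting two
consecutive prefixes. Progress and termination ensure that the search succeeds. -/

namespace Ksmt

/-! ### Linear atoms -/

instance : DecidableEq Atom := fun a b =>
  decidable_of_iff (a.const = b.const ∧ a.coeffs = b.coeffs ∧ a.strict = b.strict)
    (by cases a; cases b; simp)

theorem rel_cast (s : Bool) (t : ℚ) : Rel s (t : ℝ) ↔ Rel s t := by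
  cases s <;> simp [Rel]

theorem Atom.coeff_of_length_le (a : Atom) {i : ℕ} (h : a.coeffs.length ≤ i) : a.coeff i = 0 := by
  simp [Atom.coeff, List.getD, List.getElem?_eq_none h]

theorem Atom.lt_length_of_mem_vars {a : Atom} {i : ℕ} (h : i ∈ a.vars) : i < a.coeffs.length := by
  by_contra h'
  exact h (a.coeff_of_length_le (not_lt.mp h'))

/-- Coefficients beyond the list are `0`, so the sum may be extended to any common length; this is
how atoms with coefficient lists of different lengths are combined. -/
theorem Atom.value_eq_sum (a : Atom) (β : ℕ → ℝ) {N : ℕ} (h : a.coeffs.length ≤ N) :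
    a.value β = a.const + ∑ i ∈ Finset.range N, (a.coeff i : ℝ) * β i := by
  unfold Atom.value
  congr 1
  refine Finset.sum_subset (Finset.range_mono h) fun i _ hi => ?_
  rw [a.coeff_of_length_le (by simpa using hi)]
  simp

theorem Atom.value_congr (a : Atom) {β γ : ℕ → ℝ} (h : ∀ i ∈ a.vars, β i = γ i) :
    a.value β = a.value γ := by
  unfold Atom.value
  congr 1
  refine Finset.sum_congr rfl fun i _ => ?_
  by_cases hi : a.coeff i = 0
  · simp [hi]
  · rw [h i hi]

theorem Atom.holds_congr (a : Atom) {β γ : ℕ → ℝ} (h : ∀ i ∈ a.vars, β i = γ i) :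
    a.Holds β ↔ a.Holds γ := by
  rw [Atom.Holds, Atom.Holds, a.value_congr h]

/-- The value of the linear term of `a` at a rational assignment. -/
def Atom.qvalue (a : Atom) (v : ℕ → ℚ) : ℚ :=
  a.const + ((List.range a.coeffs.length).map fun i => a.coeff i * v i).sum

theorem Atom.value_cast (a : Atom) (v : ℕ → ℚ) :
    a.value (fun i => (v i : ℝ)) = (a.qvalue v : ℚ) := by
  have : ∀ n : ℕ, ((List.range n).map fun i => a.coeff i * v i).sum =
      ∑ i ∈ Finset.range n, a.coeff i * v i := by
    intro n
    induction n with
    | zero => simp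
    | succ n ih => rw [Finset.sum_range_succ, ← ih, List.range_succ]; simp
  rw [Atom.value, Atom.qvalue, this]
  push_cast
  rfl

theorem Atom.holds_toReal (a : Atom) (α : Assign) :
    a.Holds α.toReal ↔ Rel a.strict (a.qvalue α.val) := by
  unfold Atom.Holds Assign.toReal
  rw [a.value_cast, rel_cast]

theorem coeff_fmResolve (z : ℕ) (l u : Atom) (i : ℕ) :
    (fmResolve z l u).coeff i = -u.coeff z * l.coeff i + l.coeff z * u.coeff i := by
  by_cases h : i < max l.coeffs.length u.coeffs.length
  · simp [Atom.coeff, fmResolve, List.getD, List.getElem?_map, List.getElem?_range h]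
  · have h1 : (fmResolve z l u).coeff i = 0 :=
      Atom.coeff_of_length_le _ (by simpa [fmResolve] using h)
    rw [h1, l.coeff_of_length_le (i := i) (by omega), u.coeff_of_length_le (i := i) (by omega)]
    ring

theorem coeff_fmResolve_self (z : ℕ) (l u : Atom) : (fmResolve z l u).coeff z = 0 := by
  rw [coeff_fmResolve]; ring

theorem vars_fmResolve_subset (z : ℕ) (l u : Atom) :
    (fmResolve z l u).vars ⊆ (l.vars ∪ u.vars) \ {z} := by
  intro i hi
  have hi' : (fmResolve z l u).coeff i ≠ 0 := hi
  refine ⟨?_, fun h => hi' (by rw [show i = z from h, coeff_fmResolve_self])⟩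
  rw [coeff_fmResolve] at hi'
  by_contra h
  simp only [Set.mem_union, not_or, Atom.vars, Set.mem_ofPred_eq, not_not] at h
  exact hi' (by rw [h.1, h.2]; ring)

theorem value_fmResolve (z : ℕ) (l u : Atom) (β : ℕ → ℝ) :
    (fmResolve z l u).value β =
      -(u.coeff z : ℝ) * l.value β + (l.coeff z : ℝ) * u.value β := by
  rw [(fmResolve z l u).value_eq_sum β (N := max l.coeffs.length u.coeffs.length)
      (by simp [fmResolve]), l.value_eq_sum β (le_max_left _ u.coeffs.length),
    u.value_eq_sum β (le_max_right l.coeffs.length _), mul_add, mul_add, Finset.mul_sum,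
    Finset.mul_sum]
  simp only [coeff_fmResolve]
  rw [add_add_add_comm, ← Finset.sum_add_distrib]
  congr 1
  · simp [fmResolve]
  · refine Finset.sum_congr rfl fun i _ => ?_
    push_cast
    ring

/-- Both weights, `-u.coeff z` and `l.coeff z`, are positive, so the combination is nonnegative, and
positive as soon as one of the two terms is. -/
theorem Atom.Holds.fmResolve {z : ℕ} {l u : Atom} {β : ℕ → ℝ} (hl : l.Holds β) (hu : u.Holds β)
    (hlz : 0 < l.coeff z) (huz : u.coeff z < 0) : (Ksmt.fmResolve z l u).Holds β := by
  unfold Atom.Holds at *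
  rw [value_fmResolve]
  have h1 : (0 : ℝ) < l.coeff z := by exact_mod_cast hlz
  have h2 : (0 : ℝ) < -(u.coeff z : ℝ) := by
    have : (u.coeff z : ℝ) < 0 := by exact_mod_cast huz
    linarith
  have hs : (Ksmt.fmResolve z l u).strict = (l.strict || u.strict) := rfl
  rw [hs]
  cases hls : l.strict <;> cases hus : u.strict <;> simp only [hls, hus, Rel] at hl hu ⊢ <;>
    simp at hl hu ⊢ <;> nlinarith [mul_nonneg h2.le (le_refl (0:ℝ)), mul_pos h1 h2]

/-! ### Assignments -/

theorem Assign.lookup_eq_none {α : Assign} {z : ℕ} (h : ¬ α.Assigned z) :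
    List.lookup z α = none := by
  rw [List.lookup_eq_none_iff]
  intro p hp
  simp only [bne_iff_ne, ne_eq]
  rintro rfl
  exact h (List.mem_map_of_mem hp)

theorem Assign.val_append {α : Assign} {z : ℕ} (h : α.Assigned z) (β : Assign) :
    (Assign.val (α ++ β) z) = α.val z := by
  unfold Assign.val
  rw [List.lookup_append]
  cases hl : List.lookup z α with
  | none =>
    rw [List.lookup_eq_none_iff] at hl
    obtain ⟨p, hp, rfl⟩ := List.mem_map.mp h
    simpa using hl p hp
  | some q => simp

theorem Assign.val_append_of_not {α : Assign} {z : ℕ} (h : ¬ α.Assigned z) (β : Assign) :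
    (Assign.val (α ++ β) z) = β.val z := by
  unfold Assign.val
  rw [List.lookup_append, Assign.lookup_eq_none h]
  simp

theorem Assign.val_singleton (z : ℕ) (q : ℚ) (i : ℕ) :
    Assign.val [(z, q)] i = if i = z then q else 0 := by
  unfold Assign.val
  by_cases h : i = z
  · simp [List.lookup, h]
  · have : (i == z) = false := by simpa using h
    simp [List.lookup, this, h]

theorem Assign.val_snoc {α : Assign} {z : ℕ} (h : ¬ α.Assigned z) (q : ℚ) (i : ℕ) :
    Assign.val (α ++ [(z, q)]) i = if i = z then q else α.val i := by
  by_cases hi : α.Assigned i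
  · rw [Assign.val_append hi, if_neg]
    rintro rfl
    exact h hi
  · rw [Assign.val_append_of_not hi, Assign.val_singleton]
    split_ifs with h1
    · rfl
    · unfold Assign.val; rw [Assign.lookup_eq_none hi]; rfl

theorem Assign.assigned_append {α β : Assign} {i : ℕ} :
    Assign.Assigned (α ++ β) i ↔ α.Assigned i ∨ β.Assigned i := by
  simp [Assign.Assigned, List.map_append, List.mem_append]

theorem Assign.assigned_singleton {z : ℕ} {q : ℚ} {i : ℕ} :
    Assign.Assigned [(z, q)] i ↔ i = z := by
  simp [Assign.Assigned]

theorem Atom.holds_append {α : Assign} (β : Assign) {a : Atom}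
    (h : ∀ i ∈ a.vars, α.Assigned i) :
    a.Holds (Assign.toReal (α ++ β)) ↔ a.Holds α.toReal :=
  a.holds_congr fun i hi => by simp [Assign.toReal, Assign.val_append (h i hi)]

theorem Atom.IsFalse.append {α : Assign} {a : Atom} (h : a.IsFalse α) (β : Assign) :
    a.IsFalse (α ++ β) :=
  ⟨fun i hi => Assign.assigned_append.mpr (Or.inl (h.1 i hi)),
    fun h' => h.2 ((Atom.holds_append β h.1).mp h')⟩

theorem Clause.IsFalse.append {α : Assign} {C : Clause} (h : Clause.IsFalse α C) (β : Assign) :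
    Clause.IsFalse (α ++ β) C := fun a ha => (h a ha).append β

/-- Falsity persists under extension, so the prefixes under which `L` is not false form an initial
segment; rule (B) only has to locate where falsity sets in. -/
theorem LinFalse.of_prefix {α β : Assign} {L : List Clause} (h : LinFalse α L) (hp : α <+: β) :
    LinFalse β L := by
  obtain ⟨γ, rfl⟩ := hp
  obtain ⟨C, hC, hf⟩ := h
  exact ⟨C, hC, hf.append γ⟩

theorem Clause.IsFalse.not_holds {α : Assign} {C : Clause} (h : Clause.IsFalse α C) :
    ¬ Clause.Holds C α.toReal := by
  rintro ⟨a, ha, hh⟩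
  exact (h a ha).2 hh

/-- Falsity under the empty assignment forces all atoms to be variable-free, and their truth values
are then the same at every `β`. -/
theorem Clause.IsFalse.not_holds_of_nil {C : Clause} (h : Clause.IsFalse [] C) (β : ℕ → ℝ) :
    ¬ Clause.Holds C β := by
  rintro ⟨a, ha, hh⟩
  refine (h a ha).2 ((a.holds_congr fun i hi => ?_).mp hh)
  simpa [Assign.Assigned] using (h a ha).1 i hi

theorem LinTrue.not_linFalse {α : Assign} {L : List Clause} (h : LinTrue α L) :
    ¬ LinFalse α L := by
  rintro ⟨C, hC, hf⟩
  obtain ⟨a, ha, ht⟩ := h C hC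
  exact (hf a ha).2 ht.2

theorem LinTrue.holds {α : Assign} {L : List Clause} (h : LinTrue α L) {C : Clause} (hC : C ∈ L) :
    Clause.Holds C α.toReal := by
  obtain ⟨a, ha, ht⟩ := h C hC
  exact ⟨a, ha, ht.2⟩

/-! ### Soundness of arithmetical resolution -/

theorem ResDerivable.sound {z : ℕ} {L : List Clause} {S : Set Atom} (h : ResDerivable z L S)
    {β : ℕ → ℝ} (hL : ∀ D ∈ L, Clause.Holds D β) : ∃ a ∈ S, a.Holds β := by
  induction h with
  | base hC => exact hL _ hC
  | @resolve C D l u _ _ hl hu hlz huz ih1 ih2 =>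
    obtain ⟨a, ha, hah⟩ := ih1
    obtain ⟨b, hb, hbh⟩ := ih2
    by_cases hal : a = l
    · by_cases hbu : b = u
      · subst hal hbu
        exact ⟨_, Or.inr rfl, hah.fmResolve hbh hlz huz⟩
      · exact ⟨b, Or.inl (Or.inr ⟨hb, hbu⟩), hbh⟩
    · exact ⟨a, Or.inl (Or.inl ⟨ha, hal⟩), hah⟩

/-- A combination on `z` no longer contains `z`, so it is never resolved upon again in the same
derivation. One application of (R) therefore adds only one level of combinations, which is what
bounds the atoms of a run. -/
theorem ResDerivable.mem {z : ℕ} {L : List Clause} {S : Set Atom} (h : ResDerivable z L S)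
    {a : Atom} (ha : a ∈ S) :
    (∃ C ∈ L, a ∈ C) ∨ ∃ l u : Atom, (∃ C ∈ L, l ∈ C) ∧ (∃ C ∈ L, u ∈ C) ∧
      l.coeff z ≠ 0 ∧ u.coeff z ≠ 0 ∧ a = fmResolve z l u := by
  induction h generalizing a with
  | base hC => exact Or.inl ⟨_, hC, ha⟩
  | @resolve C D l u _ _ hl hu hlz huz ih1 ih2 =>
    rcases ha with (ha | ha) | ha
    · exact ih1 ha.1
    · exact ih2 ha.1
    · refine Or.inr ⟨l, u, ?_, ?_, hlz.ne', huz.ne, ha⟩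
      · rcases ih1 hl with h | ⟨_, _, _, _, _, _, rfl⟩
        · exact h
        · rw [coeff_fmResolve_self] at hlz; exact absurd hlz (lt_irrefl _)
      · rcases ih2 hu with h | ⟨_, _, _, _, _, _, rfl⟩
        · exact h
        · rw [coeff_fmResolve_self] at huz; exact absurd huz (lt_irrefl _)

/-! ### Completeness of arithmetical resolution on one variable -/

/-- Derivations by resolution on `z` of clauses, as lists of atoms, from the clauses in `B`. -/
inductive Deriv (B : Clause → Prop) (z : ℕ) : Clause → Prop
  | base {C E : Clause} : B C → (∀ a, a ∈ E ↔ a ∈ C) → Deriv B z E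
  | resolve {C D E : Clause} {l u : Atom} : Deriv B z C → Deriv B z D → l ∈ C → u ∈ D →
      0 < l.coeff z → u.coeff z < 0 →
      (∀ a, a ∈ E ↔ a ∈ C ∧ a ≠ l ∨ a ∈ D ∧ a ≠ u ∨ a = fmResolve z l u) → Deriv B z E

theorem Deriv.congr {B : Clause → Prop} {z : ℕ} {C E : Clause} (h : Deriv B z C)
    (he : ∀ a, a ∈ E ↔ a ∈ C) : Deriv B z E := by
  cases h with
  | base hB h => exact .base hB fun a => (he a).trans (h a)
  | resolve h1 h2 h3 h4 h5 h6 h => exact .resolve h1 h2 h3 h4 h5 h6 fun a => (he a).trans (h a)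

theorem Deriv.resDerivable {B : Clause → Prop} {z : ℕ} {L : List Clause} (hB : ∀ C, B C → C ∈ L)
    {C : Clause} (h : Deriv B z C) : ResDerivable z L {a | a ∈ C} := by
  induction h with
  | @base C E hC hE =>
    have : {a | a ∈ E} = {a | a ∈ C} := Set.ext hE
    rw [this]
    exact .base (hB _ hC)
  | @resolve C D E l u _ _ hl hu hlz huz hE ih1 ih2 =>
    have : {a | a ∈ E} = ({a | a ∈ C} \ {l}) ∪ ({a | a ∈ D} \ {u}) ∪ {fmResolve z l u} := by
      ext a
      simp only [Set.mem_ofPred_eq, hE, Set.mem_union, Set.mem_sdiff, Set.mem_singleton_iff, or_assoc]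
    rw [this]
    exact .resolve ih1 ih2 hl hu hlz huz

theorem Deriv.sound {B : Clause → Prop} {z : ℕ} {C : Clause} (h : Deriv B z C)
    {β : ℕ → ℝ} (hL : ∀ D, B D → Clause.Holds D β) : Clause.Holds C β := by
  induction h with
  | base hC hE =>
    obtain ⟨a, ha, h⟩ := hL _ hC
    exact ⟨a, (hE a).mpr ha, h⟩
  | @resolve C D E l u _ _ hl hu hlz huz hE ih1 ih2 =>
    obtain ⟨a, ha, hah⟩ := ih1
    obtain ⟨b, hb, hbh⟩ := ih2
    by_cases hal : a = l
    · by_cases hbu : b = u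
      · subst hal hbu
        exact ⟨_, (hE _).mpr (Or.inr (Or.inr rfl)), hah.fmResolve hbh hlz huz⟩
      · exact ⟨b, (hE _).mpr (Or.inr (Or.inl ⟨hb, hbu⟩)), hbh⟩
    · exact ⟨a, (hE _).mpr (Or.inl ⟨ha, hal⟩), hah⟩

/-- All upper bounds of `C` can be resolved against one lower bound of a clause without upper
bounds. -/
theorem Deriv.elim_lower {B : Clause → Prop} {z : ℕ} {C D : Clause} {l : Atom}
    (hD : Deriv B z D) (hlD : l ∈ D) (hl : 0 < l.coeff z) (hup : ∀ a ∈ D, 0 ≤ a.coeff z)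
    (hC : Deriv B z C) :
    ∃ E, Deriv B z E ∧ ∀ a ∈ E, a ∈ D ∧ a ≠ l ∨ a ∈ C ∧ 0 ≤ a.coeff z ∨
      ∃ u ∈ C, u.coeff z < 0 ∧ a = fmResolve z l u := by
  -- Induction on the number of distinct upper bounds left in `C'`. Resolving some `u` against `l`
  -- removes `u` and brings in no upper bound: `D` has none, and the new atom is free of `z`.
  have key : ∀ n, ∀ C', Deriv B z C' → (C'.toFinset.filter fun a => a.coeff z < 0).card = n →
      (∀ a ∈ C', a ∈ D ∧ a ≠ l ∨ a ∈ C ∨ ∃ u ∈ C, u.coeff z < 0 ∧ a = fmResolve z l u) →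
      ∃ E, Deriv B z E ∧ ∀ a ∈ E, a ∈ D ∧ a ≠ l ∨ a ∈ C ∧ 0 ≤ a.coeff z ∨
        ∃ u ∈ C, u.coeff z < 0 ∧ a = fmResolve z l u := by
    intro n
    induction n using Nat.strong_induction_on with
    | _ n ih =>
    intro C' hC' hn hsub
    by_cases hex : ∃ u ∈ C', u.coeff z < 0
    · obtain ⟨u, hu, huz⟩ := hex
      have huC : u ∈ C := by
        rcases hsub u hu with h | h | ⟨v, _, _, rfl⟩
        · exact absurd (hup u h.1) (not_le.mpr huz)
        · exact h
        · rw [coeff_fmResolve_self] at huz; exact absurd huz (lt_irrefl _)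
      have hmem : ∀ a, a ∈ fmResolve z l u :: (D.filter (· ≠ l) ++ C'.filter (· ≠ u)) ↔
          a ∈ D ∧ a ≠ l ∨ a ∈ C' ∧ a ≠ u ∨ a = fmResolve z l u := by
        intro a
        simp only [List.mem_cons, List.mem_append, List.mem_filter, decide_eq_true_eq]
        tauto
      refine ih _ ?_ _ (.resolve hD hC' hlD hu hl huz hmem) rfl ?_
      · rw [← hn]
        refine Finset.card_lt_card ⟨?_, fun hcon => ?_⟩
        · intro a ha
          simp only [Finset.mem_filter, List.mem_toFinset, hmem] at ha ⊢
          refine ⟨?_, ha.2⟩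
          rcases ha.1 with h | h | rfl
          · exact absurd (hup a h.1) (not_le.mpr ha.2)
          · exact h.1
          · rw [coeff_fmResolve_self] at ha; exact absurd ha.2 (lt_irrefl _)
        · have : u ∈ C'.toFinset.filter fun a => a.coeff z < 0 := by simp [hu, huz]
          have := hcon this
          simp only [Finset.mem_filter, List.mem_toFinset, hmem] at this
          rcases this.1 with h | h | h
          · exact absurd (hup u h.1) (not_le.mpr huz)
          · exact h.2 rfl
          · rw [h, coeff_fmResolve_self] at huz; exact absurd huz (lt_irrefl _)
      · intro a ha
        rcases (hmem a).mp ha with h | h | rfl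
        · exact Or.inl h
        · exact hsub a h.1
        · exact Or.inr (Or.inr ⟨u, huC, huz, rfl⟩)
    · push Not at hex
      refine ⟨C', hC', fun a ha => ?_⟩
      rcases hsub a ha with h | h | h
      · exact Or.inl h
      · exact Or.inr (Or.inl ⟨h, hex a ha⟩)
      · exact Or.inr (Or.inr h)
  exact key _ C hC rfl fun a ha => Or.inr (Or.inl ha)

/-- All upper bounds of `C` can be resolved against a set of lower bounds of a clause without upper
bounds. -/
theorem Deriv.elim_lowers {B : Clause → Prop} {z : ℕ} {C D : Clause}
    (hD : Deriv B z D) (hup : ∀ a ∈ D, 0 ≤ a.coeff z) (hC : Deriv B z C) (τ : Atom → Prop)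
    (hτ : ∀ a, τ a → 0 < a.coeff z) (hCτ : ∀ a ∈ C, ¬ τ a) :
    ∃ E, Deriv B z E ∧ ∀ a ∈ E, a ∈ D ∧ ¬ τ a ∨ a ∈ C ∧ 0 ≤ a.coeff z ∨
      ∃ l ∈ D, τ l ∧ ∃ u ∈ C, u.coeff z < 0 ∧ a = fmResolve z l u := by
  classical
  -- Induction on the number of distinct `τ`-atoms left in `D'`. `elim_lower` removes one of them
  -- and adds none: atoms of `C` do not satisfy `τ`, and combinations do not contain `z`.
  have key : ∀ n, ∀ D', Deriv B z D' → (D'.toFinset.filter τ).card = n →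
      (∀ a ∈ D', a ∈ D ∨ a ∈ C ∧ 0 ≤ a.coeff z ∨
        ∃ l ∈ D, τ l ∧ ∃ u ∈ C, u.coeff z < 0 ∧ a = fmResolve z l u) →
      ∃ E, Deriv B z E ∧ ∀ a ∈ E, a ∈ D ∧ ¬ τ a ∨ a ∈ C ∧ 0 ≤ a.coeff z ∨
        ∃ l ∈ D, τ l ∧ ∃ u ∈ C, u.coeff z < 0 ∧ a = fmResolve z l u := by
    intro n
    induction n using Nat.strong_induction_on with
    | _ n ih =>
    intro D' hD' hn hsub
    by_cases hex : ∃ l ∈ D', τ l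
    · obtain ⟨l, hl, hlτ⟩ := hex
      have hlD : l ∈ D := by
        rcases hsub l hl with h | h | ⟨_, _, _, _, _, _, rfl⟩
        · exact h
        · exact absurd hlτ (hCτ l h.1)
        · have := hτ _ hlτ
          rw [coeff_fmResolve_self] at this; exact absurd this (lt_irrefl _)
      have hup' : ∀ a ∈ D', 0 ≤ a.coeff z := by
        intro a ha
        rcases hsub a ha with h | h | ⟨_, _, _, _, _, _, rfl⟩
        · exact hup a h
        · exact h.2
        · rw [coeff_fmResolve_self]
      obtain ⟨E, hE, hEsub⟩ := hD'.elim_lower hl (hτ l hlτ) hup' hC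
      refine ih _ ?_ E hE rfl ?_
      · rw [← hn]
        have hsub' : E.toFinset.filter τ ⊆ (D'.toFinset.filter τ).erase l := by
          intro a ha
          simp only [Finset.mem_filter, List.mem_toFinset, Finset.mem_erase] at ha ⊢
          rcases hEsub a ha.1 with h | h | ⟨u, _, _, rfl⟩
          · exact ⟨h.2, h.1, ha.2⟩
          · exact absurd ha.2 (hCτ a h.1)
          · have := hτ _ ha.2
            rw [coeff_fmResolve_self] at this; exact absurd this (lt_irrefl _)
        refine (Finset.card_le_card hsub').trans_lt (Finset.card_erase_lt_of_mem ?_)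
        simp [hl, hlτ]
      · intro a ha
        rcases hEsub a ha with h | h | h
        · exact hsub a h.1
        · exact Or.inr (Or.inl h)
        · exact Or.inr (Or.inr ⟨l, hlD, hlτ, h⟩)
    · push Not at hex
      refine ⟨D', hD', fun a ha => ?_⟩
      rcases hsub a ha with h | h
      · exact Or.inl ⟨h, hex a ha⟩
      · exact Or.inr h
  exact key _ D hD rfl fun a ha => Or.inl ha

/-- Provides a rational playing the role of `t + ε`: no member of the finite list lies above `t`
without lying above `q`. -/
theorem exists_gt_forall_lt (l : List ℚ) (t : ℚ) : ∃ q, t < q ∧ ∀ s ∈ l, t < s → q < s := by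
  induction l with
  | nil => exact ⟨t + 1, by linarith, by simp⟩
  | cons a l ih =>
    obtain ⟨q, hq, h⟩ := ih
    by_cases hat : t < a
    · obtain ⟨r, hr1, hr2⟩ := exists_between (lt_min hq hat)
      rw [lt_min_iff] at hr2
      refine ⟨r, hr1, fun s hs hts => ?_⟩
      rcases List.mem_cons.mp hs with rfl | hs
      · exact hr2.2
      · exact hr2.1.trans (h s hs hts)
    · refine ⟨q, hq, fun s hs hts => ?_⟩
      rcases List.mem_cons.mp hs with rfl | hs
      · exact absurd hts hat
      · exact h s hs hts

theorem exists_lt_forall (l : List ℚ) : ∃ q : ℚ, ∀ s ∈ l, q < s := by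
  induction l with
  | nil => exact ⟨0, by simp⟩
  | cons a l ih =>
    obtain ⟨q, h⟩ := ih
    refine ⟨min q a - 1, fun s hs => ?_⟩
    rcases List.mem_cons.mp hs with rfl | hs
    · linarith [min_le_right q s]
    · linarith [min_le_left q a, h s hs]

end Ksmt

namespace Ksmt

/-- The falsity at the value `q` of `z` of the atom `a`, whose linear term is `T a + a.coeff z * z`. -/
def FalseAt (T : Atom → ℚ) (z : ℕ) (q : ℚ) (a : Atom) : Prop :=
  ¬ Rel a.strict (T a + a.coeff z * q)

/-- The strength of a lower bound on `z`. -/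
def lowerKey (T : Atom → ℚ) (z : ℕ) (a : Atom) : ℚ ×ₗ Bool :=
  toLex (-T a / a.coeff z, a.strict)

/-- A sweep over the values of `z` from below. The current clause `D` has no upper bounds on `z`,
its `z`-free atoms are false, and its lower bounds are input atoms. At the first value `q` where the
weakest lower bound `l0` of `D` becomes true, some input clause `C` is false. Resolving the upper
bounds of `C` against the lower bounds of `D` as weak as `l0` gives a clause of the same kind whose
lower bounds are all stronger than `l0`. As only finitely many input atoms exist, eventually no
lower bound is left. -/
theorem Deriv.exists_conflict {z : ℕ} {L : List Clause} {T : Atom → ℚ} {Ev : Atom → Prop}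
    (hT : ∀ l u, T (fmResolve z l u) = -u.coeff z * T l + l.coeff z * T u)
    (hEv : ∀ l u, Ev l → Ev u → Ev (fmResolve z l u))
    (H : ∀ q, ∃ C ∈ L, ∀ a ∈ C, Ev a ∧ FalseAt T z q a) :
    ∃ D, Deriv (fun C => C ∈ L ∧ ∃ q, ∀ a ∈ C, Ev a ∧ FalseAt T z q a) z D ∧
      ∀ a ∈ D, Ev a ∧ a.coeff z = 0 ∧ FalseAt T z 0 a := by
  classical
  set B : Clause → Prop := fun C => C ∈ L ∧ ∃ q, ∀ a ∈ C, Ev a ∧ FalseAt T z q a with hB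
  set A := L.flatten with hA
  have hBA : ∀ {C a}, C ∈ L → a ∈ C → a ∈ A := fun hC ha => List.mem_flatten.mpr ⟨_, hC, ha⟩
  have free : ∀ {a q}, a.coeff z = 0 → FalseAt T z q a → FalseAt T z 0 a := by
    intro a q h hf
    simpa [FalseAt, h] using hf
  set Good : Clause → Prop := fun D => Deriv B z D ∧ ∀ a ∈ D, Ev a ∧ 0 ≤ a.coeff z ∧
    (a.coeff z = 0 → FalseAt T z 0 a) ∧ (0 < a.coeff z → a ∈ A) with hGood
  set m : Clause → Finset Atom := fun D => A.toFinset.filter fun a => 0 < a.coeff z ∧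
    ∃ l ∈ D, 0 < l.coeff z ∧ lowerKey T z l ≤ lowerKey T z a with hm
  have start : ∃ D, Good D := by
    -- Below all thresholds every upper bound is true, so the clause false there contains none.
    -- Atoms without `z` contribute the harmless entry `0`, the value of a division by zero.
    obtain ⟨q, hq⟩ := exists_lt_forall (A.map fun a => -T a / a.coeff z)
    obtain ⟨C, hC, hf⟩ := H q
    refine ⟨C, .base ⟨hC, q, hf⟩ fun _ => Iff.rfl, fun a ha =>
      ⟨(hf a ha).1, ?_, fun h => free h (hf a ha).2, fun _ => hBA hC ha⟩⟩
    by_contra hneg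
    push Not at hneg
    have h1 : q < -T a / a.coeff z := hq _ (List.mem_map_of_mem (hBA hC ha))
    rw [lt_div_iff_of_neg hneg] at h1
    refine (hf a ha).2 ?_
    unfold Rel
    split_ifs <;> linarith
  have step : ∀ n, ∀ D, Good D → (m D).card = n →
      ∃ D, Good D ∧ ∀ a ∈ D, a.coeff z = 0 := by
    intro n
    induction n using Nat.strong_induction_on with
    | _ n ih =>
    intro D hD hn
    by_cases hex : ∃ l ∈ D, 0 < l.coeff z
    swap
    · push Not at hex
      exact ⟨D, hD, fun a ha => le_antisymm (hex a ha) (hD.2 a ha).2.1⟩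
    obtain ⟨l0, hl0, hmin⟩ := Finset.exists_min_image (D.toFinset.filter fun l => 0 < l.coeff z)
      (lowerKey T z) (by obtain ⟨l, hl, hlz⟩ := hex; exact ⟨l, by simp [hl, hlz]⟩)
    simp only [Finset.mem_filter, List.mem_toFinset] at hl0 hmin
    set t : ℚ := -T l0 / l0.coeff z with ht
    obtain ⟨q1, hq1, hq1'⟩ := exists_gt_forall_lt (A.map fun a => -T a / a.coeff z) t
    -- The place where `l0` starts to be true: its threshold, or a point just above it if `l0` is
    -- strict.
    set q : ℚ := if l0.strict = true then q1 else t with hq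
    obtain ⟨C, hC, hf⟩ := H q
    have hCB : Deriv B z C := .base ⟨hC, q, hf⟩ fun _ => Iff.rfl
    -- A lower bound false at `q`, where `l0` is true, is strictly stronger than `l0`. At equal
    -- thresholds the strict atom is the stronger one, since `false < true`.
    have keyC : ∀ a ∈ C, 0 < a.coeff z → lowerKey T z l0 < lowerKey T z a := by
      intro a ha haz
      have hfa := (hf a ha).2
      rw [lowerKey, lowerKey, Prod.Lex.toLex_lt_toLex]
      change t < _ ∨ t = _ ∧ _
      unfold FalseAt Rel at hfa
      by_cases hs : l0.strict = true
      · left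
        rw [hq, if_pos hs] at hfa
        have : q1 ≤ -T a / a.coeff z := by
          rw [le_div_iff₀ haz]
          split_ifs at hfa <;> linarith
        exact hq1.trans_le this
      · rw [hq, if_neg hs] at hfa
        by_cases hsa : a.strict = true
        · rw [if_pos hsa] at hfa
          have : t ≤ -T a / a.coeff z := by
            rw [le_div_iff₀ haz]; linarith
          rcases this.lt_or_eq with h | h
          · exact Or.inl h
          · refine Or.inr ⟨h, ?_⟩
            change l0.strict < a.strict
            simp [hsa, Bool.eq_false_iff.mpr hs]
        · rw [if_neg hsa] at hfa
          left
          rw [lt_div_iff₀ haz]; linarith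
    obtain ⟨E, hE, hsub⟩ := hD.1.elim_lowers (fun a ha => (hD.2 a ha).2.1) hCB
      (fun a => 0 < a.coeff z ∧ lowerKey T z a = lowerKey T z l0) (fun a h => h.1)
      (fun a ha h => absurd (keyC a ha h.1) (by rw [h.2]; exact lt_irrefl _))
    have hEgood : Good E := by
      refine ⟨hE, fun a ha => ?_⟩
      rcases hsub a ha with h | h | ⟨l, hlD, hlτ, u, huC, huz, rfl⟩
      · exact hD.2 a h.1
      · exact ⟨(hf a h.1).1, h.2, fun h0 => free h0 (hf a h.1).2, fun _ => hBA hC h.1⟩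
      · refine ⟨hEv _ _ (hD.2 l hlD).1 (hf u huC).1, (coeff_fmResolve_self z l u).ge, fun _ => ?_,
          fun h => absurd h (by rw [coeff_fmResolve_self]; exact lt_irrefl _)⟩
        have hkey := hlτ.2
        rw [lowerKey, lowerKey, toLex_inj, Prod.mk.injEq] at hkey
        have hTl : T l = -(l.coeff z * t) := by
          have h1 := hkey.1
          rw [← ht, div_eq_iff hlτ.1.ne'] at h1
          linarith
        have hfu := (hf u huC).2
        unfold FalseAt at hfu ⊢
        -- The linear term of `l` vanishes at `t`, so the combination is a positive multiple of the
        -- value of `u` at `t`.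
        have hval : T (fmResolve z l u) + (fmResolve z l u).coeff z * 0 =
            l.coeff z * (T u + u.coeff z * t) := by
          rw [hT, hTl]; ring
        rw [hval]
        have hstr : (fmResolve z l u).strict = (l0.strict || u.strict) := by
          rw [← hkey.2]; rfl
        rw [hstr]
        by_cases hs : l0.strict = true
        · rw [hq, if_pos hs] at hfu
          -- If the threshold of `u` exceeded `t`, it would exceed `q1` and `u` would be true at
          -- `q1`. At `t` this leaves only the value `≤ 0`, which suffices because the combination
          -- is strict.
          have h1 : -T u / u.coeff z ≤ t := by
            by_contra hcon
            push Not at hcon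
            have h2 : q1 < -T u / u.coeff z := hq1' _ (List.mem_map_of_mem (hBA hC huC)) hcon
            rw [lt_div_iff_of_neg huz] at h2
            refine hfu ?_
            unfold Rel
            split_ifs <;> linarith
          rw [div_le_iff_of_neg huz] at h1
          have h3 : l.coeff z * (T u + u.coeff z * t) ≤ 0 :=
            mul_nonpos_of_nonneg_of_nonpos hlτ.1.le (by linarith)
          simp [Rel, hs, h3]
        · rw [hq, if_neg hs] at hfu
          rw [Bool.eq_false_iff.mpr hs, Bool.false_or]
          unfold Rel at hfu ⊢
          split_ifs at hfu ⊢
          · rwa [mul_pos_iff_of_pos_left hlτ.1]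
          · rwa [mul_nonneg_iff_of_pos_left hlτ.1]
    refine ih _ ?_ E hEgood rfl
    rw [← hn]
    have hlow : ∀ l ∈ E, 0 < l.coeff z → lowerKey T z l0 < lowerKey T z l := by
      intro l hl hlz
      rcases hsub l hl with h | h | ⟨_, _, _, _, _, _, rfl⟩
      · exact lt_of_le_of_ne (hmin l ⟨h.1, hlz⟩) fun he => h.2 ⟨hlz, he.symm⟩
      · exact keyC l h.1 hlz
      · rw [coeff_fmResolve_self] at hlz; exact absurd hlz (lt_irrefl _)
    -- The measure counts the input lower bounds at least as strong as some lower bound of the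
    -- clause; it drops because `l0` is no longer counted.
    refine Finset.card_lt_card ⟨?_, fun hcon => ?_⟩
    · intro a ha
      simp only [hm, Finset.mem_filter] at ha ⊢
      obtain ⟨h1, h2, l, hl, hlz, hle⟩ := ha
      exact ⟨h1, h2, l0, hl0.1, hl0.2, (hlow l hl hlz).le.trans hle⟩
    · have h0 : l0 ∈ m D := by
        simp only [hm, Finset.mem_filter, List.mem_toFinset]
        exact ⟨(hD.2 l0 hl0.1).2.2.2 hl0.2, hl0.2, l0, hl0.1, hl0.2, le_refl _⟩
      have h1 := hcon h0
      simp only [hm, Finset.mem_filter, List.mem_toFinset] at h1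
      obtain ⟨_, _, l, hl, hlz, hle⟩ := h1
      exact absurd (hlow l hl hlz) (not_lt.mpr hle)
  obtain ⟨D0, hD0⟩ := start
  obtain ⟨D, hD, hz⟩ := step _ D0 hD0 rfl
  exact ⟨D, hD.1, fun a ha => ⟨(hD.2 a ha).1, hz a ha, (hD.2 a ha).2.2.1 (hz a ha)⟩⟩

/-- The clauses of `L` that are false for some value of `z`. -/
def ConflictBase (α : Assign) (L : List Clause) (z : ℕ) (C : Clause) : Prop :=
  C ∈ L ∧ ∃ q : ℚ, Clause.IsFalse (α ++ [(z, q)]) C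

theorem Atom.qvalue_snoc {α : Assign} {z : ℕ} (hz : ¬ α.Assigned z) (a : Atom) (q : ℚ) :
    a.qvalue (Assign.val (α ++ [(z, q)])) =
      a.qvalue (Assign.val (α ++ [(z, 0)])) + a.coeff z * q := by
  have h1 : ∀ v : ℕ → ℚ, ∀ N, a.coeffs.length ≤ N →
      a.qvalue v = a.const + ∑ i ∈ Finset.range N, a.coeff i * v i := by
    intro v N hN
    have := a.value_eq_sum (fun i => (v i : ℝ)) hN
    rw [a.value_cast] at this
    exact_mod_cast this
  have hN := le_max_left a.coeffs.length (z + 1)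
  rw [h1 _ _ hN, h1 _ _ hN, add_assoc]
  congr 1
  have h2 : ∀ i, a.coeff i * Assign.val (α ++ [(z, q)]) i =
      a.coeff i * Assign.val (α ++ [(z, 0)]) i + if i = z then a.coeff z * q else 0 := by
    intro i
    rw [Assign.val_snoc hz, Assign.val_snoc hz]
    split_ifs with h
    · rw [h]; ring
    · ring
  simp only [h2]
  rw [Finset.sum_add_distrib, Finset.sum_ite_eq' (Finset.range _) z,
    if_pos (Finset.mem_range.mpr (by omega))]

/-- The value of an atom is affine in `z`, and `T` is its value at `z ↦ 0`. The predicate `Ev` says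
that every variable other than `z` is assigned, which combinations inherit. -/
theorem exists_conflict_clause {α : Assign} {L : List Clause} {z : ℕ} (hz : ¬ α.Assigned z)
    (H : ∀ q : ℚ, LinFalse (α ++ [(z, q)]) L) :
    ∃ D : Clause, Deriv (ConflictBase α L z) z D ∧ D.Nodup ∧ z ∉ Clause.vars D ∧
      Clause.IsFalse α D := by
  set T : Atom → ℚ := fun a => a.qvalue (Assign.val (α ++ [(z, 0)])) with hT
  set Ev : Atom → Prop := fun a => ∀ i ∈ a.vars, α.Assigned i ∨ i = z with hEv
  have hFalse : ∀ q a, a.IsFalse (α ++ [(z, q)]) ↔ Ev a ∧ FalseAt T z q a := by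
    intro q a
    unfold Atom.IsFalse FalseAt
    rw [Atom.holds_toReal, Atom.qvalue_snoc hz]
    simp only [hEv, Assign.assigned_append, Assign.assigned_singleton]
    rfl
  have hFalseC : ∀ q C, Clause.IsFalse (α ++ [(z, q)]) C ↔ ∀ a ∈ C, Ev a ∧ FalseAt T z q a :=
    fun q C => forall₂_congr fun a _ => hFalse q a
  obtain ⟨D, hD, hDf⟩ := Deriv.exists_conflict (z := z) (L := L) (T := T) (Ev := Ev)
    (fun l u => by
      have h := value_fmResolve z l u (Assign.val (α ++ [(z, 0)]) · : ℕ → ℝ)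
      rw [Atom.value_cast, Atom.value_cast, Atom.value_cast] at h
      exact_mod_cast h)
    (fun l u hl hu i hi => by
      rcases (vars_fmResolve_subset z l u hi).1 with h | h
      · exact hl i h
      · exact hu i h)
    (fun q => by
      obtain ⟨C, hC, hf⟩ := H q
      exact ⟨C, hC, (hFalseC q C).mp hf⟩)
  have hbase : (fun C => C ∈ L ∧ ∃ q, ∀ a ∈ C, Ev a ∧ FalseAt T z q a) = ConflictBase α L z := by
    funext C
    simp only [ConflictBase, hFalseC]
  rw [hbase] at hD
  refine ⟨D.dedup, hD.congr fun a => List.mem_dedup, D.nodup_dedup, ?_, ?_⟩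
  · rintro ⟨a, ha, haz⟩
    exact haz (hDf a (List.mem_dedup.mp ha)).2.1
  · intro a ha
    obtain ⟨h1, h2, h3⟩ := hDf a (List.mem_dedup.mp ha)
    have hv : ∀ i ∈ a.vars, α.Assigned i := fun i hi => (h1 i hi).resolve_right fun h =>
      hi (by rw [h]; exact h2)
    exact ⟨hv, fun h => ((hFalse 0 a).mpr ⟨h1, h3⟩).2 ((Atom.holds_append _ hv).mpr h)⟩

theorem Deriv.isResolvent {α : Assign} {L : List Clause} {z : ℕ} {D : Clause}
    (h : Deriv (ConflictBase α L z) z D) (hn : D.Nodup) (hz : z ∉ Clause.vars D)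
    (hf : Clause.IsFalse α D) : IsResolvent α L z [D] := by
  refine ⟨by simp, fun C hC => ?_⟩
  rw [List.mem_singleton] at hC
  subst hC
  have hr : ResDerivable z L {a | a ∈ C} := h.resDerivable fun _ h => h.1
  exact ⟨hz, fun β hβ => hr.sound hβ, hf, hn, hr⟩

/-- If `L` were not false at `z ↦ q`, the conflict clauses, all of whose variables are assigned
there, would be true, and by soundness so would `D`. The premise of (R) about all rational `q` is
thus certified by a finite derivation, which can be searched for. -/
theorem Deriv.linFalse_snoc {α : Assign} {L : List Clause} {z : ℕ} {D : Clause}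
    (h : Deriv (ConflictBase α L z) z D) (hf : Clause.IsFalse α D) (q : ℚ) :
    LinFalse (α ++ [(z, q)]) L := by
  by_contra hcon
  refine (hf.append [(z, q)]).not_holds (h.sound fun C hC => ?_)
  obtain ⟨hCL, q', hq'⟩ := hC
  have hnf : ¬ Clause.IsFalse (α ++ [(z, q)]) C := fun hf => hcon ⟨C, hCL, hf⟩
  unfold Clause.IsFalse at hnf
  push Not at hnf
  obtain ⟨a, ha, hna⟩ := hnf
  refine ⟨a, ha, ?_⟩
  by_contra hh
  refine hna ⟨fun i hi => ?_, hh⟩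
  have := (hq' a ha).1 i hi
  rw [Assign.assigned_append, Assign.assigned_singleton] at this ⊢
  exact this

end Ksmt

namespace Ksmt

/-! ### Sequences in which each entry is justified by the preceding ones -/

/-- Each entry of the list is related by `J` to the list of the preceding entries. -/
def Hist {X : Type*} (J : List X → X → Prop) (l : List X) : Prop :=
  ∀ i x, l[i]? = some x → J (l.take i) x

theorem Hist.nil {X : Type*} (J : List X → X → Prop) : Hist J [] := by
  intro i x h; simp at h

theorem hist_snoc {X : Type*} {J : List X → X → Prop} {l : List X} {x : X} :
    Hist J (l ++ [x]) ↔ Hist J l ∧ J l x := by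
  constructor
  · intro h
    refine ⟨fun i y hy => ?_, ?_⟩
    · have hi : i < l.length := by
        by_contra hc
        rw [List.getElem?_eq_none (not_lt.mp hc)] at hy
        simp at hy
      have := h i y (by rw [List.getElem?_append_left hi, hy])
      rwa [List.take_append_of_le_length hi.le] at this
    · have := h l.length x (by simp)
      simpa using this
  · rintro ⟨h1, h2⟩ i y hy
    rcases lt_trichotomy i l.length with hi | hi | hi
    · rw [List.getElem?_append_left hi] at hy
      rw [List.take_append_of_le_length hi.le]
      exact h1 i y hy
    · subst hi
      have hxy : x = y := by simpa using hy
      subst hxy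
      simpa using h2
    · rw [List.getElem?_eq_none (by simp; omega)] at hy
      simp at hy

theorem asks_iff_hist {M : Nat.Partrec.Code} {k : ℕ} {φ : ℕ → Fin k → ℚ} {p : ℕ} {qs : List ℕ} :
    Asks M φ p qs ↔ Hist (fun l m => Moves M p (answers φ l) (Sum.inl m)) qs := by
  constructor
  · intro h
    induction h with
    | start => exact .nil _
    | query _ hm ih => exact hist_snoc.mpr ⟨ih, hm⟩
  · induction qs using List.reverseRecOn with
    | nil => exact fun _ => .start
    | append_singleton l m ih =>
      intro h
      rw [hist_snoc] at h
      exact .query (ih h.1) h.2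

/-! ### Runs of oracle machines -/

theorem Moves.unique {M : Nat.Partrec.Code} {p : ℕ} {h : List (List RCode)} {a b : ℕ ⊕ RCode}
    (ha : Moves M p h a) (hb : Moves M p h b) : a = b :=
  Encodable.encode_injective (Part.mem_unique ha hb)

/-- Determinism: with the same answers so far the next move is forced, and a machine that halts
poses no further query. -/
theorem Outputs.prefix_of_asks {M : Nat.Partrec.Code} {k : ℕ} {φ : ℕ → Fin k → ℚ} {p : ℕ}
    {qs : List ℕ} {y : ℚ} (h : Outputs M φ p qs y) {qs' : List ℕ} (h' : Asks M φ p qs') :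
    qs' <+: qs := by
  induction h' with
  | start => exact List.nil_prefix
  | @query l m _ hm ih =>
    obtain ⟨t, rfl⟩ := ih
    obtain ⟨ha, c, hc, _⟩ := h
    cases t with
    | nil =>
      rw [List.append_nil] at hc
      cases hm.unique hc
    | cons m' t =>
      have h1 := asks_iff_hist.mp ha l.length m' (by simp)
      rw [List.take_left'  rfl] at h1
      cases hm.unique h1
      exact ⟨t, by simp⟩

theorem Outputs.unique {M : Nat.Partrec.Code} {k : ℕ} {φ : ℕ → Fin k → ℚ} {p : ℕ}
    {qs qs' : List ℕ} {y y' : ℚ} (h : Outputs M φ p qs y) (h' : Outputs M φ p qs' y') :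
    qs = qs' ∧ y = y' := by
  have hq : qs = qs' := (h'.prefix_of_asks h.1).eq_of_length_le (h.prefix_of_asks h'.1).length_le
  subst hq
  obtain ⟨_, c, hc, rfl⟩ := h
  obtain ⟨_, c', hc', rfl⟩ := h'
  cases hc.unique hc'
  exact ⟨rfl, rfl⟩

theorem answers_congr {k : ℕ} {φ ψ : ℕ → Fin k → ℚ} {qs : List ℕ} (h : ∀ m ∈ qs, φ m = ψ m) :
    answers φ qs = answers ψ qs := by
  unfold answers
  exact List.map_congr_left fun m hm => by rw [h m hm]

theorem Asks.congr {M : Nat.Partrec.Code} {k : ℕ} {φ ψ : ℕ → Fin k → ℚ} {p : ℕ}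
    {qs : List ℕ} (h : Asks M φ p qs) (hφ : ∀ m ∈ qs, φ m = ψ m) : Asks M ψ p qs := by
  induction h with
  | start => exact .start
  | @query l m _ hm ih =>
    have h' : ∀ m ∈ l, φ m = ψ m := fun i hi => hφ i (List.mem_append_left _ hi)
    exact .query (ih h') (by rwa [← answers_congr h'])

/-- The run sees its oracle only through the answers to the queries actually posed. -/
theorem Outputs.congr {M : Nat.Partrec.Code} {k : ℕ} {φ ψ : ℕ → Fin k → ℚ} {p : ℕ}
    {qs : List ℕ} {y : ℚ} (h : Outputs M φ p qs y) (hφ : ∀ m ∈ qs, φ m = ψ m) :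
    Outputs M ψ p qs y := by
  obtain ⟨h1, c, hc, hy⟩ := h
  exact ⟨h1.congr hφ, c, by rwa [← answers_congr hφ], hy⟩

theorem le_foldr_max {l : List ℕ} {m : ℕ} (h : m ∈ l) : m ≤ l.foldr max 0 := by
  induction l with
  | nil => simp at h
  | cons a l ih =>
    rcases List.mem_cons.mp h with rfl | h
    · exact le_max_left _ _
    · exact (ih h).trans (le_max_right _ _)

/-! ### Names -/

theorem abs_approx_sub_le_real {rnd : ℚ → ℤ} (h : ∀ q : ℚ, |(rnd q : ℚ) - q| ≤ 1 / 2) (q : ℚ)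
    (m : ℕ) : |(approx rnd q m : ℝ) - q| ≤ (1 / 2 : ℝ) ^ (m + 2) := by
  have h0 : ((|approx rnd q m - q| : ℚ) : ℝ) ≤ ((1 / 2 ^ (m + 2) : ℚ) : ℝ) :=
    Rat.cast_le.mpr (abs_approx_sub_le h q m)
  push_cast at h0
  rwa [one_div_pow]

theorem isName_approx {rnd : ℚ → ℤ} (h : ∀ q : ℚ, |(rnd q : ℚ) - q| ≤ 1 / 2) {k : ℕ}
    (x : Fin k → ℚ) : IsName (fun m j => approx rnd (x j) m) (fun j => (x j : ℝ)) := by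
  intro m
  rw [pi_norm_le_iff_of_nonneg (by positivity)]
  intro j
  rw [Pi.sub_apply, Real.norm_eq_abs]
  exact (abs_approx_sub_le_real h _ _).trans
    (pow_le_pow_of_le_one (by norm_num) (by norm_num) (by omega))

/-- A name of a point may be replaced up to index `k` by approximations of a point close to it. -/
theorem isName_glue {rnd : ℚ → ℤ} (h : ∀ q : ℚ, |(rnd q : ℚ) - q| ≤ 1 / 2) {k : ℕ}
    (x : Fin k → ℚ) (y : Fin k → ℝ) (K : ℕ)
    (hxy : ∀ j, |y j - x j| < (1 / 2) ^ (K + 1)) :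
    ∃ ψ : ℕ → Fin k → ℚ, IsName ψ y ∧ ∀ m ≤ K, ψ m = fun j => approx rnd (x j) m := by
  have hex : ∀ (m : ℕ) (j : Fin k), ∃ q : ℚ, |(q : ℝ) - y j| ≤ (1 / 2 : ℝ) ^ m := by
    intro m j
    obtain ⟨q, hq1, hq2⟩ := exists_rat_btwn (show y j < y j + (1 / 2 : ℝ) ^ m by
      linarith [show (0 : ℝ) < (1 / 2 : ℝ) ^ m by positivity])
    exact ⟨q, by rw [abs_le]; constructor <;> linarith [show (0 : ℝ) < (1 / 2 : ℝ) ^ m by positivity]⟩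
  choose χ hχ using hex
  refine ⟨fun m => if m ≤ K then fun j => approx rnd (x j) m else χ m, fun m => ?_,
    fun m hm => if_pos hm⟩
  rw [pi_norm_le_iff_of_nonneg (by positivity)]
  intro j
  rw [Pi.sub_apply, Real.norm_eq_abs]
  dsimp only
  split_ifs with hm
  -- The error budget is `2^{-(m+2)}` for rounding plus `2^{-(K+1)} ≤ 2^{-(m+1)}` for the distance
  -- of the points, together at most `2^{-m}`.
  · have h1 := abs_approx_sub_le_real h (x j) m
    have h2 := (hxy j).le.trans (pow_le_pow_of_le_one (show (0 : ℝ) ≤ 1 / 2 by norm_num)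
      (by norm_num) (show m + 1 ≤ K + 1 by omega))
    rw [abs_le] at *
    rw [pow_succ] at h2
    rw [pow_succ, pow_succ] at h1
    have : (0 : ℝ) < (1 / 2 : ℝ) ^ m := by positivity
    constructor <;> linarith [h1.1, h1.2, h2.1, h2.2]
  · exact hχ m j

/-! ### Local linearisations -/

theorem half_pow_le {δ : ℚ} (hδ : 0 < δ) {p : ℕ}
    (hp : -⌊Real.logb 2 (min 1 ((δ : ℝ) / 4))⌋ ≤ (p : ℤ)) : (1 / 2 : ℝ) ^ p ≤ δ / 4 := by
  have hδ' : (0 : ℝ) < δ := by exact_mod_cast hδ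
  have hm : (0 : ℝ) < min 1 ((δ : ℝ) / 4) := lt_min one_pos (by positivity)
  have h1 : (-(p : ℤ) : ℤ) ≤ ⌊Real.logb 2 (min 1 ((δ : ℝ) / 4))⌋ := by omega
  rw [Int.le_floor, Real.le_logb_iff_rpow_le (by norm_num) hm] at h1
  push_cast at h1
  rw [Real.rpow_neg (by norm_num), Real.rpow_natCast] at h1
  rw [one_div, inv_pow]
  exact h1.trans (min_le_right _ _)

theorem coeff_boundAtom (i : ℕ) (s c : ℚ) (j : ℕ) :
    (boundAtom i s c).coeff j = if j = i then s else 0 := by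
  unfold Atom.coeff boundAtom
  simp only [List.getD]
  rcases lt_trichotomy j i with h | h | h
  · rw [List.getElem?_append_left (by simpa using h), if_neg h.ne]
    simp [h]
  · subst h; simp
  · rw [List.getElem?_eq_none (by simp; omega), if_neg h.ne']; rfl

theorem value_boundAtom (i : ℕ) (s c : ℚ) (β : ℕ → ℝ) :
    (boundAtom i s c).value β = c + s * β i := by
  unfold Atom.value
  simp only [coeff_boundAtom]
  congr 1
  rw [Finset.sum_eq_single i]
  · simp
  · intro j _ hj; simp [hj]
  · intro h; simp [boundAtom] at h

theorem vars_boundAtom_subset (i : ℕ) (s c : ℚ) : (boundAtom i s c).vars ⊆ {i} := by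
  intro j hj
  by_contra h
  exact hj (by rw [coeff_boundAtom, if_neg (by simpa using h)])

theorem holds_boundAtom (i : ℕ) (s c : ℚ) (β : ℕ → ℝ) :
    (boundAtom i s c).Holds β ↔ (0 : ℝ) ≤ c + s * β i := by
  rw [Atom.Holds, value_boundAtom]
  simp [Rel, boundAtom]

theorem mem_outsideBall {args : List ℕ} {c : ℕ → ℚ} {r : ℚ} {a : Atom} :
    a ∈ outsideBall args c r ↔ ∃ i ∈ args, a = boundAtom i 1 (-(c i) - r) ∨
      a = boundAtom i (-1) (c i - r) := by
  simp [outsideBall]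

theorem holds_outsideBall {args : List ℕ} {c : ℕ → ℚ} {r : ℚ} {β : ℕ → ℝ} :
    Clause.Holds (outsideBall args c r) β ↔ ∃ i ∈ args, (r : ℝ) ≤ |β i - c i| := by
  unfold Clause.Holds
  simp only [mem_outsideBall, le_abs]
  constructor
  · rintro ⟨a, ⟨i, hi, rfl | rfl⟩, ha⟩ <;> refine ⟨i, hi, ?_⟩ <;>
      rw [holds_boundAtom] at ha <;> push_cast at ha
    · left; linarith
    · right; linarith
  · rintro ⟨i, hi, h | h⟩
    · exact ⟨_, ⟨i, hi, Or.inl rfl⟩, by rw [holds_boundAtom]; push_cast; linarith⟩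
    · exact ⟨_, ⟨i, hi, Or.inr rfl⟩, by rw [holds_boundAtom]; push_cast; linarith⟩

theorem vars_outsideBall {args : List ℕ} {c : ℕ → ℚ} {r : ℚ} {i : ℕ}
    (h : i ∈ Clause.vars (outsideBall args c r)) : i ∈ args := by
  obtain ⟨a, ha, hi⟩ := h
  obtain ⟨j, hj, rfl | rfl⟩ := mem_outsideBall.mp ha <;>
  · rw [show i = j from vars_boundAtom_subset _ _ _ hi]; exact hj

theorem isFalse_outsideBall {args : List ℕ} {α : Assign} {r : ℚ} (hr : 0 < r)
    (h : ∀ i ∈ args, α.Assigned i) : Clause.IsFalse α (outsideBall args α.val r) := by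
  intro a ha
  refine ⟨fun i hi => h i (vars_outsideBall ⟨a, ha, hi⟩), fun hh => ?_⟩
  obtain ⟨i, hi, hle⟩ := holds_outsideBall.mp ⟨a, ha, hh⟩
  have : (0 : ℝ) < r := by exact_mod_cast hr
  simp [Assign.toReal] at hle
  linarith

variable {δ : ℚ} {p : ℕ} {rnd : ℚ → ℤ}

theorem Outputs.abs_sub_le {P : NlConstraint} (hrnd : ∀ q : ℚ, |(rnd q : ℚ) - q| ≤ 1 / 2)
    {α : Assign} {v : ℝ} (hv : v ∈ P.fn (P.point α.toReal)) {qs : List ℕ} {y : ℚ}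
    (h : Outputs P.machine (fun m j => approx rnd (P.point α.val j) m) p qs y) :
    |(y : ℝ) - v| ≤ (1 / 2 : ℝ) ^ p := by
  obtain ⟨qs', y', h', hy'⟩ := P.computes _ v hv _ (isName_approx hrnd (P.point α.val)) p
  rwa [(h.unique h').2]

theorem exists_lineariseLocal (δ : ℚ) (p : ℕ) {P : NlConstraint}
    (hrnd : ∀ q : ℚ, |(rnd q : ℚ) - q| ≤ 1 / 2)
    {α : Assign} {v : ℝ} (hv : v ∈ P.fn (P.point α.toReal)) :
    ∃ r, LineariseLocal δ p rnd P α r := by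
  obtain ⟨qs, y, h, _⟩ := P.computes _ v hv _ (isName_approx hrnd (P.point α.val)) (p + 2)
  by_cases hr : Rel P.strict (y + δ / 2)
  · exact ⟨none, qs, y, h, Or.inl ⟨hr, rfl⟩⟩
  · exact ⟨_, qs, y, h, Or.inr ⟨hr, rfl⟩⟩

theorem half_pow_add_two_le (hp : (1 / 2 : ℝ) ^ p ≤ δ / 4) : (1 / 2 : ℝ) ^ (p + 2) ≤ δ / 16 := by
  rw [pow_add]; linarith

/-- An error of at most `δ/16` does not use up the gap between `-δ/2` and `-δ`. -/
theorem LineariseLocal.rel_of_none (hδ : 0 < δ) (hp : (1 / 2 : ℝ) ^ p ≤ δ / 4)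
    (hrnd : ∀ q : ℚ, |(rnd q : ℚ) - q| ≤ 1 / 2) {P : NlConstraint} {α : Assign} {v : ℝ}
    (hv : v ∈ P.fn (P.point α.toReal)) (h : LineariseLocal δ p rnd P α none) :
    Rel P.strict (v + δ) := by
  obtain ⟨qs, y, ho, ⟨hr, _⟩ | ⟨_, h⟩⟩ := h
  · have h1 := (ho.abs_sub_le hrnd hv).trans (half_pow_add_two_le hp)
    have hδ' : (0 : ℝ) < δ := by exact_mod_cast hδ
    rw [abs_le] at h1
    rw [← rel_cast] at hr
    push_cast at hr
    unfold Rel at hr ⊢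
    split_ifs at hr ⊢ <;> linarith [h1.1, h1.2]
  · cases h

/-- The value `y` computed with precision `p + 2` does not satisfy `y ⋄ -δ/2` only where `f ⋄ 0`
is false. -/
theorem not_rel_of_abs_sub_le (hδ : 0 < δ) (hp : (1 / 2 : ℝ) ^ p ≤ δ / 4) {s : Bool} {y : ℚ} {v : ℝ}
    (hy : |(y : ℝ) - v| ≤ (1 / 2 : ℝ) ^ (p + 2)) (h : ¬ Rel s (y + δ / 2)) : ¬ Rel s v := by
  have h1 := hy.trans (half_pow_add_two_le hp)
  have hδ' : (0 : ℝ) < δ := by exact_mod_cast hδ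
  rw [abs_le] at h1
  rw [← rel_cast] at h
  push_cast at h
  unfold Rel at h ⊢
  split_ifs at h ⊢ <;> linarith [h1.1, h1.2]

/-- Suppose a point of the ball satisfied `P`. Gluing gives it a name that agrees with the name of
`α` up to the largest query, so the machine outputs the same `y`, which now approximates the value
of `f` at that point; but `y` fails `⋄ -δ/2`. Satisfying `P` includes definedness of `f`, so nothing
is needed of points outside the domain. -/
theorem LineariseLocal.isLinearisation (hδ : 0 < δ) (hp : (1 / 2 : ℝ) ^ p ≤ δ / 4)
    (hrnd : ∀ q : ℚ, |(rnd q : ℚ) - q| ≤ 1 / 2) {P : NlConstraint} {α : Assign} {C : Clause}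
    (hα : ∀ i ∈ P.args, α.Assigned i)
    (h : LineariseLocal δ p rnd P α (some C)) : IsLinearisation P α C := by
  obtain ⟨qs, y, ho, ⟨_, h⟩ | ⟨hr, h⟩⟩ := h
  · cases h
  · rw [Option.some_inj] at h
    subst h
    refine ⟨fun β hβ => ?_, isFalse_outsideBall (by positivity) hα, fun i => vars_outsideBall⟩
    rw [holds_outsideBall]
    by_contra hcon
    push Not at hcon
    obtain ⟨v, hv, hrel⟩ := hβ
    obtain ⟨ψ, hψ, hag⟩ := isName_glue hrnd (P.point α.val) (P.point β) (qs.foldr max 0)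
      (fun j => by
        have := hcon _ (List.get_mem P.args j)
        push_cast at this
        exact this)
    obtain ⟨qs', y', ho', hy'⟩ := P.computes _ v hv ψ hψ (p + 2)
    have ho2 := ho.congr (ψ := ψ) fun m hm => (hag m (le_foldr_max hm)).symm
    rw [← (ho2.unique ho').2] at hy'
    exact not_rel_of_abs_sub_le hδ hp hy' hr (by simpa using hrel)

theorem LineariseLocal.isFalse (hδ : 0 < δ) (hp : (1 / 2 : ℝ) ^ p ≤ δ / 4)
    (hrnd : ∀ q : ℚ, |(rnd q : ℚ) - q| ≤ 1 / 2) {P : NlConstraint} {α : Assign} {C : Clause}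
    (hα : ∀ i ∈ P.args, α.Assigned i) {v : ℝ} (hv : v ∈ P.fn (P.point α.toReal))
    (h : LineariseLocal δ p rnd P α (some C)) : P.IsFalse α := by
  obtain ⟨qs, y, ho, ⟨_, h⟩ | ⟨hr, h⟩⟩ := h
  · cases h
  · exact ⟨hα, v, hv, not_rel_of_abs_sub_le hδ hp (ho.abs_sub_le hrnd hv) hr⟩

/-- Where `P` is false it has a linearisation, which excludes a single point. -/
theorem NlConstraint.IsFalse.exists_linearisation {P : NlConstraint} {α : Assign}
    (h : P.IsFalse α) : ∃ C, IsLinearisation P α C := by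
  obtain ⟨hα, v, hv, hr⟩ := h
  let pos : ℕ → Atom := fun i => ⟨-(α.val i), List.replicate i 0 ++ [1], true⟩
  let neg : ℕ → Atom := fun i => ⟨α.val i, List.replicate i 0 ++ [-1], true⟩
  have hpos : ∀ i β, (pos i).Holds β ↔ (α.val i : ℝ) < β i := by
    intro i β
    have := value_boundAtom i 1 (-(α.val i)) β
    have hv : (pos i).value β = (boundAtom i 1 (-(α.val i))).value β := rfl
    rw [Atom.Holds, hv, this]
    simp [Rel, pos]
  have hneg : ∀ i β, (neg i).Holds β ↔ β i < (α.val i : ℝ) := by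
    intro i β
    have := value_boundAtom i (-1) (α.val i) β
    have hv : (neg i).value β = (boundAtom i (-1) (α.val i)).value β := rfl
    rw [Atom.Holds, hv, this]
    simp [Rel, neg]
  have hvpos : ∀ i, (pos i).vars ⊆ {i} := fun i => vars_boundAtom_subset i 1 0
  have hvneg : ∀ i, (neg i).vars ⊆ {i} := fun i => vars_boundAtom_subset i (-1) 0
  have hmem : ∀ a, a ∈ P.args.flatMap (fun i => [pos i, neg i]) ↔
      ∃ i ∈ P.args, a = pos i ∨ a = neg i := by simp
  have hvars : ∀ a ∈ P.args.flatMap (fun i => [pos i, neg i]), ∀ j ∈ a.vars, j ∈ P.args := by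
    intro a ha j hj
    obtain ⟨i, hi, rfl | rfl⟩ := (hmem a).mp ha
    · rw [show j = i from hvpos i hj]; exact hi
    · rw [show j = i from hvneg i hj]; exact hi
  refine ⟨P.args.flatMap fun i => [pos i, neg i], fun β hβ => ?_, fun a ha => ⟨fun j hj =>
    hα j (hvars a ha j hj), fun hh => ?_⟩, fun j ⟨a, ha, hj⟩ => hvars a ha j hj⟩
  · by_contra hcon
    have heq : P.point β = P.point α.toReal := by
      funext j
      rcases lt_trichotomy (β (P.args.get j)) (α.toReal (P.args.get j)) with h | h | h
      · exact absurd ⟨neg _, (hmem _).mpr ⟨_, List.get_mem _ j, Or.inr rfl⟩, (hneg _ _).mpr h⟩ hcon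
      · exact h
      · exact absurd ⟨pos _, (hmem _).mpr ⟨_, List.get_mem _ j, Or.inl rfl⟩, (hpos _ _).mpr h⟩ hcon
    obtain ⟨w, hw, hrel⟩ := hβ
    rw [heq] at hw
    rw [Part.mem_unique hw hv] at hrel
    exact hr (by simpa using hrel)
  · obtain ⟨i, hi, rfl | rfl⟩ := (hmem a).mp ha
    · exact lt_irrefl _ ((hpos i _).mp hh)
    · exact lt_irrefl _ ((hneg i _).mp hh)

end Ksmt

namespace Ksmt

/-! ### Invariants of runs -/

/-- What holds for all states reachable from the initial one. -/
def Invariant (F : Formula) (ord : List ℕ) (δ : ℚ) : State → Prop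
  | .run α L => α.map Prod.fst <+: ord ∧ F.lin ⊆ L ∧
      (∀ β : ℕ → ℝ, F.HoldsUpTo 0 β → ∀ C ∈ L, Clause.Holds C β) ∧
      ∀ C ∈ L, ∀ i ∈ Clause.vars C, i < F.n
  | S => CorrectAnswer F δ S

section

variable {F : Formula} {ord : List ℕ} {δ : ℚ} {p : ℕ} {rnd : ℚ → ℤ}

theorem invariant_init (F : Formula) (ord : List ℕ) (δ : ℚ) : Invariant F ord δ F.init :=
  ⟨List.nil_prefix, List.Subset.refl _, fun _ h => h.1, F.lin_vars⟩

theorem lt_of_assigned (hord : ord.Perm (List.range F.n)) {α : Assign}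
    (hα : α.map Prod.fst <+: ord) {i : ℕ} (hi : α.Assigned i) : i < F.n :=
  List.mem_range.mp (hord.subset (hα.subset hi))

/-- Adding clauses that are implied and false under the assignment preserves the invariant. -/
theorem Invariant.append (hord : ord.Perm (List.range F.n)) {α : Assign} {L R : List Clause}
    (h : Invariant F ord δ (.run α L))
    (hR : ∀ C ∈ R, (∀ β : ℕ → ℝ, F.HoldsUpTo 0 β → Clause.Holds C β) ∧ Clause.IsFalse α C) :
    Invariant F ord δ (.run α (R ++ L)) := by
  obtain ⟨h1, h2, h3, h4⟩ := h
  refine ⟨h1, List.Subset.trans h2 (List.subset_append_right _ _), fun β hβ C hC => ?_, fun C hC i hi => ?_⟩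
  · rcases List.mem_append.mp hC with hC | hC
    · exact (hR C hC).1 β hβ
    · exact h3 β hβ C hC
  · rcases List.mem_append.mp hC with hC | hC
    · obtain ⟨a, ha, hi⟩ := hi
      exact lt_of_assigned hord h1 (((hR C hC).2 a ha).1 i hi)
    · exact h4 C hC i hi

/-- `L` retains the clauses of `L₀`; the univariate ones, being true under `α`, put each value into
its box, and the second half of boundedness supplies definedness. -/
theorem Invariant.exists_mem_fn (hF : F.IsBounded) {α : Assign} {L : List Clause}
    (h : Invariant F ord δ (.run α L)) (ht : LinTrue α L) {P : NlConstraint} (hP : P ∈ F.nl) :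
    P.point α.toReal ∈ closure (Set.univ.pi fun j => F.box (P.args.get j)) ∧
    ∃ v, v ∈ P.fn (P.point α.toReal) := by
  have hmem : P.point α.toReal ∈ closure (Set.univ.pi fun j => F.box (P.args.get j)) := by
    refine subset_closure fun j _ C hC hv => ?_
    obtain ⟨a, ha, hh⟩ := ht.holds (h.2.1 hC)
    refine ⟨a, ha, (a.holds_congr fun i hi => ?_).mp hh⟩
    have : i ∈ Clause.vars C := ⟨a, ha, hi⟩
    rw [hv] at this
    rw [show i = P.args.get j from this]
    rfl
  exact ⟨hmem, Part.dom_iff_mem.mp (hF.2 P hP hmem)⟩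

theorem Invariant.deltaKsmtStep (hδ : 0 < δ) (hp : (1 / 2 : ℝ) ^ p ≤ δ / 4)
    (hrnd : ∀ q : ℚ, |(rnd q : ℚ) - q| ≤ 1 / 2) (hF : F.IsBounded) {S S' : State}
    (h : Invariant F ord δ S) (hs : LocalStep F ord δ p rnd S S') : DeltaKsmtStep F δ S S' := by
  rcases hs with ⟨z, _, hs⟩ | hs | hs | hs | hs | hs
  · exact Or.inl ⟨z, hs⟩
  · exact Or.inr (Or.inl hs)
  · exact Or.inr (Or.inr (Or.inl hs))
  · exact Or.inr (Or.inr (Or.inr (Or.inr (Or.inl hs))))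
  · exact Or.inr (Or.inr (Or.inr (Or.inr (Or.inr (Or.inl hs)))))
  · cases S with
    | run α L =>
      obtain ⟨htot, ht, ⟨P, hP, C, hC, hS⟩ | ⟨hnone, hS⟩⟩ := hs
      · have hα : ∀ i ∈ P.args, α.Assigned i := fun i hi => htot i (F.nl_vars P hP i hi)
        obtain ⟨_, v, hv⟩ := h.exists_mem_fn hF ht hP
        exact Or.inr (Or.inr (Or.inr (Or.inl ⟨ht.not_linFalse, P, hP,
          hC.isFalse hδ hp hrnd hα hv, C, hC.isLinearisation hδ hp hrnd hα, hS⟩)))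
      · refine Or.inr (Or.inr (Or.inr (Or.inr (Or.inr (Or.inr ⟨htot, ht, fun P hP => ?_, hS⟩)))))
        obtain ⟨_, v, hv⟩ := h.exists_mem_fn hF ht hP
        exact ⟨v, hv, (hnone P hP).rel_of_none hδ hp hrnd hv⟩
    | _ => exact hs.elim

theorem holdsUpTo_of_le (hδ : 0 < δ) {β : ℕ → ℝ} (h : F.HoldsUpTo 0 β) : F.HoldsUpTo δ β := by
  refine ⟨h.1, fun P hP => ?_⟩
  obtain ⟨v, hv, hr⟩ := h.2 P hP
  refine ⟨v, hv, ?_⟩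
  have hδ' : (0 : ℝ) < δ := by exact_mod_cast hδ
  rw [Rat.cast_zero, add_zero] at hr
  unfold Rel at hr ⊢
  split_ifs at hr ⊢ <;> linarith

theorem Invariant.step (hδ : 0 < δ) (hp : (1 / 2 : ℝ) ^ p ≤ δ / 4)
    (hrnd : ∀ q : ℚ, |(rnd q : ℚ) - q| ≤ 1 / 2) (hF : F.IsBounded)
    (hord : ord.Perm (List.range F.n)) {S S' : State}
    (h : Invariant F ord δ S) (hs : LocalStep F ord δ p rnd S S') : Invariant F ord δ S' := by
  have hstep := h.deltaKsmtStep hδ hp hrnd hF hs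
  cases S with
  | run α L =>
    rcases hs with ⟨z, hz, hs⟩ | hs | hs | hs | hs | hs
    · obtain ⟨_, _, _, q, _, rfl⟩ := hs
      refine ⟨?_, h.2⟩
      rw [List.map_append]
      exact hz
    · obtain ⟨_, z, _, _, _, R, ⟨_, hR⟩, rfl⟩ := hs
      exact h.append hord fun C hC => ⟨fun β hβ => (hR C hC).2.1 β (h.2.2.1 β hβ),
        (hR C hC).2.2.1⟩
    · obtain ⟨_, γ, hγ, _, _, rfl⟩ := hs
      exact ⟨(hγ.map _).trans h.1, h.2⟩
    · obtain ⟨htot, ht, hno, rfl⟩ := hs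
      have hF0 : F.HoldsUpTo 0 α.toReal := by
        refine ⟨fun C hC => ht.holds (h.2.1 hC), fun P hP => ?_⟩
        obtain ⟨_, v, hv⟩ := h.exists_mem_fn hF ht hP
        refine ⟨v, hv, ?_⟩
        rw [Rat.cast_zero, add_zero]
        by_contra hr
        -- Were `f ⋄ 0` false here, excluding this single point would be a linearisation, and (L)
        -- would apply, contrary to the side condition of SAT.
        have hPf : P.IsFalse α := ⟨fun i hi => htot i (F.nl_vars P hP i hi), v, hv, hr⟩
        obtain ⟨C, hC⟩ := hPf.exists_linearisation
        exact (hno (.run α (C :: L))).2.2.2 ⟨ht.not_linFalse, P, hP, hPf, C, hC, rfl⟩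
      exact ⟨α.val, hF0, holdsUpTo_of_le hδ hF0⟩
    · obtain ⟨⟨C, hC, hf⟩, rfl⟩ := hs
      exact fun β hβ => hf.not_holds_of_nil β (h.2.2.1 β hβ C hC)
    · obtain ⟨htot, ht, ⟨P, hP, C, hC, rfl⟩ | ⟨hnone, rfl⟩⟩ := hs
      · have hl := hC.isLinearisation hδ hp hrnd fun i hi => htot i (F.nl_vars P hP i hi)
        refine h.append (R := [C]) hord fun D hD => ?_
        rw [List.mem_singleton] at hD
        subst hD
        exact ⟨fun β hβ => hl.1 β (hβ.2 P hP), hl.2.1⟩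
      · refine ⟨α.val, fun C hC => ht.holds (h.2.1 hC), fun P hP => ?_⟩
        obtain ⟨_, v, hv⟩ := h.exists_mem_fn hF ht hP
        exact ⟨v, hv, (hnone P hP).rel_of_none hδ hp hrnd hv⟩
  | _ => rcases hs with ⟨_, _, hs⟩ | hs | hs | hs | hs | hs <;> exact hs.elim

/-! ### Progress -/

/-- The steps that the algorithm may choose from. -/
def SearchStep (F : Formula) (ord : List ℕ) (δ : ℚ) (p : ℕ) (rnd : ℚ → ℤ) : State → State → Prop
  | .run α L, S' =>
    (∃ z q, α.map Prod.fst ++ [z] <+: ord ∧ ¬ LinFalse (α ++ [(z, q)]) L ∧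
      S' = .run (α ++ [(z, q)]) L) ∨
    (¬ LinFalse α L ∧ ∃ z D, z < F.n ∧ ¬ α.Assigned z ∧ Deriv (ConflictBase α L z) z D ∧
      D.Nodup ∧ z ∉ Clause.vars D ∧ Clause.IsFalse α D ∧ S' = .run α (D :: L)) ∨
    (∃ k, ¬ LinFalse (α.take k) L ∧ LinFalse (α.take (k + 1)) L ∧ S' = .run (α.take k) L) ∨
    (LinFalse [] L ∧ S' = .unsat) ∨
    NlinStepLocal F δ p rnd (.run α L) S'
  | _, _ => False

/-- The finite certificates in `SearchStep` imply the side conditions of the rules: a derivation of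
a false clause yields the universal premise of (R), and the change from not false to false between
`k` and `k + 1` yields the maximality in (B). -/
theorem SearchStep.localStep (hord : ord.Perm (List.range F.n)) {S S' : State}
    (h : SearchStep F ord δ p rnd S S') : LocalStep F ord δ p rnd S S' := by
  cases S with
  | run α L =>
    rcases h with ⟨z, q, hz, hq, rfl⟩ | ⟨hnf, z, D, hz, hzα, hD, hnd, hzD, hDf, rfl⟩ |
      ⟨k, hk1, hk2, rfl⟩ | h | h
    · have hnd : ord.Nodup := hord.nodup_iff.mpr List.nodup_range
      refine Or.inl ⟨z, hz, fun hf => hq (hf.of_prefix (List.prefix_append _ _)), ?_, ?_, q, hq, rfl⟩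
      · exact List.mem_range.mp (hord.subset (hz.subset (by simp)))
      · intro hα
        have := hz.sublist.nodup hnd
        rw [List.nodup_append] at this
        exact this.2.2 z hα z (by simp) rfl
    · exact Or.inr (Or.inl ⟨hnf, z, hz, hzα, fun q => hD.linFalse_snoc hDf q, [D],
        hD.isResolvent hnd hzD hDf, rfl⟩)
    · refine Or.inr (Or.inr (Or.inl ⟨hk2.of_prefix (List.take_prefix _ _), α.take k,
        List.take_prefix _ _, hk1, fun γ hγ hγf => ?_, rfl⟩))
      rw [List.prefix_iff_eq_take] at hγ
      rcases le_or_gt γ.length k with hle | hlt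
      · rw [hγ]; exact List.take_prefix_take_left hle
      · refine absurd (hk2.of_prefix ?_) hγf
        rw [hγ]; exact List.take_prefix_take_left hlt
    · exact Or.inr (Or.inr (Or.inr (Or.inr (Or.inl h))))
    · exact Or.inr (Or.inr (Or.inr (Or.inr (Or.inr h))))
  | _ => exact h.elim

theorem linTrue_of_total {α : Assign} (htot : F.Total α)
    {L : List Clause} (hv : ∀ C ∈ L, ∀ i ∈ Clause.vars C, i < F.n) (hf : ¬ LinFalse α L) :
    LinTrue α L := by
  intro C hC
  by_contra hcon
  refine hf ⟨C, hC, fun a ha => ?_⟩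
  have hva : ∀ i ∈ a.vars, α.Assigned i := fun i hi => htot i (hv C hC i ⟨a, ha, hi⟩)
  exact ⟨hva, fun hh => hcon ⟨a, ha, hva, hh⟩⟩

/-- If `L` is false, UNSAT or (B) applies. Otherwise, if all variables are assigned, every machine
halts, so some constraint returns a clause or all return none. If a variable is left, either some
value keeps `L` not false or resolution is complete enough to supply a resolvent. The rule for SAT
is never needed. The parameter `δ'` may differ from the `δ` of the invariant, which concerns final
states only. -/
theorem Invariant.exists_searchStep (δ' : ℚ) (p : ℕ)
    (hrnd : ∀ q : ℚ, |(rnd q : ℚ) - q| ≤ 1 / 2) (hF : F.IsBounded)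
    (hord : ord.Perm (List.range F.n)) {α : Assign} {L : List Clause}
    (h : Invariant F ord δ (.run α L)) : ∃ S', SearchStep F ord δ' p rnd (.run α L) S' := by
  classical
  by_cases hf : LinFalse α L
  · by_cases hnil : LinFalse [] L
    · exact ⟨_, Or.inr (Or.inr (Or.inr (Or.inl ⟨hnil, rfl⟩)))⟩
    · have hex : ∃ k, LinFalse (α.take k) L := ⟨α.length, by simpa using hf⟩
      obtain ⟨k, hk⟩ : ∃ k, Nat.find hex = k + 1 := by
        refine Nat.exists_eq_succ_of_ne_zero fun h0 => hnil ?_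
        have := Nat.find_spec hex
        rw [h0] at this
        simpa using this
      refine ⟨_, Or.inr (Or.inr (Or.inl ⟨k, Nat.find_min hex (by omega), ?_, rfl⟩))⟩
      rw [← hk]
      exact Nat.find_spec hex
  · obtain ⟨t, ht⟩ := h.1
    cases t with
    | nil =>
      rw [List.append_nil] at ht
      have htot : F.Total α := fun i hi => by
        unfold Assign.Assigned
        rw [ht]
        exact hord.symm.subset (List.mem_range.mpr hi)
      have hlt := linTrue_of_total htot h.2.2.2 hf
      by_cases hex : ∃ P ∈ F.nl, ∃ C, LineariseLocal δ' p rnd P α (some C)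
      · obtain ⟨P, hP, C, hC⟩ := hex
        exact ⟨_, Or.inr (Or.inr (Or.inr (Or.inr ⟨htot, hlt, Or.inl ⟨P, hP, C, hC, rfl⟩⟩)))⟩
      · refine ⟨_, Or.inr (Or.inr (Or.inr (Or.inr ⟨htot, hlt, Or.inr ⟨fun P hP => ?_, rfl⟩⟩)))⟩
        obtain ⟨_, v, hv⟩ := h.exists_mem_fn hF hlt hP
        obtain ⟨r, hr⟩ := exists_lineariseLocal δ' p hrnd hv
        cases r with
        | none => exact hr
        | some C => exact absurd ⟨P, hP, C, hr⟩ hex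
    | cons z t =>
      have hz : α.map Prod.fst ++ [z] <+: ord := ⟨t, by simpa using ht⟩
      by_cases hex : ∃ q : ℚ, ¬ LinFalse (α ++ [(z, q)]) L
      · obtain ⟨q, hq⟩ := hex
        exact ⟨_, Or.inl ⟨z, q, hz, hq, rfl⟩⟩
      · push Not at hex
        have hnd : ord.Nodup := hord.nodup_iff.mpr List.nodup_range
        have hzα : ¬ α.Assigned z := by
          intro hα
          have := hz.sublist.nodup hnd
          rw [List.nodup_append] at this
          exact this.2.2 z hα z (by simp) rfl
        obtain ⟨D, hD, hDn, hDz, hDf⟩ := exists_conflict_clause hzα hex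
        exact ⟨_, Or.inr (Or.inl ⟨hf, z, D,
          List.mem_range.mp (hord.subset (hz.subset (by simp))), hzα, hD, hDn, hDz, hDf, rfl⟩)⟩

end

end Ksmt

namespace Ksmt
open Filter Topology

section

variable {F : Formula} {ord : List ℕ} {δ : ℚ} {p : ℕ} {rnd : ℚ → ℤ}

/-! ### Finitely many linearisations -/

/-- This is where the special form of the names enters: bounded entries of fixed precision take only
finitely many values. -/
theorem finite_dyadic (m : ℕ) (R : ℝ) :
    {q : ℚ | (∃ a : ℤ, q = (a : ℚ) / 2 ^ (m + 1)) ∧ |(q : ℝ)| ≤ R}.Finite := by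
  refine ((Set.finite_Icc (-⌈R * 2 ^ (m + 1)⌉) ⌈R * 2 ^ (m + 1)⌉).image
    fun a : ℤ => (a : ℚ) / 2 ^ (m + 1)).subset ?_
  rintro q ⟨⟨a, rfl⟩, hq⟩
  refine ⟨a, ?_, rfl⟩
  have h2 : (0 : ℝ) < 2 ^ (m + 1) := by positivity
  push_cast at hq
  rw [abs_div, abs_of_pos h2, div_le_iff₀ h2] at hq
  have h3 := hq.trans (Int.le_ceil _)
  rw [Set.mem_Icc, ← abs_le]
  exact_mod_cast h3

/-- Along an ultrafilter, the names of the points of a bounded set are pointwise eventually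
constant. -/
theorem exists_limit_name (hrnd : ∀ q : ℚ, |(rnd q : ℚ) - q| ≤ 1 / 2) (U : Ultrafilter ℕ) {k : ℕ}
    (x : ℕ → Fin k → ℚ) (R : ℝ) (hx : ∀ i j, |(x i j : ℝ)| ≤ R) {c : Fin k → ℝ}
    (hc : Tendsto (fun i j => (x i j : ℝ)) U (𝓝 c)) :
    ∃ ψ : ℕ → Fin k → ℚ, IsName ψ c ∧
      ∀ m, ∀ᶠ i in U, (fun j => approx rnd (x i j) m) = ψ m := by
  have h1 : ∀ m, ∃ f : Fin k → ℚ, ∀ᶠ i in U, (fun j => approx rnd (x i j) m) = f := by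
    intro m
    have hfin : (Set.univ.pi fun _ : Fin k =>
        {q : ℚ | (∃ a : ℤ, q = (a : ℚ) / 2 ^ (m + 1)) ∧ |(q : ℝ)| ≤ R + 1}).Finite :=
      Set.Finite.pi fun _ => finite_dyadic m _
    obtain ⟨f, _, hf⟩ := (Ultrafilter.eventually_exists_mem_iff (f := U)
      (P := fun f i => (fun j => approx rnd (x i j) m) = f) hfin).mp (Eventually.of_forall fun i =>
        ⟨fun j => approx rnd (x i j) m, fun j _ => ⟨⟨rnd (x i j * 2 ^ (m + 1)), rfl⟩, by
          change |(approx rnd (x i j) m : ℝ)| ≤ R + 1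
          have h2 := abs_approx_sub_le_real hrnd (x i j) m
          have h3 : (1 / 2 : ℝ) ^ (m + 2) ≤ 1 := pow_le_one₀ (by norm_num) (by norm_num)
          have h4 := abs_sub_abs_le_abs_sub (approx rnd (x i j) m : ℝ) (x i j)
          linarith [hx i j]⟩, rfl⟩)
    exact ⟨f, hf⟩
  choose ψ hψ using h1
  refine ⟨ψ, fun m => ?_, hψ⟩
  -- The defining inequality of a name is closed: `ψ m` equals the `m`-th approximation of almost
  -- all points, so the bound passes to the limit.
  have h2 : Tendsto (fun i => ‖(fun j => (ψ m j : ℝ)) - fun j => (x i j : ℝ)‖) U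
      (𝓝 ‖(fun j => (ψ m j : ℝ)) - c‖) := (tendsto_const_nhds.sub hc).norm
  refine le_of_tendsto h2 ((hψ m).mono fun i hi => ?_)
  rw [← hi]
  exact isName_approx hrnd (x i) m

/-- Along a non-principal ultrafilter the constraint is constant and the points converge to some `c`
in the closure of the box, hence in the domain of `f`. Their names stabilise to a name of `c`, on
which the machine halts. Almost all of the radii therefore equal a single `r > 0`, while almost all
points are within `r/2` of `c` and so within `r` of each other; but a later point must avoid the
ball excluded at an earlier one. -/
theorem no_infinite_linearisation (hrnd : ∀ q : ℚ, |(rnd q : ℚ) - q| ≤ 1 / 2)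
    (hF : F.IsBounded) (α : ℕ → Assign) (L : ℕ → List Clause) (P : ℕ → NlConstraint)
    (C : ℕ → Clause) (hinv : ∀ i, Invariant F ord δ (.run (α i) (L i)))
    (hL : ∀ i, LinTrue (α i) (L i)) (hP : ∀ i, P i ∈ F.nl)
    (hC : ∀ i, LineariseLocal δ p rnd (P i) (α i) (some (C i)))
    (hmem : ∀ i j, i < j → C i ∈ L j) : False := by
  set U : Ultrafilter ℕ := hyperfilter ℕ with hU
  obtain ⟨Q, hQ, hPQ⟩ := (Ultrafilter.eventually_exists_mem_iff (f := U)
    (P := fun Q i => P i = Q) (List.finite_toSet F.nl)).mp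
    (Eventually.of_forall fun i => ⟨P i, hP i, rfl⟩)
  obtain ⟨R, hR⟩ := hF.1.subset_closedBall 0
  have hbound : ∀ i, ∀ j < F.n, |((α i).val j : ℝ)| ≤ R := by
    intro i j hj
    have hmem : (fun j : Fin F.n => (α i).toReal j) ∈ Set.univ.pi fun i : Fin F.n => F.box i := by
      intro j _ D hD hv
      obtain ⟨a, ha, hh⟩ := (hL i).holds ((hinv i).2.1 hD)
      refine ⟨a, ha, (a.holds_congr fun s hs => ?_).mp hh⟩
      have : s ∈ Clause.vars D := ⟨a, ha, hs⟩
      rw [hv] at this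
      rw [show s = j from this]
    have h1 := hR hmem
    rw [mem_closedBall_zero_iff] at h1
    exact (norm_le_pi_norm (fun j : Fin F.n => (α i).toReal j) ⟨j, hj⟩).trans h1
  set x : ℕ → Fin Q.args.length → ℚ := fun i => Q.point (α i).val with hx
  have hxR : ∀ i j, |(x i j : ℝ)| ≤ R := fun i j =>
    hbound i _ (F.nl_vars Q hQ _ (List.get_mem _ j))
  obtain ⟨c, _, hc⟩ := (isCompact_univ_pi fun _ : Fin Q.args.length =>
    isCompact_Icc (a := -R) (b := R)).ultrafilter_le_nhds (U.map fun i j => (x i j : ℝ))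
    (by
      rw [le_principal_iff]
      exact Ultrafilter.mem_map.mpr (Eventually.of_forall fun i j _ => abs_le.mp (hxR i j)))
  have hc : Tendsto (fun i j => (x i j : ℝ)) U (𝓝 c) := hc
  have hdom : c ∈ Q.fn.Dom := hF.2 Q hQ (isClosed_closure.mem_of_tendsto hc
    (Eventually.of_forall fun i => ((hinv i).exists_mem_fn hF (hL i) hQ).1))
  obtain ⟨v, hv⟩ := Part.dom_iff_mem.mp hdom
  obtain ⟨ψ, hψ, hev⟩ := exists_limit_name hrnd U x R hxR hc
  obtain ⟨qs, y, ho, _⟩ := Q.computes c v hv ψ hψ (p + 2)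
  set r : ℚ := (1 / 2) ^ (qs.foldr max 0 + 1) with hr
  have hrpos : (0 : ℝ) < (r : ℝ) / 2 := by rw [hr]; push_cast; positivity
  -- The run on the limit name poses finitely many queries; almost all points give the same answers
  -- to all of them, hence the same run and the same radius.
  have hevC : ∀ᶠ i in U, C i = outsideBall Q.args (α i).val r := by
    have h1 : ∀ᶠ i in U, ∀ m ∈ qs.toFinset, (fun j => approx rnd (x i j) m) = ψ m :=
      (eventually_all_finset _).mpr fun m _ => hev m
    filter_upwards [h1, hPQ] with i hi hiP
    obtain ⟨qs', y', ho', ⟨_, h⟩ | ⟨_, h⟩⟩ := hC i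
    · cases h
    · rw [hiP] at h ho'
      have ho2 := ho.congr (ψ := fun m j => approx rnd (Q.point (α i).val j) m)
        fun m hm => (hi m (List.mem_toFinset.mpr hm)).symm
      rw [Option.some_inj] at h
      rw [h, hr, (ho2.unique ho').1]
  have hevx : ∀ᶠ i in U, dist (fun j => (x i j : ℝ)) c < r / 2 :=
    hc.eventually (Metric.ball_mem_nhds c hrpos)
  have hgood := hevC.and hevx
  obtain ⟨i, hiC, hix⟩ := hgood.exists
  -- The ultrafilter refines `atTop`, so a good index beyond `i` exists.
  obtain ⟨j, ⟨hjC, hjx⟩, hij⟩ :=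
    (hgood.and (Nat.hyperfilter_le_atTop (eventually_gt_atTop i))).exists
  have hholds := (hL j).holds (hmem i j hij)
  rw [hiC, holds_outsideBall] at hholds
  obtain ⟨s, hs, hle⟩ := hholds
  obtain ⟨s', hs'⟩ := List.mem_iff_get.mp hs
  have h1 := (dist_le_pi_dist (fun j => (x i j : ℝ)) c s').trans_lt hix
  have h2 := (dist_le_pi_dist (fun s => (x j s : ℝ)) c s').trans_lt hjx
  rw [Real.dist_eq, abs_lt] at h1 h2
  have h3 : |(x j s' : ℝ) - x i s'| < r := by
    rw [abs_lt]; constructor <;> linarith [h1.1, h1.2, h2.1, h2.2]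
  have h4 : ∀ i, x i s' = (α i).val s := fun i => by rw [← hs']; rfl
  rw [h4, h4] at h3
  exact absurd h3 (not_lt.mpr hle)

/-! ### Finitely many resolvents -/

/-- The atoms obtained from those in `A` by at most `k` combinations. -/
def generated (A : Set Atom) (n : ℕ) : ℕ → Set Atom
  | 0 => A
  | k + 1 => generated A n k ∪
      (fun t : ℕ × Atom × Atom => fmResolve t.1 t.2.1 t.2.2) ''
        (Set.Iio n ×ˢ generated A n k ×ˢ generated A n k)

theorem generated_finite {A : Set Atom} (hA : A.Finite) (n k : ℕ) : (generated A n k).Finite := by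
  induction k with
  | zero => exact hA
  | succ k ih => exact ih.union (((Set.finite_Iio n).prod (ih.prod ih)).image _)

theorem generated_mono (A : Set Atom) (n : ℕ) : Monotone (generated A n) :=
  monotone_nat_of_le_succ fun _ => Set.subset_union_left

/-- Absence of repetitions bounds the length; this is what the `Nodup` condition on resolvents is
for. -/
theorem finite_nodup_lists {X : Type*} {A : Set X} (hA : A.Finite) :
    {l : List X | l.Nodup ∧ ∀ a ∈ l, a ∈ A}.Finite := by
  classical
  have : Finite A := hA
  refine ((List.finite_length_le A (Nat.card A)).image (List.map Subtype.val)).subset ?_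
  rintro l ⟨hn, hl⟩
  refine ⟨l.attach.map fun a => ⟨a.1, hl a.1 a.2⟩, ?_, by simp [Function.comp_def]⟩
  simp only [Set.mem_ofPred_eq, List.length_map, List.length_attach]
  have := Fintype.ofFinite A
  have hn' : (l.attach.map fun a => (⟨a.1, hl a.1 a.2⟩ : A)).Nodup :=
    (List.nodup_attach.mpr hn).map fun a b h => Subtype.ext (by simpa using h)
  have := hn'.length_le_card
  rw [Nat.card_eq_fintype_card]
  simpa using this

/-- The atoms of `L` that contain a variable which is not among the first `r` ones are generated in
few steps. -/
def AtomsGenerated (A : Set Atom) (n : ℕ) (ord : List ℕ) (L : List Clause) : Prop :=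
  ∀ C ∈ L, ∀ a ∈ C, a ∈ generated A n n ∧
    ∀ r, ¬ a.vars ⊆ {i | i ∈ ord.take r} → a ∈ generated A n (n - 1 - r)

/-- With `j` variables assigned, `z` is not among the first `j`, so `l` and `u`, which contain `z`,
are generated in `n - 1 - j` steps and their combination in `n - j`. The combination is false under
`α`, so its variables are among the first `j`. If one of them is not among the first `r`, then `r <
j`, and `n - j ≤ n - 1 - r` as required. -/
theorem AtomsGenerated.append {A : Set Atom} (hord : ord.Perm (List.range F.n))
    {L : List Clause} (h : AtomsGenerated A F.n ord L) {α : Assign}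
    (hα : α.map Prod.fst <+: ord) {z : ℕ} (hz : z < F.n) (hzα : ¬ α.Assigned z)
    {R : List Clause} (hR : IsResolvent α L z R) : AtomsGenerated A F.n ord (R ++ L) := by
  intro C hC a ha
  rcases List.mem_append.mp hC with hC | hC
  swap
  · exact h C hC a ha
  obtain ⟨_, _, hf, _, hd⟩ := hR.2 C hC
  rcases hd.mem ha with ⟨D, hD, haD⟩ | ⟨l, u, ⟨D, hD, hl⟩, ⟨E, hE, hu⟩, hlz, huz, rfl⟩
  · exact h D hD a haD
  set j := α.length with hj
  have hαj : α.map Prod.fst = ord.take j := by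
    have := List.prefix_iff_eq_take.mp hα
    rwa [List.length_map] at this
  have hzj : z ∉ ord.take j := by rw [← hαj]; exact hzα
  have hjn : j < F.n := by
    by_contra hcon
    have hlen : ord.length = F.n := by rw [hord.length_eq, List.length_range]
    rw [List.take_of_length_le (by omega)] at hzj
    exact hzj (hord.symm.subset (List.mem_range.mpr hz))
  have hl' := (h D hD l hl).2 j fun hs => hzj (hs hlz)
  have hu' := (h E hE u hu).2 j fun hs => hzj (hs huz)
  have hg : fmResolve z l u ∈ generated A F.n (F.n - 1 - j + 1) :=
    Or.inr ⟨(z, l, u), ⟨hz, hl', hu'⟩, rfl⟩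
  refine ⟨generated_mono A F.n (by omega) hg, fun r hr => generated_mono A F.n ?_ hg⟩
  have hrj : r < j := by
    by_contra hcon
    refine hr fun i hi => ?_
    have h1 : i ∈ ord.take j := by rw [← hαj]; exact (hf _ ha).1 i hi
    exact (List.take_prefix_take_left (not_lt.mp hcon)).subset h1
  omega

/-- Once linearisations have stopped, only finitely many clauses `V` can occur. Each (R) adds a new
one, since the resolvent is false under `α` while `L` is not; between two such steps the run can
only extend `α` or repair a conflict. -/
theorem no_infinite_linear (hord : ord.Perm (List.range F.n)) (α : ℕ → Assign)
    (L : ℕ → List Clause) (hα : ∀ i, (α i).map Prod.fst <+: ord)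
    (hstep : ∀ i, (∃ z, RuleA F z (.run (α i) (L i)) (.run (α (i + 1)) (L (i + 1)))) ∨
      RuleR F (.run (α i) (L i)) (.run (α (i + 1)) (L (i + 1))) ∨
      RuleB (.run (α i) (L i)) (.run (α (i + 1)) (L (i + 1)))) : False := by
  classical
  set A : Set Atom := {a | a ∈ (L 0).flatten} with hA
  have hAfin : A.Finite := List.finite_toSet _
  have hgen : ∀ i, AtomsGenerated A F.n ord (L i) := by
    intro i
    induction i with
    | zero =>
      intro C hC a ha
      have h0 : a ∈ generated A F.n 0 := List.mem_flatten.mpr ⟨C, hC, ha⟩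
      exact ⟨generated_mono A F.n (Nat.zero_le _) h0, fun r _ =>
        generated_mono A F.n (Nat.zero_le _) h0⟩
    | succ i ih =>
      rcases hstep i with ⟨z, _, _, _, q, _, hS⟩ | ⟨_, z, hz, hzα, _, R, hR, hS⟩ |
        ⟨_, γ, _, _, _, hS⟩ <;> rw [State.run.injEq] at hS <;> rw [hS.2]
      · exact ih
      · exact ih.append hord (hα i) hz hzα hR
      · exact ih
  have hUfin : ({C | C ∈ L 0} ∪ {l : List Atom | l.Nodup ∧ ∀ a ∈ l, a ∈ generated A F.n F.n}).Finite :=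
    (List.finite_toSet _).union (finite_nodup_lists (generated_finite hAfin _ _))
  set V := hUfin.toFinset with hV
  have hLV : ∀ i, (L i).toFinset ⊆ V := by
    intro i
    induction i with
    | zero => intro C hC; simp [hV] at hC ⊢; exact Or.inl hC
    | succ i ih =>
      rcases hstep i with ⟨z, _, _, _, q, _, hS⟩ | ⟨_, z, hz, hzα, _, R, hR, hS⟩ |
        ⟨_, γ, _, _, _, hS⟩ <;> rw [State.run.injEq] at hS
      · rw [hS.2]; exact ih
      · intro C hC
        by_cases hCR : C ∈ R
        · rw [hV, Set.Finite.mem_toFinset]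
          exact Or.inr ⟨(hR.2 C hCR).2.2.2.1, fun a ha =>
            (hgen (i + 1) C (by rw [hS.2]; exact List.mem_append_left _ hCR) a ha).1⟩
        · rw [hS.2] at hC
          refine ih ?_
          simpa [hCR] using hC
      · rw [hS.2]; exact ih
  have hlen : ∀ i, (α i).length ≤ F.n := fun i => by
    have := (hα i).length_le
    rwa [List.length_map, hord.length_eq, List.length_range] at this
  -- A lexicographic measure in one number. (A) lowers the last summand. (B) clears the falsity
  -- flag, whose weight `n + 1` exceeds any loss in the length of `α`. (R) lowers the first summand
  -- by at least two units of the flag, which pays for setting it.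
  set μ : ℕ → ℕ := fun i => ((V.card - (L i).toFinset.card) * 2 +
    if LinFalse (α i) (L i) then 1 else 0) * (F.n + 1) + (F.n - (α i).length) with hμ
  have hdec : ∀ i, μ (i + 1) < μ i := by
    intro i
    have hl := hlen i
    have hl' := hlen (i + 1)
    rcases hstep i with ⟨z, hf, _, _, q, hf', hS⟩ | ⟨hf, z, hz, hzα, _, R, hR, hS⟩ |
      ⟨hf, γ, _, hf', _, hS⟩ <;> rw [State.run.injEq] at hS
    · have h1 : (α (i + 1)).length = (α i).length + 1 := by rw [hS.1]; simp
      rw [← hS.1] at hf'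
      simp only [hμ, hS.2, if_neg hf, if_neg hf']
      omega
    · have hcard : (L i).toFinset.card < (L (i + 1)).toFinset.card := by
        obtain ⟨D, hD⟩ := List.exists_mem_of_ne_nil R hR.1
        refine Finset.card_lt_card ⟨fun C hC => ?_, fun hcon => ?_⟩
        · rw [hS.2]
          simp only [List.mem_toFinset, List.mem_append] at hC ⊢
          exact Or.inr hC
        · have : D ∈ (L i).toFinset := hcon (by rw [hS.2]; simp [hD])
          exact hf ⟨D, List.mem_toFinset.mp this, (hR.2 D hD).2.2.1⟩
      have hcard' := Finset.card_le_card (hLV (i + 1))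
      have hb : (if LinFalse (α (i + 1)) (L (i + 1)) then 1 else 0) ≤ 1 := by split_ifs <;> simp
      simp only [hμ, if_neg hf]
      have : (V.card - (L (i + 1)).toFinset.card) * 2 +
          (if LinFalse (α (i + 1)) (L (i + 1)) then 1 else 0) + 1 ≤
          (V.card - (L i).toFinset.card) * 2 + 0 := by omega
      have := Nat.mul_le_mul_right (F.n + 1) this
      rw [Nat.add_mul _ 1, Nat.one_mul] at this
      omega
    · rw [← hS.1] at hf'
      simp only [hμ, hS.2, if_pos hf, if_neg hf']
      have : ∀ c : ℕ, (c + 1) * (F.n + 1) = (c + 0) * (F.n + 1) + (F.n + 1) := by intro c; ring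
      rw [this]
      omega
  have hbound : ∀ i, μ i + i ≤ μ 0 := by
    intro i
    induction i with
    | zero => simp
    | succ i ih => have := hdec i; omega
  have := hbound (μ 0 + 1)
  omega

/-! ### Termination -/

/-- Clauses are never removed, so with infinitely many linearisation steps each clause constrains
all later points, which compactness forbids. With finitely many, the tail of the run is purely
linear. -/
theorem no_infinite_run (hδ : 0 < δ) (hp : (1 / 2 : ℝ) ^ p ≤ δ / 4)
    (hrnd : ∀ q : ℚ, |(rnd q : ℚ) - q| ≤ 1 / 2) (hF : F.IsBounded)
    (hord : ord.Perm (List.range F.n)) :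
    ¬ ∃ run : ℕ → State, run 0 = F.init ∧ ∀ i, LocalStep F ord δ p rnd (run i) (run (i + 1)) := by
  rintro ⟨run, h0, hrun⟩
  have hinv : ∀ i, Invariant F ord δ (run i) := by
    intro i
    induction i with
    | zero => rw [h0]; exact invariant_init F ord δ
    | succ i ih => exact ih.step hδ hp hrnd hF hord (hrun i)
  have hst : ∀ i, ∃ α L, run i = .run α L := by
    intro i
    have hs := hrun i
    cases h : run i with
    | run α L => exact ⟨α, L, rfl⟩
    | _ =>
      rw [h] at hs
      rcases hs with ⟨_, _, hs⟩ | hs | hs | hs | hs | hs <;> exact hs.elim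
  choose α L hαL using hst
  simp only [hαL] at hrun hinv
  have hcases : ∀ i, ((∃ z, RuleA F z (.run (α i) (L i)) (.run (α (i + 1)) (L (i + 1)))) ∨
      RuleR F (.run (α i) (L i)) (.run (α (i + 1)) (L (i + 1))) ∨
      RuleB (.run (α i) (L i)) (.run (α (i + 1)) (L (i + 1)))) ∨
      LinTrue (α i) (L i) ∧ ∃ P ∈ F.nl, ∃ C, LineariseLocal δ p rnd P (α i) (some C) ∧
        L (i + 1) = C :: L i := by
    intro i
    rcases hrun i with ⟨z, _, h⟩ | h | h | h | h | h
    · exact Or.inl (Or.inl ⟨z, h⟩)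
    · exact Or.inl (Or.inr (Or.inl h))
    · exact Or.inl (Or.inr (Or.inr h))
    · cases h.2.2.2
    · cases h.2
    · obtain ⟨_, ht, ⟨P, hP, C, hC, hS⟩ | ⟨_, hS⟩⟩ := h
      · rw [State.run.injEq] at hS
        exact Or.inr ⟨ht, P, hP, C, hC, hS.2⟩
      · cases hS
  have hmono : ∀ i j, i ≤ j → L i ⊆ L j := by
    intro i j hij
    induction hij with
    | refl => exact List.Subset.refl _
    | @step j _ ih =>
      refine List.Subset.trans ih ?_
      rcases hcases j with (⟨z, _, _, _, q, _, hS⟩ | ⟨_, z, _, _, _, R, _, hS⟩ |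
        ⟨_, γ, _, _, _, hS⟩) | ⟨_, _, _, C, _, hS⟩
      · rw [State.run.injEq] at hS; rw [hS.2]; exact List.Subset.refl _
      · rw [State.run.injEq] at hS; rw [hS.2]; exact List.subset_append_right _ _
      · rw [State.run.injEq] at hS; rw [hS.2]; exact List.Subset.refl _
      · rw [hS]; exact List.subset_cons_self _ _
  by_cases hfreq : ∃ᶠ i in atTop, LinTrue (α i) (L i) ∧ ∃ P ∈ F.nl, ∃ C,
      LineariseLocal δ p rnd P (α i) (some C) ∧ L (i + 1) = C :: L i
  · obtain ⟨t, ht, h⟩ := extraction_of_frequently_atTop hfreq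
    choose hT P hP C hC hL using h
    refine no_infinite_linearisation hrnd hF (fun i => α (t i)) (fun i => L (t i)) P C
      (fun i => hinv (t i)) hT hP hC fun i j hij => ?_
    have h1 : C i ∈ L (t i + 1) := by rw [hL]; simp
    exact hmono _ _ (ht hij) h1
  · rw [not_frequently, eventually_atTop] at hfreq
    obtain ⟨N, hN⟩ := hfreq
    refine no_infinite_linear hord (fun i => α (N + i)) (fun i => L (N + i))
      (fun i => (hinv _).1) fun i => ?_
    exact (hcases (N + i)).resolve_right (hN _ (Nat.le_add_right _ _))

end

end Ksmt

attribute [fun_prop] Primrec PrimrecPred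

namespace Ksmt

/-! ### Primitive recursive functions and predicates -/

namespace Prim

section

variable {α β γ : Type*} [Primcodable α] [Primcodable β] [Primcodable γ]

@[fun_prop]
theorem id' : Primrec fun x : α => x := Primrec.id

@[fun_prop]
theorem const (y : β) : Primrec fun _ : α => y := Primrec.const y

@[fun_prop]
theorem comp {f : β → γ} {g : α → β} (hf : Primrec f) (hg : Primrec g) :
    Primrec fun x => f (g x) := hf.comp hg

@[fun_prop]
theorem mk {f : α → γ} {g : α → β} (hf : Primrec f) (hg : Primrec g) :
    Primrec fun x => (f x, g x) := hf.pair hg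

@[fun_prop]
theorem fst {f : α → β × γ} (hf : Primrec f) : Primrec fun x => (f x).1 := Primrec.fst.comp hf

@[fun_prop]
theorem snd {f : α → β × γ} (hf : Primrec f) : Primrec fun x => (f x).2 := Primrec.snd.comp hf

@[fun_prop]
theorem ite {c : α → Prop} [DecidablePred c] {f g : α → β} (hc : PrimrecPred c) (hf : Primrec f)
    (hg : Primrec g) : Primrec fun x => if c x then f x else g x := Primrec.ite hc hf hg

@[fun_prop]
theorem natAdd {f g : α → ℕ} (hf : Primrec f) (hg : Primrec g) :
    Primrec fun x => f x + g x := Primrec.nat_add.comp hf hg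

@[fun_prop]
theorem natSub {f g : α → ℕ} (hf : Primrec f) (hg : Primrec g) :
    Primrec fun x => f x - g x := Primrec.nat_sub.comp hf hg

@[fun_prop]
theorem natMul {f g : α → ℕ} (hf : Primrec f) (hg : Primrec g) :
    Primrec fun x => f x * g x := Primrec.nat_mul.comp hf hg

@[fun_prop]
theorem natDiv {f g : α → ℕ} (hf : Primrec f) (hg : Primrec g) :
    Primrec fun x => f x / g x := Primrec.nat_div.comp hf hg

@[fun_prop]
theorem natMod {f g : α → ℕ} (hf : Primrec f) (hg : Primrec g) :
    Primrec fun x => f x % g x := Primrec.nat_mod.comp hf hg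

@[fun_prop]
theorem natPow {f g : α → ℕ} (hf : Primrec f) (hg : Primrec g) :
    Primrec fun x => f x ^ g x :=
  (Primrec₂.unpaired'.mp Nat.Primrec.pow).comp hf hg

@[fun_prop]
theorem natMax {f g : α → ℕ} (hf : Primrec f) (hg : Primrec g) :
    Primrec fun x => max (f x) (g x) := Primrec.nat_max.comp hf hg

@[fun_prop]
theorem natLe {f g : α → ℕ} (hf : Primrec f) (hg : Primrec g) :
    PrimrecPred fun x => f x ≤ g x := Primrec.nat_le.comp hf hg

@[fun_prop]
theorem natLt {f g : α → ℕ} (hf : Primrec f) (hg : Primrec g) :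
    PrimrecPred fun x => f x < g x := Primrec.nat_lt.comp hf hg

@[fun_prop]
theorem eq [DecidableEq β] {f g : α → β} (hf : Primrec f) (hg : Primrec g) :
    PrimrecPred fun x => f x = g x := Primrec.eq.comp hf hg

@[fun_prop]
theorem and {p q : α → Prop} (hp : PrimrecPred p) (hq : PrimrecPred q) :
    PrimrecPred fun x => p x ∧ q x := hp.and hq

@[fun_prop]
theorem or {p q : α → Prop} (hp : PrimrecPred p) (hq : PrimrecPred q) :
    PrimrecPred fun x => p x ∨ q x := hp.or hq

@[fun_prop]
theorem not {p : α → Prop} (hp : PrimrecPred p) : PrimrecPred fun x => ¬ p x := hp.not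

@[fun_prop]
theorem exists_mem {f : α → List β} {p : α → β → Prop} (hf : Primrec f)
    (hp : PrimrecPred fun x : α × β => p x.1 x.2) : PrimrecPred fun x => ∃ b ∈ f x, p x b :=
  (PrimrecRel.exists_mem_list (R := fun b a => p a b)
    (hp.comp (f := fun x : β × α => (x.2, x.1)) (by fun_prop))).comp hf Primrec.id

@[fun_prop]
theorem forall_mem {f : α → List β} {p : α → β → Prop} (hf : Primrec f)
    (hp : PrimrecPred fun x : α × β => p x.1 x.2) : PrimrecPred fun x => ∀ b ∈ f x, p x b :=
  (PrimrecRel.forall_mem_list (R := fun b a => p a b)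
    (hp.comp (f := fun x : β × α => (x.2, x.1)) (by fun_prop))).comp hf Primrec.id

theorem mem_list [DecidableEq β] {f : α → β} {g : α → List β} (hf : Primrec f) (hg : Primrec g) :
    PrimrecPred fun x => f x ∈ g x :=
  PrimrecPred.of_eq (p := fun x => ∃ b ∈ g x, b = f x) (by fun_prop) fun x => by simp

@[fun_prop]
theorem cons {f : α → β} {g : α → List β} (hf : Primrec f) (hg : Primrec g) :
    Primrec fun x => f x :: g x := Primrec.list_cons.comp hf hg

@[fun_prop]
theorem append {f g : α → List β} (hf : Primrec f) (hg : Primrec g) :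
    Primrec fun x => f x ++ g x := Primrec.list_append.comp hf hg

@[fun_prop]
theorem map {f : α → List β} {g : α → β → γ} (hf : Primrec f)
    (hg : Primrec fun x : α × β => g x.1 x.2) : Primrec fun x => (f x).map (g x) :=
  Primrec.list_map hf hg

@[fun_prop]
theorem flatMap {f : α → List β} {g : α → β → List γ} (hf : Primrec f)
    (hg : Primrec fun x : α × β => g x.1 x.2) : Primrec fun x => (f x).flatMap (g x) :=
  Primrec.list_flatMap hf hg

@[fun_prop]
theorem foldr {f : α → List β} {g : α → γ} {h : α → β → γ → γ} (hf : Primrec f) (hg : Primrec g)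
    (hh : Primrec fun x : α × β × γ => h x.1 x.2.1 x.2.2) :
    Primrec fun x => (f x).foldr (h x) (g x) :=
  Primrec.list_foldr (h := fun a x => h a x.1 x.2) hf hg hh

@[fun_prop]
theorem length {f : α → List β} (hf : Primrec f) : Primrec fun x => (f x).length :=
  Primrec.list_length.comp hf

@[fun_prop]
theorem range {f : α → ℕ} (hf : Primrec f) : Primrec fun x => List.range (f x) :=
  Primrec.list_range.comp hf

@[fun_prop]
theorem take {f : α → ℕ} {g : α → List β} (hf : Primrec f) (hg : Primrec g) :
    Primrec fun x => (g x).take (f x) := Primrec.list_take.comp hf hg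

@[fun_prop]
theorem getElem? {f : α → ℕ} {g : α → List β} (hf : Primrec f) (hg : Primrec g) :
    Primrec fun x => (g x)[f x]? := Primrec.list_getElem?.comp hg hf

@[fun_prop]
theorem some {f : α → β} (hf : Primrec f) : Primrec fun x => Option.some (f x) :=
  Primrec.option_some.comp hf

@[fun_prop]
theorem getD {f : α → Option β} {g : α → β} (hf : Primrec f) (hg : Primrec g) :
    Primrec fun x => (f x).getD (g x) := Primrec.option_getD.comp hf hg

@[fun_prop]
theorem lookup [DecidableEq β] {f : α → β} {g : α → List (β × γ)} (hf : Primrec f)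
    (hg : Primrec g) : Primrec fun x => List.lookup (f x) (g x) := Primrec.listLookup.comp hf hg

@[fun_prop]
theorem inl {f : α → β} (hf : Primrec f) : Primrec fun x => (Sum.inl (f x) : β ⊕ γ) :=
  Primrec.sumInl.comp hf

@[fun_prop]
theorem inr {f : α → γ} (hf : Primrec f) : Primrec fun x => (Sum.inr (f x) : β ⊕ γ) :=
  Primrec.sumInr.comp hf

@[fun_prop]
theorem encode {f : α → β} (hf : Primrec f) : Primrec fun x => Encodable.encode (f x) :=
  Primrec.encode.comp hf

@[fun_prop]
theorem bool_or {f g : α → Bool} (hf : Primrec f) (hg : Primrec g) :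
    Primrec fun x => f x || g x := Primrec.or.comp hf hg

@[fun_prop]
theorem natGcd {f g : α → ℕ} (hf : Primrec f) (hg : Primrec g) :
    Primrec fun x => Nat.gcd (f x) (g x) := by
  -- The sum bounds the gcd even if one argument is `0`; if both are, the search returns `0`, the
  -- value of the gcd.
  have h : Primrec fun x => Nat.findGreatest (fun d => f x % d = 0 ∧ g x % d = 0) (f x + g x) :=
    Primrec.nat_findGreatest (by fun_prop)
      (show PrimrecPred fun x : α × ℕ => f x.1 % x.2 = 0 ∧ g x.1 % x.2 = 0 by fun_prop)
  refine h.of_eq fun x => ?_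
  simp only [← Nat.dvd_iff_mod_eq_zero]
  rcases Nat.eq_zero_or_pos (f x + g x) with h0 | h0
  · have h1 : f x = 0 := by omega
    have h2 : g x = 0 := by omega
    simp [h1, h2]
  · refine le_antisymm ?_ (Nat.le_findGreatest ?_ ⟨Nat.gcd_dvd_left _ _, Nat.gcd_dvd_right _ _⟩)
    · have hpos : 0 < Nat.gcd (f x) (g x) := Nat.gcd_pos_iff.mpr (by omega)
      refine Nat.le_of_dvd hpos ?_
      have := Nat.findGreatest_spec (P := fun d => d ∣ f x ∧ d ∣ g x) (m := 1) (n := f x + g x)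
        (by omega) ⟨one_dvd _, one_dvd _⟩
      exact Nat.dvd_gcd this.1 this.2
    · rcases Nat.eq_zero_or_pos (f x) with h1 | h1
      · simp [h1]
      · exact (Nat.gcd_le_left _ h1).trans (Nat.le_add_right _ _)

/-! Integers -/

/-- Integers are coded by `2n` and `2n + 1` for the two constructors, so parity of the code makes
the case distinction. -/
theorem int_cases {F : α → ℤ → β} (h1 : Primrec fun x : α × ℕ => F x.1 (Int.ofNat x.2))
    (h2 : Primrec fun x : α × ℕ => F x.1 (Int.negSucc x.2)) :
    Primrec fun x : α × ℤ => F x.1 x.2 := by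
  have h : Primrec fun x : α × ℤ => if Encodable.encode x.2 % 2 = 0 then
      F x.1 (Int.ofNat (Encodable.encode x.2 / 2)) else
      F x.1 (Int.negSucc (Encodable.encode x.2 / 2)) :=
    ite (by fun_prop) (h1.comp (show Primrec fun x : α × ℤ => (x.1, Encodable.encode x.2 / 2) by
      fun_prop)) (h2.comp (show Primrec fun x : α × ℤ => (x.1, Encodable.encode x.2 / 2) by
      fun_prop))
  refine h.of_eq fun ⟨a, z⟩ => ?_
  cases z with
  | ofNat n =>
    have : Encodable.encode (Int.ofNat n) = 2 * n := rfl
    change (if Encodable.encode (Int.ofNat n) % 2 = 0 then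
      F a (Int.ofNat (Encodable.encode (Int.ofNat n) / 2)) else _) = F a (Int.ofNat n)
    rw [this, if_pos (by omega), show 2 * n / 2 = n by omega]
  | negSucc n =>
    have : Encodable.encode (Int.negSucc n) = 2 * n + 1 := rfl
    have h3 : (2 * n + 1) / 2 = n := by omega
    simp [this, h3, Nat.add_mod]

theorem intOfNat {f : α → ℕ} (hf : Primrec f) : Primrec fun x => Int.ofNat (f x) := by
  refine Primrec.encode_iff.mp ?_
  change Primrec fun x => 2 * f x
  fun_prop

theorem intNegSucc {f : α → ℕ} (hf : Primrec f) : Primrec fun x => Int.negSucc (f x) := by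
  refine Primrec.encode_iff.mp ?_
  change Primrec fun x => 2 * f x + 1
  fun_prop

theorem intToNat : Primrec Int.toNat := by
  have := int_cases (α := Unit) (F := fun _ => Int.toNat)
    (show Primrec fun x : Unit × ℕ => x.2 by fun_prop)
    (show Primrec fun x : Unit × ℕ => 0 by fun_prop)
  exact this.comp (show Primrec fun x : ℤ => ((), x) by fun_prop)

theorem intNegToNat : Primrec fun z : ℤ => (-z).toNat := by
  have := int_cases (α := Unit) (F := fun _ z => (-z).toNat)
    ((show Primrec fun x : Unit × ℕ => 0 by fun_prop).of_eq fun x => by simp)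
    ((show Primrec fun x : Unit × ℕ => x.2 + 1 by fun_prop).of_eq fun x => rfl)
  exact this.comp (show Primrec fun x : ℤ => ((), x) by fun_prop)

theorem natSubInt {f g : α → ℕ} (hf : Primrec f) (hg : Primrec g) :
    Primrec fun x => (f x : ℤ) - (g x : ℤ) :=
  Primrec.of_eq (f := fun x => if g x ≤ f x then Int.ofNat (f x - g x) else
      Int.negSucc (g x - f x - 1))
    (ite (by fun_prop) (intOfNat (by fun_prop)) (intNegSucc (by fun_prop))) fun x => by
    split_ifs with h
    · simp; omega
    · rw [Int.negSucc_eq]; omega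

/-- Splitting into positive and negative parts reduces integer arithmetic to natural numbers. -/
theorem int_eq_sub (x : ℤ) : x = (x.toNat : ℤ) - ((-x).toNat : ℤ) := by omega

@[fun_prop]
theorem intAdd {f g : α → ℤ} (hf : Primrec f) (hg : Primrec g) :
    Primrec fun x => f x + g x := by
  refine (natSubInt (f := fun x => (f x).toNat + (g x).toNat)
    (g := fun x => (-f x).toNat + (-g x).toNat) ?_ ?_).of_eq fun x => by omega
  · exact natAdd (intToNat.comp hf) (intToNat.comp hg)
  · exact natAdd (intNegToNat.comp hf) (intNegToNat.comp hg)

@[fun_prop]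
theorem intMul {f g : α → ℤ} (hf : Primrec f) (hg : Primrec g) :
    Primrec fun x => f x * g x := by
  have h1 := intToNat.comp hf
  have h2 := intToNat.comp hg
  have h3 := intNegToNat.comp hf
  have h4 := intNegToNat.comp hg
  refine (natSubInt (natAdd (natMul h1 h2) (natMul h3 h4))
    (natAdd (natMul h1 h4) (natMul h3 h2))).of_eq fun x => ?_
  conv_rhs => rw [int_eq_sub (f x), int_eq_sub (g x)]
  push_cast
  ring

@[fun_prop]
theorem intNatAbs {f : α → ℤ} (hf : Primrec f) : Primrec fun x => (f x).natAbs :=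
  (natAdd (intToNat.comp hf) (intNegToNat.comp hf)).of_eq fun x => by omega

theorem intLe {f g : α → ℤ} (hf : Primrec f) (hg : Primrec g) :
    PrimrecPred fun x => f x ≤ g x :=
  (natLe (natAdd (intToNat.comp hf) (intNegToNat.comp hg))
    (natAdd (intToNat.comp hg) (intNegToNat.comp hf))).of_eq fun x => by omega

@[fun_prop]
theorem intCast {f : α → ℕ} (hf : Primrec f) : Primrec fun x => (f x : ℤ) := intOfNat hf

theorem intDivNat {f : α → ℤ} {g : α → ℕ} (hf : Primrec f) (hg : Primrec g)
    (hpos : ∀ x, 0 < g x) : Primrec fun x => f x / (g x : ℤ) := by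
  have := int_cases (F := fun x z => z / (g x : ℤ))
    ((intOfNat (f := fun x : α × ℕ => x.2 / g x.1)
      (natDiv (by fun_prop) (hg.comp Primrec.fst))).of_eq fun x => by simp)
    ((intNegSucc (f := fun x : α × ℕ => x.2 / g x.1)
      (natDiv (by fun_prop) (hg.comp Primrec.fst))).of_eq fun x => by
        rw [Int.negSucc_ediv _ (by exact_mod_cast hpos x.1), Int.negSucc_eq]
        rfl)
  exact this.comp (show Primrec fun x => (x, f x) by fun_prop)

end

/-! Rational numbers -/

instance ratCodePred_decidable : DecidablePred fun c : RCode => c.2 ≠ 0 ∧ c.1.natAbs.Coprime c.2 :=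
  fun _ => inferInstance

theorem ratCodePred : PrimrecPred fun c : RCode => c.2 ≠ 0 ∧ c.1.natAbs.Coprime c.2 :=
  (show PrimrecPred fun c : RCode => ¬ c.2 = 0 ∧ c.1.natAbs.gcd c.2 = 1 by fun_prop)

/-- Rational numbers are coded by the reduced pairs of a numerator and a denominator. -/
def ratEquiv : ℚ ≃ {c : RCode // c.2 ≠ 0 ∧ c.1.natAbs.Coprime c.2} where
  toFun q := ⟨ratCode q, q.den_nz, q.reduced⟩
  invFun c := ⟨c.1.1, c.1.2, c.2.1, c.2.2⟩
  left_inv _ := rfl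
  right_inv _ := rfl

/-- In this coding a map into `ℚ` is primitive recursive exactly if its reduced pair of numerator
and denominator is, see `ratCode_iff`. -/
instance primcodableRat : Primcodable ℚ :=
  letI := Primcodable.subtype ratCodePred
  Primcodable.ofEquiv _ ratEquiv

section

variable {α : Type*} [Primcodable α]

theorem ratCode_iff {f : α → ℚ} : (Primrec fun x => ratCode (f x)) ↔ Primrec f := by
  let := Primcodable.subtype ratCodePred
  exact (Primrec.subtype_val_iff (hp := ratCodePred) (f := fun x => ratEquiv (f x))).trans
    (Primrec.of_equiv_iff ratEquiv)

@[fun_prop]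
theorem ratCode {f : α → ℚ} (hf : Primrec f) : Primrec fun x => ratCode (f x) :=
  ratCode_iff.mpr hf

@[fun_prop]
theorem ratNum {f : α → ℚ} (hf : Primrec f) : Primrec fun x => (f x).num :=
  Primrec.fst.comp (ratCode hf)

@[fun_prop]
theorem ratDen {f : α → ℚ} (hf : Primrec f) : Primrec fun x => (f x).den :=
  Primrec.snd.comp (ratCode hf)

theorem mkRat' {f : α → ℤ} {g : α → ℕ} (hf : Primrec f) (hg : Primrec g) (hpos : ∀ x, 0 < g x) :
    Primrec fun x => mkRat (f x) (g x) := by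
  refine ratCode_iff.mp ?_
  have h1 : Primrec fun x => (g x).gcd (f x).natAbs := by fun_prop
  refine ((intDivNat hf h1 fun x => Nat.gcd_pos_of_pos_left _ (hpos x)).pair
    (natDiv hg h1)).of_eq fun x => ?_
  rw [Ksmt.ratCode, Rat.num_mkRat, Rat.den_mkRat, if_neg (hpos x).ne', if_neg (hpos x).ne']

@[fun_prop]
theorem ratAdd {f g : α → ℚ} (hf : Primrec f) (hg : Primrec g) :
    Primrec fun x => f x + g x :=
  (mkRat' (f := fun x => (f x).num * (g x).den + (g x).num * (f x).den)
    (g := fun x => (f x).den * (g x).den) (by fun_prop) (by fun_prop)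
    fun x => Nat.mul_pos (f x).pos (g x).pos).of_eq fun x => (Rat.add_def' _ _).symm

@[fun_prop]
theorem ratMul {f g : α → ℚ} (hf : Primrec f) (hg : Primrec g) :
    Primrec fun x => f x * g x :=
  (mkRat' (f := fun x => (f x).num * (g x).num)
    (g := fun x => (f x).den * (g x).den) (by fun_prop) (by fun_prop)
    fun x => Nat.mul_pos (f x).pos (g x).pos).of_eq fun x => (Rat.mul_def' _ _).symm

@[fun_prop]
theorem ratNeg {f : α → ℚ} (hf : Primrec f) : Primrec fun x => -f x :=
  (ratMul (const (-1)) hf).of_eq fun x => by ring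

@[fun_prop]
theorem ratSub {f g : α → ℚ} (hf : Primrec f) (hg : Primrec g) :
    Primrec fun x => f x - g x :=
  (ratAdd hf (ratNeg hg)).of_eq fun x => by ring

@[fun_prop]
theorem ratIntCast {f : α → ℤ} (hf : Primrec f) : Primrec fun x => (f x : ℚ) :=
  (mkRat' hf (const 1) fun _ => Nat.one_pos).of_eq fun x => by rw [Rat.mkRat_eq_div]; simp

@[fun_prop]
theorem ratDivNat {f : α → ℤ} {g : α → ℕ} (hf : Primrec f) (hg : Primrec g) :
    Primrec fun x => (f x : ℚ) / (g x : ℚ) :=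
  Primrec.of_eq (f := fun x => if g x = 0 then 0 else mkRat (f x) (g x - 1 + 1))
    (ite (by fun_prop) (by fun_prop) (mkRat' hf (by fun_prop) fun x => Nat.succ_pos _)) fun x => by
    split_ifs with h
    · simp [h]
    · rw [Nat.sub_add_cancel (Nat.pos_of_ne_zero h), Rat.mkRat_eq_div]

@[fun_prop]
theorem ratTwoPow {f : α → ℕ} (hf : Primrec f) : Primrec fun x => (2 : ℚ) ^ f x :=
  Primrec.of_eq (f := fun x => (((2 ^ f x : ℕ) : ℤ) : ℚ)) (by fun_prop) fun x => by push_cast; rfl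

@[fun_prop]
theorem ratHalfPow {f : α → ℕ} (hf : Primrec f) : Primrec fun x => (1 / 2 : ℚ) ^ f x :=
  Primrec.of_eq (f := fun x => ((1 : ℤ) : ℚ) / ((2 ^ f x : ℕ) : ℚ)) (by fun_prop) fun x => by
    push_cast; rw [one_div_pow]

@[fun_prop]
theorem ratSum {f : α → List ℚ} (hf : Primrec f) : Primrec fun x => (f x).sum :=
  show Primrec fun x => (f x).foldr (· + ·) 0 by fun_prop

theorem ratNonneg {f : α → ℚ} (hf : Primrec f) : PrimrecPred fun x => 0 ≤ f x :=
  (intLe (const 0) (ratNum hf)).of_eq fun _ => Rat.num_nonneg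

@[fun_prop]
theorem ratPos {f : α → ℚ} (hf : Primrec f) : PrimrecPred fun x => 0 < f x :=
  (ratNonneg (ratNeg hf)).not.of_eq fun x => by simp

@[fun_prop]
theorem rel {s : α → Bool} {f : α → ℚ} (hs : Primrec s) (hf : Primrec f) :
    PrimrecPred fun x => Rel (s x) (f x) := by
  have := ratNonneg hf
  exact PrimrecPred.of_eq (p := fun x => (s x = true ∧ 0 < f x) ∨ (¬ s x = true ∧ 0 ≤ f x))
    (by fun_prop) fun x => by unfold Rel; split_ifs with h <;> simp [h]

end

end Prim

end Ksmt

namespace Ksmt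

/-! ### Recursively enumerable predicates -/

/-- Recursively enumerable predicates, as projections of primitive recursive relations. -/
def RE {α : Type*} [Primcodable α] (P : α → Prop) : Prop :=
  ∃ q : α → ℕ → Prop, PrimrecRel q ∧ ∀ a, P a ↔ ∃ n, q a n

attribute [fun_prop] RE

namespace RE

section

variable {α β γ : Type*} [Primcodable α] [Primcodable β] [Primcodable γ]

theorem of_prim {P : α → Prop} (hP : PrimrecPred P) : RE P :=
  ⟨fun a _ => P a, hP.comp Primrec.fst, fun a => by simp⟩

theorem of_iff {P Q : α → Prop} (hP : RE P) (h : ∀ a, Q a ↔ P a) : RE Q := by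
  obtain ⟨q, hq, hPq⟩ := hP
  exact ⟨q, hq, fun a => (h a).trans (hPq a)⟩

theorem comp {P : β → Prop} (hP : RE P) {f : α → β} (hf : Primrec f) : RE fun a => P (f a) := by
  obtain ⟨q, hq, hPq⟩ := hP
  exact ⟨fun a n => q (f a) n, hq.comp (hf.comp Primrec.fst) Primrec.snd, fun a => hPq (f a)⟩

@[fun_prop]
theorem and {P Q : α → Prop} (hP : RE P) (hQ : RE Q) : RE fun a => P a ∧ Q a := by
  obtain ⟨p, hp, hPp⟩ := hP
  obtain ⟨q, hq, hQq⟩ := hQ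
  refine ⟨fun a n => p a n.unpair.1 ∧ q a n.unpair.2,
    PrimrecPred.and (hp.comp Primrec.fst (Primrec.fst.comp (Primrec.unpair.comp Primrec.snd)))
      (hq.comp Primrec.fst (Primrec.snd.comp (Primrec.unpair.comp Primrec.snd))), fun a => ?_⟩
  dsimp only
  rw [hPp, hQq]
  constructor
  · rintro ⟨⟨i, hi⟩, j, hj⟩
    exact ⟨Nat.pair i j, by simpa using ⟨hi, hj⟩⟩
  · rintro ⟨n, h1, h2⟩
    exact ⟨⟨_, h1⟩, _, h2⟩

@[fun_prop]
theorem or {P Q : α → Prop} (hP : RE P) (hQ : RE Q) : RE fun a => P a ∨ Q a := by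
  obtain ⟨p, hp, hPp⟩ := hP
  obtain ⟨q, hq, hQq⟩ := hQ
  exact ⟨fun a n => p a n ∨ q a n, PrimrecPred.or hp hq, fun a => by
    dsimp only; rw [hPp, hQq, exists_or]⟩

@[fun_prop]
theorem exists_ {P : α → β → Prop} (hP : RE fun x : α × β => P x.1 x.2) :
    RE fun a => ∃ b, P a b := by
  obtain ⟨p, hp, hPp⟩ := hP
  have hdec : Primrec fun n : ℕ => (Encodable.decode (α := β) n.unpair.1).toList :=
    Primrec.optionToList.comp (Primrec.decode.comp (Primrec.fst.comp Primrec.unpair))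
  refine ⟨fun a n => ∃ b ∈ (Encodable.decode (α := β) n.unpair.1).toList, p (a, b) n.unpair.2,
    Prim.exists_mem (hdec.comp Primrec.snd)
      (PrimrecRel.comp hp (f := fun x : (α × ℕ) × β => (x.1.1, x.2))
        (g := fun x : (α × ℕ) × β => x.1.2.unpair.2) (by fun_prop)
        (Primrec.snd.comp (Primrec.unpair.comp (by fun_prop)))), fun a => ?_⟩
  constructor
  · rintro ⟨b, hb⟩
    obtain ⟨n, hn⟩ := (hPp (a, b)).mp hb
    exact ⟨Nat.pair (Encodable.encode b) n, b, by simp, by simpa using hn⟩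
  · rintro ⟨n, b, _, hb⟩
    exact ⟨b, (hPp (a, b)).mpr ⟨_, hb⟩⟩

@[fun_prop]
-- The list is finite, so its members have witnesses below a common bound, and this bound is the new
-- search parameter.
theorem forall_mem {f : α → List β} {P : α → β → Prop} (hf : Primrec f)
    (hP : RE fun x : α × β => P x.1 x.2) : RE fun a => ∀ b ∈ f a, P a b := by
  obtain ⟨p, hp, hPp⟩ := hP
  refine ⟨fun a n => ∀ b ∈ f a, ∃ m ∈ List.range n, p (a, b) m,
    Prim.forall_mem (hf.comp Primrec.fst) (Prim.exists_mem (by fun_prop)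
      (PrimrecRel.comp hp (f := fun x : ((α × ℕ) × β) × ℕ => (x.1.1.1, x.1.2))
        (by fun_prop) Primrec.snd)), fun a => ?_⟩
  simp only [fun b => hPp (a, b), List.mem_range]
  generalize f a = l
  constructor
  · intro h
    induction l with
    | nil => exact ⟨0, by simp⟩
    | cons b l ih =>
      obtain ⟨n, hn⟩ := ih fun c hc => h c (List.mem_cons_of_mem _ hc)
      obtain ⟨m, hm⟩ := h b List.mem_cons_self
      refine ⟨max n (m + 1), fun c hc => ?_⟩
      rcases List.mem_cons.mp hc with rfl | hc
      · exact ⟨m, by omega, hm⟩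
      · obtain ⟨k, hk, hk'⟩ := hn c hc
        exact ⟨k, by omega, hk'⟩
  · rintro ⟨n, hn⟩ b hb
    obtain ⟨m, _, hm⟩ := hn b hb
    exact ⟨m, hm⟩

@[fun_prop]
theorem eq {f g : α → β} (hf : Primrec f) (hg : Primrec g) : RE fun x => f x = g x := by
  classical
  exact of_prim (by fun_prop)

@[fun_prop]
theorem not {P : α → Prop} (hP : PrimrecPred P) : RE fun x => ¬ P x := of_prim (by fun_prop)

@[fun_prop]
theorem mem_list {f : α → β} {g : α → List β} (hf : Primrec f) (hg : Primrec g) :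
    RE fun x => f x ∈ g x := by
  classical
  exact of_prim (Prim.mem_list hf hg)

@[fun_prop]
theorem natLt {f g : α → ℕ} (hf : Primrec f) (hg : Primrec g) :
    RE fun x => f x < g x := of_prim (by fun_prop)

@[fun_prop]
theorem ratPos {f : α → ℚ} (hf : Primrec f) : RE fun x => 0 < f x := of_prim (by fun_prop)

@[fun_prop]
theorem rel {s : α → Bool} {f : α → ℚ} (hs : Primrec s) (hf : Primrec f) :
    RE fun x => Rel (s x) (f x) := of_prim (by fun_prop)

/-- Derivations, oracle runs and runs of the calculus all become searchable through this closure
property. -/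
theorem hist {f : α → List β} {J : α → List β → β → Prop} (hf : Primrec f)
    (hJ : RE fun x : α × List β × β => J x.1 x.2.1 x.2.2) : RE fun a => Hist (J a) (f a) := by
  have h : RE fun a => ∀ i ∈ List.range (f a).length, ∃ x, (f a)[i]? = some x ∧
      J a ((f a).take i) x :=
    forall_mem (by fun_prop) (exists_ (and (by fun_prop)
      (hJ.comp (f := fun x : (α × ℕ) × β => (x.1.1, (f x.1.1).take x.1.2, x.2)) (by fun_prop))))
  refine h.of_iff fun a => ?_
  simp only [List.mem_range]
  constructor
  · intro h i hi
    exact ⟨(f a)[i], by simp [hi], h i _ (by simp [hi])⟩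
  · intro h i x hx
    have hi : i < (f a).length := by
      by_contra hc
      rw [List.getElem?_eq_none (not_lt.mp hc)] at hx
      cases hx
    obtain ⟨y, hy, hJ⟩ := h i hi
    rw [hy, Option.some_inj] at hx
    rwa [← hx]

/-- Only the graph of `g` is assumed to be recursively enumerable, so the equality is checked entry
by entry. -/
theorem eq_map {f : α → List β} {h : α → List γ} {g : α → β → γ}
    (hf : Primrec f) (hh : Primrec h) (hg : RE fun x : α × β × γ => x.2.2 = g x.1 x.2.1) :
    RE fun a => h a = (f a).map (g a) := by
  have H : RE fun a => (h a).length = (f a).length ∧ ∀ i ∈ List.range (f a).length,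
      ∃ x, ∃ y, (f a)[i]? = some x ∧ (h a)[i]? = some y ∧ y = g a x :=
    and (by fun_prop) (forall_mem (by fun_prop) (exists_ (exists_ (and (by fun_prop)
      (and (by fun_prop) (hg.comp (f := fun x : ((α × ℕ) × β) × γ => (x.1.1.1, x.1.2, x.2))
        (by fun_prop)))))))
  refine H.of_iff fun a => ?_
  simp only [List.mem_range]
  constructor
  · intro he
    rw [he]
    refine ⟨by simp, fun i hi => ⟨(f a)[i], g a (f a)[i], by simp [hi], by simp [hi], rfl⟩⟩
  · rintro ⟨hl, he⟩
    refine List.ext_getElem? fun i => ?_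
    by_cases hi : i < (f a).length
    · obtain ⟨x, y, hx, hy, rfl⟩ := he i hi
      rw [hy, List.getElem?_map, hx]
      rfl
    · rw [List.getElem?_eq_none (by omega), List.getElem?_eq_none (by simp; omega)]

theorem eval {M : α → Nat.Partrec.Code} {n x : α → ℕ} (hM : Primrec M) (hn : Primrec n)
    (hx : Primrec x) : RE fun a => x a ∈ (M a).eval (n a) := by
  have h : RE fun a => ∃ k, (M a).evaln k (n a) = some (x a) :=
    exists_ (of_prim (Prim.eq (Nat.Partrec.Code.primrec_evaln.comp
      (show Primrec fun y : α × ℕ => ((y.2, M y.1), n y.1) by fun_prop)) (by fun_prop)))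
  refine h.of_iff fun a => ?_
  rw [Nat.Partrec.Code.evaln_complete]
  rfl

theorem eq_computable {F : β → γ} (hF : Computable F) {f : α → β} {g : α → γ} (hf : Primrec f)
    (hg : Primrec g) : RE fun a => g a = F (f a) := by
  obtain ⟨c, hc⟩ := Nat.Partrec.Code.exists_code.mp hF
  refine (eval (M := fun _ => c) (n := fun a => Encodable.encode (f a))
    (x := fun a => Encodable.encode (g a)) (by fun_prop) (by fun_prop) (by fun_prop)).of_iff
    fun a => ?_
  rw [hc]
  simp [eq_comm]

/-- A solution of a recursively enumerable relation can be searched for. -/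
theorem exists_partrec {P : α → β → Prop} (hP : RE fun x : α × β => P x.1 x.2) :
    ∃ f : α →. β, Partrec f ∧ (∀ a b, b ∈ f a → P a b) ∧
      ∀ a, (∃ b, P a b) → ∃ b, b ∈ f a := by
  classical
  obtain ⟨p, hp, hPp⟩ := hP
  -- The search index pairs a code of a candidate `b` with a witness for it.
  let g : α → ℕ → Option β := fun a n =>
    (Encodable.decode (α := β) n.unpair.1).bind fun b => if p (a, b) n.unpair.2 then some b else none
  have hg : Primrec₂ g := by
    refine Primrec.option_bind (Primrec.decode.comp
      (Primrec.fst.comp (Primrec.unpair.comp Primrec.snd))) ?_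
    refine Prim.ite (PrimrecRel.comp hp (f := fun x : (α × ℕ) × β => (x.1.1, x.2))
        (g := fun x : (α × ℕ) × β => x.1.2.unpair.2) (by fun_prop)
        (Primrec.snd.comp (Primrec.unpair.comp (by fun_prop)))) (by fun_prop) (by fun_prop)
  refine ⟨fun a => Nat.rfindOpt (g a), Partrec.rfindOpt hg.to_comp, fun a b hb => ?_, ?_⟩
  · obtain ⟨n, hn⟩ := Nat.rfindOpt_spec hb
    simp only [g, Option.mem_def, Option.bind_eq_some_iff] at hn
    obtain ⟨c, _, hc⟩ := hn
    split_ifs at hc with h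
    cases hc
    exact (hPp (a, b)).mpr ⟨_, h⟩
  · rintro a ⟨b, hb⟩
    obtain ⟨n, hn⟩ := (hPp (a, b)).mp hb
    exact Part.dom_iff_mem.mp (Nat.rfindOpt_dom.mpr
      ⟨Nat.pair (Encodable.encode b) n, b, by simp [g, hn]⟩)

end

end RE

/-! ### Effectivity of the linear part -/

def atomEquiv : Atom ≃ ℚ × List ℚ × Bool where
  toFun a := (a.const, a.coeffs, a.strict)
  invFun t := ⟨t.1, t.2.1, t.2.2⟩
  left_inv _ := rfl
  right_inv _ := rfl

instance : Primcodable Atom := Primcodable.ofEquiv _ atomEquiv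

def stateEquiv : State ≃ (Assign × List Clause) ⊕ Fin 3 where
  toFun
    | .run α L => Sum.inl (α, L)
    | .sat => Sum.inr 0
    | .deltaSat => Sum.inr 1
    | .unsat => Sum.inr 2
  invFun
    | Sum.inl t => .run t.1 t.2
    | Sum.inr 0 => .sat
    | Sum.inr 1 => .deltaSat
    | Sum.inr 2 => .unsat
  left_inv S := by cases S <;> rfl
  right_inv t := by
    rcases t with t | t
    · rfl
    · fin_cases t <;> rfl

instance : Primcodable State := Primcodable.ofEquiv _ stateEquiv

namespace Prim

section

variable {α : Type*} [Primcodable α]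

@[fun_prop]
theorem atomConst {f : α → Atom} (hf : Primrec f) : Primrec fun x => (f x).const :=
  Primrec.fst.comp ((Primrec.of_equiv (e := atomEquiv)).comp hf)

@[fun_prop]
theorem atomCoeffs {f : α → Atom} (hf : Primrec f) : Primrec fun x => (f x).coeffs :=
  Primrec.fst.comp (Primrec.snd.comp ((Primrec.of_equiv (e := atomEquiv)).comp hf))

@[fun_prop]
theorem atomStrict {f : α → Atom} (hf : Primrec f) : Primrec fun x => (f x).strict :=
  Primrec.snd.comp (Primrec.snd.comp ((Primrec.of_equiv (e := atomEquiv)).comp hf))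

@[fun_prop]
theorem atomMk {f : α → ℚ} {g : α → List ℚ} {s : α → Bool} (hf : Primrec f) (hg : Primrec g)
    (hs : Primrec s) : Primrec fun x => (⟨f x, g x, s x⟩ : Atom) :=
  (Primrec.of_equiv_symm (e := atomEquiv)).comp (hf.pair (hg.pair hs))

@[fun_prop]
theorem atomCoeff {f : α → Atom} {i : α → ℕ} (hf : Primrec f) (hi : Primrec i) :
    Primrec fun x => (f x).coeff (i x) :=
  Primrec.of_eq (f := fun x => ((f x).coeffs[i x]?).getD 0) (by fun_prop) fun x => by
    simp [Atom.coeff, List.getD]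

@[fun_prop]
theorem fmResolve {z : α → ℕ} {l u : α → Atom} (hz : Primrec z) (hl : Primrec l)
    (hu : Primrec u) : Primrec fun x => Ksmt.fmResolve (z x) (l x) (u x) := by
  unfold Ksmt.fmResolve
  fun_prop

@[fun_prop]
theorem assignVal {f : α → Assign} {i : α → ℕ} (hf : Primrec f) (hi : Primrec i) :
    Primrec fun x => (f x).val (i x) := by
  unfold Assign.val
  fun_prop

@[fun_prop]
theorem assigned {f : α → Assign} {i : α → ℕ} (hf : Primrec f) (hi : Primrec i) :
    PrimrecPred fun x => (f x).Assigned (i x) := mem_list hi (by fun_prop)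

@[fun_prop]
theorem qvalue {f : α → Assign} {a : α → Atom} (hf : Primrec f) (ha : Primrec a) :
    Primrec fun x => (a x).qvalue (f x).val := by
  unfold Atom.qvalue
  fun_prop

theorem vars_assigned {f : α → Assign} {a : α → Atom} (hf : Primrec f) (ha : Primrec a) :
    PrimrecPred fun x => ∀ i ∈ (a x).vars, (f x).Assigned i :=
  PrimrecPred.of_eq (p := fun x => ∀ i ∈ List.range (a x).coeffs.length,
    (a x).coeff i = 0 ∨ (f x).Assigned i) (by fun_prop) fun x =>
    ⟨fun h i hi => (h i (List.mem_range.mpr (Atom.lt_length_of_mem_vars hi))).resolve_left hi,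
      fun h i _ => or_iff_not_imp_left.mpr fun hi => h i hi⟩

@[fun_prop]
theorem atomIsFalse {f : α → Assign} {a : α → Atom} (hf : Primrec f) (ha : Primrec a) :
    PrimrecPred fun x => (a x).IsFalse (f x) :=
  ((vars_assigned hf ha).and (rel (atomStrict ha) (qvalue hf ha)).not).of_eq fun x => by
    rw [Atom.IsFalse, Atom.holds_toReal]

@[fun_prop]
theorem atomIsTrue {f : α → Assign} {a : α → Atom} (hf : Primrec f) (ha : Primrec a) :
    PrimrecPred fun x => (a x).IsTrue (f x) :=
  ((vars_assigned hf ha).and (rel (atomStrict ha) (qvalue hf ha))).of_eq fun x => by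
    rw [Atom.IsTrue, Atom.holds_toReal]

@[fun_prop]
theorem clauseIsFalse {f : α → Assign} {C : α → Clause} (hf : Primrec f) (hC : Primrec C) :
    PrimrecPred fun x => (C x).IsFalse (f x) :=
  show PrimrecPred fun x => ∀ a ∈ C x, a.IsFalse (f x) by fun_prop

@[fun_prop]
theorem linFalse {f : α → Assign} {L : α → List Clause} (hf : Primrec f) (hL : Primrec L) :
    PrimrecPred fun x => LinFalse (f x) (L x) :=
  show PrimrecPred fun x => ∃ C ∈ L x, C.IsFalse (f x) by fun_prop

theorem linTrue {f : α → Assign} {L : α → List Clause} (hf : Primrec f) (hL : Primrec L) :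
    PrimrecPred fun x => LinTrue (f x) (L x) :=
  show PrimrecPred fun x => ∀ C ∈ L x, ∃ a ∈ C, a.IsTrue (f x) by fun_prop

@[fun_prop]
theorem stateRun {f : α → Assign} {L : α → List Clause} (hf : Primrec f) (hL : Primrec L) :
    Primrec fun x => State.run (f x) (L x) :=
  (Primrec.of_equiv_symm (e := stateEquiv)).comp (inl (hf.pair hL))

@[fun_prop]
theorem atomCode {f : α → Atom} (hf : Primrec f) : Primrec fun x => (f x).code := by
  unfold Atom.code
  fun_prop

@[fun_prop]
theorem linCode {f : α → List Clause} (hf : Primrec f) : Primrec fun x => linCode (f x) := by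
  unfold Ksmt.linCode
  fun_prop

@[fun_prop]
theorem stateCode {f : α → State} (hf : Primrec f) : Primrec fun x => (f x).code := by
  have h : Primrec fun x => Sum.casesOn (motive := fun _ => SCode) (stateEquiv (f x))
      (fun t => Sum.inl (t.1.map fun b => (b.1, Ksmt.ratCode b.2), Ksmt.linCode t.2))
      (fun t => Sum.inr t.val) :=
    Primrec.sumCasesOn ((Primrec.of_equiv (e := stateEquiv)).comp hf)
      (show Primrec fun y : α × (Assign × List Clause) =>
        (Sum.inl (y.2.1.map fun b => (b.1, Ksmt.ratCode b.2), Ksmt.linCode y.2.2) : SCode) by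
        fun_prop)
      (inr (Primrec.fin_val.comp Primrec.snd))
  refine h.of_eq fun x => ?_
  cases f x <;> rfl

theorem boundAtom {i : α → ℕ} {s c : α → ℚ} (hi : Primrec i) (hs : Primrec s) (hc : Primrec c) :
    Primrec fun x => Ksmt.boundAtom (i x) (s x) (c x) :=
  Primrec.of_eq (f := fun x => (⟨c x, ((List.range (i x)).map fun _ => 0) ++ [s x], false⟩ : Atom))
    (by fun_prop) fun x => by simp [Ksmt.boundAtom]

theorem outsideBall {args : α → List ℕ} {f : α → Assign} {r : α → ℚ} (ha : Primrec args)
    (hf : Primrec f) (hr : Primrec r) :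
    Primrec fun x => Ksmt.outsideBall (args x) (f x).val (r x) := by
  unfold Ksmt.outsideBall
  refine flatMap ha (cons (boundAtom ?_ ?_ ?_) (cons (boundAtom ?_ ?_ ?_) ?_)) <;> fun_prop

end

end Prim

/-- One step of a derivation by resolution on `z` from the clauses that are false for some value of
`z`. -/
def DerivStep (α : Assign) (L : List Clause) (z : ℕ) (W : List Clause) (E : Clause) : Prop :=
  (∃ C ∈ L, (∃ q : ℚ, C.IsFalse (α ++ [(z, q)])) ∧ (∀ a ∈ E, a ∈ C) ∧ ∀ a ∈ C, a ∈ E) ∨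
  ∃ C ∈ W, ∃ D ∈ W, ∃ l ∈ C, ∃ u ∈ D, 0 < l.coeff z ∧ 0 < -u.coeff z ∧
    (∀ a ∈ E, a ∈ C ∧ ¬ a = l ∨ a ∈ D ∧ ¬ a = u ∨ a = fmResolve z l u) ∧
    (∀ a ∈ C, a = l ∨ a ∈ E) ∧ (∀ a ∈ D, a = u ∨ a ∈ E) ∧ fmResolve z l u ∈ E

namespace RE

section

variable {α : Type*} [Primcodable α]

@[fun_prop]
theorem clauseIsFalse {f : α → Assign} {C : α → Clause} (hf : Primrec f) (hC : Primrec C) :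
    RE fun x => (C x).IsFalse (f x) := of_prim (by fun_prop)

@[fun_prop]
theorem linFalse {f : α → Assign} {L : α → List Clause} (hf : Primrec f) (hL : Primrec L) :
    RE fun x => LinFalse (f x) (L x) := of_prim (by fun_prop)

@[fun_prop]
theorem linTrue {f : α → Assign} {L : α → List Clause} (hf : Primrec f) (hL : Primrec L) :
    RE fun x => LinTrue (f x) (L x) := of_prim (Prim.linTrue hf hL)

@[fun_prop]
theorem assigned {f : α → Assign} {i : α → ℕ} (hf : Primrec f) (hi : Primrec i) :
    RE fun x => (f x).Assigned (i x) := of_prim (by fun_prop)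

theorem derivStep : RE fun x : (Assign × List Clause × ℕ) × List Clause × Clause =>
    DerivStep x.1.1 x.1.2.1 x.1.2.2 x.2.1 x.2.2 := by
  unfold DerivStep
  fun_prop

theorem derivStep_mono {α : Assign} {L : List Clause} {z : ℕ} {W W' : List Clause} {E : Clause}
    (h : DerivStep α L z W E) (hW : W ⊆ W') : DerivStep α L z W' E := by
  rcases h with h | ⟨C, hC, D, hD, h⟩
  · exact Or.inl h
  · exact Or.inr ⟨C, hW hC, D, hW hD, h⟩

/-- A derivation tree is flattened to a sequence with premises before conclusions. The sequences for
two premises are concatenated; the second stays justified, since additional preceding clauses do no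
harm. -/
theorem deriv_iff {α : Assign} {L : List Clause} {z : ℕ} {E : Clause} :
    Deriv (ConflictBase α L z) z E ↔ ∃ W, Hist (DerivStep α L z) W ∧ E ∈ W := by
  constructor
  · intro h
    induction h with
    | @base C E hC hE =>
      refine ⟨[E], hist_snoc (l := []).mpr ⟨.nil _, Or.inl ⟨C, hC.1, hC.2, fun a => (hE a).mp,
        fun a => (hE a).mpr⟩⟩, by simp⟩
    | @resolve C D E l u _ _ hl hu hlz huz hE ih1 ih2 =>
      obtain ⟨W1, hW1, hC⟩ := ih1
      obtain ⟨W2, hW2, hD⟩ := ih2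
      have hW : Hist (DerivStep α L z) (W1 ++ W2) := by
        clear hD
        induction W2 using List.reverseRecOn with
        | nil => simpa using hW1
        | append_singleton W x ih =>
          rw [hist_snoc] at hW2
          rw [← List.append_assoc, hist_snoc]
          exact ⟨ih hW2.1, derivStep_mono hW2.2 (List.subset_append_right _ _)⟩
      refine ⟨W1 ++ W2 ++ [E], hist_snoc.mpr ⟨hW, Or.inr ⟨C, List.mem_append_left _ hC, D,
        List.mem_append_right _ hD, l, hl, u, hu, hlz, by linarith, fun a ha => (hE a).mp ha,
        fun a ha => ?_, fun a ha => ?_, (hE _).mpr (Or.inr (Or.inr rfl))⟩⟩, by simp⟩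
      · exact or_iff_not_imp_left.mpr fun h => (hE a).mpr (Or.inl ⟨ha, h⟩)
      · exact or_iff_not_imp_left.mpr fun h => (hE a).mpr (Or.inr (Or.inl ⟨ha, h⟩))
  · rintro ⟨W, hW, hE⟩
    induction W using List.reverseRecOn generalizing E with
    | nil => simp at hE
    | append_singleton W x ih =>
      rw [hist_snoc] at hW
      rw [List.mem_append, List.mem_singleton] at hE
      rcases hE with hE | rfl
      · exact ih hW.1 hE
      · rcases hW.2 with ⟨C, hC, hq, h1, h2⟩ | ⟨C, hC, D, hD, l, hl, u, hu, hlz, huz, h1, h2, h3, h4⟩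
        · exact .base ⟨hC, hq⟩ fun a => ⟨h1 a, h2 a⟩
        · refine .resolve (ih hW.1 hC) (ih hW.1 hD) hl hu hlz (by linarith) fun a => ⟨h1 a, ?_⟩
          rintro (h | h | rfl)
          · exact (h2 a h.1).resolve_left h.2
          · exact (h3 a h.1).resolve_left h.2
          · exact h4

@[fun_prop]
theorem deriv {f : α → Assign} {L : α → List Clause} {z : α → ℕ} {E : α → Clause}
    (hf : Primrec f) (hL : Primrec L) (hz : Primrec z) (hE : Primrec E) :
    RE fun x => Deriv (ConflictBase (f x) (L x) (z x)) (z x) (E x) := by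
  have h : RE fun x => ∃ W, Hist (DerivStep (f x) (L x) (z x)) W ∧ E x ∈ W :=
    exists_ (and (hist (J := fun y : α × List Clause => DerivStep (f y.1) (L y.1) (z y.1))
      (by fun_prop) (derivStep.comp (f := fun y : (α × List Clause) × List Clause × Clause =>
        ((f y.1.1, L y.1.1, z y.1.1), y.2.1, y.2.2)) (by fun_prop))) (by fun_prop))
  exact h.of_iff fun x => deriv_iff

theorem nodup_iff_hist {X : Type*} {l : List X} : l.Nodup ↔ Hist (fun l x => x ∉ l) l := by
  induction l using List.reverseRecOn with
  | nil => simp [Hist.nil]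
  | append_singleton l x ih =>
    rw [hist_snoc, ← ih, List.nodup_append]
    refine ⟨fun ⟨h1, _, h3⟩ => ⟨h1, fun hx => h3 x hx x (by simp) rfl⟩,
      fun ⟨h1, h2⟩ => ⟨h1, by simp, fun a ha b hb => ?_⟩⟩
    rw [List.mem_singleton.mp hb]
    rintro rfl
    exact h2 ha

@[fun_prop]
theorem nodup {f : α → Clause} (hf : Primrec f) : RE fun x => (f x).Nodup :=
  (hist (J := fun (_ : α) (l : Clause) x => ¬ x ∈ l) hf
    (of_prim (Prim.not (Prim.mem_list (by fun_prop) (by fun_prop))))).of_iff fun _ => nodup_iff_hist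

end

end RE

/-! ### Effectivity of local linearisations -/

/-- The answers of the oracle to the queries `qs`, for the approximations of the point `α`. -/
def approxAnswers (rnd : ℚ → ℤ) (args : List ℕ) (α : Assign) (qs : List ℕ) : List (List RCode) :=
  qs.map fun m => args.map fun i => ratCode (approx rnd (α.val i) m)

theorem answers_approx (rnd : ℚ → ℤ) (P : NlConstraint) (α : Assign) (qs : List ℕ) :
    answers (fun m j => approx rnd (P.point α.val j) m) qs = approxAnswers rnd P.args α qs := by
  unfold answers approxAnswers NlConstraint.point
  refine List.map_congr_left fun m _ => ?_
  refine List.ext_getElem (by simp) fun i h1 h2 => ?_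
  simp

/-- The run of the machine `M` on the approximations of the point `α`. -/
def OutputsApprox (rnd : ℚ → ℤ) (M : Nat.Partrec.Code) (args : List ℕ) (α : Assign) (p : ℕ)
    (qs : List ℕ) (y : ℚ) : Prop :=
  Hist (fun l m => Moves M p (approxAnswers rnd args α l) (Sum.inl m)) qs ∧
    ∃ c : RCode, Moves M p (approxAnswers rnd args α qs) (Sum.inr c) ∧ y = ratOfCode c

theorem outputs_iff_outputsApprox {rnd : ℚ → ℤ} {P : NlConstraint} {α : Assign} {p : ℕ}
    {qs : List ℕ} {y : ℚ} :
    Outputs P.machine (fun m j => approx rnd (P.point α.val j) m) p qs y ↔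
      OutputsApprox rnd P.machine P.args α p qs y := by
  unfold Outputs OutputsApprox
  rw [asks_iff_hist]
  simp only [answers_approx]

/-- The local linearisation of a constraint given by its code. -/
def LineariseCode (δ : ℚ) (p : ℕ) (rnd : ℚ → ℤ) (P : NCode) (α : Assign) (C : Clause) : Prop :=
  ∃ (qs : List ℕ) (y : ℚ), OutputsApprox rnd P.2.1 P.1 α (p + 2) qs y ∧
    ¬ Rel P.2.2 (y + δ / 2) ∧ C = outsideBall P.1 α.val ((1 / 2) ^ (qs.foldr max 0 + 1))

/-- The local linearisation of a constraint given by its code yields no clause. -/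
def LineariseCodeNone (δ : ℚ) (p : ℕ) (rnd : ℚ → ℤ) (P : NCode) (α : Assign) : Prop :=
  ∃ (qs : List ℕ) (y : ℚ), OutputsApprox rnd P.2.1 P.1 α (p + 2) qs y ∧ Rel P.2.2 (y + δ / 2)

theorem lineariseLocal_some_iff {δ : ℚ} {p : ℕ} {rnd : ℚ → ℤ} {P : NlConstraint} {α : Assign}
    {C : Clause} :
    LineariseLocal δ p rnd P α (some C) ↔ LineariseCode δ p rnd P.code α C := by
  simp only [LineariseLocal, LineariseCode, outputs_iff_outputsApprox, NlConstraint.code]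
  simp

theorem lineariseLocal_none_iff {δ : ℚ} {p : ℕ} {rnd : ℚ → ℤ} {P : NlConstraint} {α : Assign} :
    LineariseLocal δ p rnd P α none ↔ LineariseCodeNone δ p rnd P.code α := by
  simp only [LineariseLocal, LineariseCodeNone, outputs_iff_outputsApprox, NlConstraint.code]
  simp

namespace RE

section

variable {α : Type*} [Primcodable α]

/-- The rounding is computable but not assumed primitive recursive. Its value `a` is therefore
guessed and checked against the graph of `rnd`; everything else is primitive recursive. -/
theorem approxAnswers {rnd : ℚ → ℤ} (hrnd : Computable rnd) {args : α → List ℕ} {f : α → Assign}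
    {qs : α → List ℕ} {h : α → List (List RCode)} (ha : Primrec args) (hf : Primrec f)
    (hq : Primrec qs) (hh : Primrec h) :
    RE fun x => h x = Ksmt.approxAnswers rnd (args x) (f x) (qs x) := by
  refine eq_map hq hh (eq_map (g := fun (y : α × ℕ × List RCode) i =>
    ratCode (approx rnd ((f y.1).val i) y.2.1)) (by fun_prop) (by fun_prop) ?_)
  have h1 : RE fun y : (α × ℕ × List RCode) × ℕ × RCode => ∃ a : ℤ,
      a = rnd ((f y.1.1).val y.2.1 * 2 ^ (y.1.2.1 + 1)) ∧
      y.2.2 = Ksmt.ratCode ((a : ℚ) / ((2 ^ (y.1.2.1 + 1) : ℕ) : ℚ)) :=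
    exists_ (and (eq_computable hrnd (by fun_prop) (by fun_prop)) (by fun_prop))
  refine h1.of_iff fun y => ?_
  simp [approx]

theorem moves {M : α → Nat.Partrec.Code} {p : α → ℕ} {h : α → List (List RCode)}
    {a : α → ℕ ⊕ RCode} (hM : Primrec M) (hp : Primrec p) (hh : Primrec h) (ha : Primrec a) :
    RE fun x => Moves (M x) (p x) (h x) (a x) :=
  eval hM (by fun_prop) (by fun_prop)

theorem moves_approx {rnd : ℚ → ℤ} (hrnd : Computable rnd) {M : α → Nat.Partrec.Code} {p : α → ℕ}
    {args : α → List ℕ} {f : α → Assign} {qs : α → List ℕ} {a : α → ℕ ⊕ RCode} (hM : Primrec M)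
    (hp : Primrec p) (hargs : Primrec args) (hf : Primrec f) (hq : Primrec qs) (ha : Primrec a) :
    RE fun x => Moves (M x) (p x) (Ksmt.approxAnswers rnd (args x) (f x) (qs x)) (a x) := by
  have h1 : RE fun x => ∃ h, h = Ksmt.approxAnswers rnd (args x) (f x) (qs x) ∧
      Moves (M x) (p x) h (a x) :=
    exists_ (and (approxAnswers hrnd (by fun_prop) (by fun_prop) (by fun_prop) (by fun_prop))
      (moves (by fun_prop) (by fun_prop) (by fun_prop) (by fun_prop)))
  exact h1.of_iff fun x => by simp

theorem outputsApprox {rnd : ℚ → ℤ} (hrnd : Computable rnd) {M : α → Nat.Partrec.Code} {p : α → ℕ}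
    {args : α → List ℕ} {f : α → Assign} {qs : α → List ℕ} {y : α → ℚ} (hM : Primrec M)
    (hp : Primrec p) (hargs : Primrec args) (hf : Primrec f) (hq : Primrec qs) (hy : Primrec y) :
    RE fun x => OutputsApprox rnd (M x) (args x) (f x) (p x) (qs x) (y x) := by
  unfold OutputsApprox ratOfCode
  refine and (hist hq (moves_approx hrnd ?_ ?_ ?_ ?_ ?_ ?_)) (exists_ (and
    (moves_approx hrnd ?_ ?_ ?_ ?_ ?_ ?_) ?_)) <;> fun_prop

theorem lineariseCode (δ : ℚ) (p : ℕ) {rnd : ℚ → ℤ} (hrnd : Computable rnd) {P : α → NCode}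
    {f : α → Assign} {C : α → Clause} (hP : Primrec P) (hf : Primrec f) (hC : Primrec C) :
    RE fun x => LineariseCode δ p rnd (P x) (f x) (C x) := by
  unfold LineariseCode
  refine exists_ (exists_ (and (outputsApprox hrnd ?_ ?_ ?_ ?_ ?_ ?_) (and ?_
    (eq ?_ (Prim.outsideBall ?_ ?_ ?_))))) <;> fun_prop

theorem lineariseCodeNone (δ : ℚ) (p : ℕ) {rnd : ℚ → ℤ} (hrnd : Computable rnd) {P : α → NCode}
    {f : α → Assign} (hP : Primrec P) (hf : Primrec f) :
    RE fun x => LineariseCodeNone δ p rnd (P x) (f x) := by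
  unfold LineariseCodeNone
  refine exists_ (exists_ (and (outputsApprox hrnd ?_ ?_ ?_ ?_ ?_ ?_) ?_)) <;> fun_prop

end

end RE

end Ksmt

namespace Ksmt

/-! ### Effectivity of the search for a run -/

/-- A step of the search, for a formula given by its code. -/
def SearchStepCode (δ : ℚ) (p : ℕ) (rnd : ℚ → ℤ) (n : ℕ) (nl : List NCode) (ord : List ℕ)
    (S S' : State) : Prop :=
  ∃ (α : Assign) (L : List Clause), S = .run α L ∧
    ((∃ (z : ℕ) (q : ℚ), (∃ t, α.map Prod.fst ++ [z] ++ t = ord) ∧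
        ¬ LinFalse (α ++ [(z, q)]) L ∧ S' = .run (α ++ [(z, q)]) L) ∨
    (¬ LinFalse α L ∧ ∃ (z : ℕ) (D : Clause), z < n ∧ ¬ α.Assigned z ∧
      Deriv (ConflictBase α L z) z D ∧ D.Nodup ∧ (∀ a ∈ D, a.coeff z = 0) ∧
      D.IsFalse α ∧ S' = .run α (D :: L)) ∨
    (∃ k : ℕ, ¬ LinFalse (α.take k) L ∧ LinFalse (α.take (k + 1)) L ∧ S' = .run (α.take k) L) ∨
    (LinFalse [] L ∧ S' = .unsat) ∨
    ((∀ i ∈ List.range n, α.Assigned i) ∧ LinTrue α L ∧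
      ((∃ P ∈ nl, ∃ C, LineariseCode δ p rnd P α C ∧ S' = .run α (C :: L)) ∨
        (∀ P ∈ nl, LineariseCodeNone δ p rnd P α) ∧ S' = .deltaSat)))

/-- A search step uses the real functions only through their machines, so it is determined by data
contained in the code of the formula. -/
theorem searchStep_iff {F : Formula} {ord : List ℕ} {δ : ℚ} {p : ℕ} {rnd : ℚ → ℤ} {S S' : State} :
    SearchStep F ord δ p rnd S S' ↔
      SearchStepCode δ p rnd F.n (F.nl.map NlConstraint.code) ord S S' := by
  cases S with
  | run α L =>
    have hv : ∀ z (D : Clause), z ∉ D.vars ↔ ∀ a ∈ D, a.coeff z = 0 := by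
      intro z D
      simp [Clause.vars, Atom.vars]
    have he : ∀ Q : NCode → Prop, (∃ P ∈ F.nl.map NlConstraint.code, Q P) ↔
        ∃ P ∈ F.nl, Q P.code := by simp
    simp only [SearchStep, SearchStepCode, NlinStepLocal, Formula.Total, List.mem_range,
      he, List.forall_mem_map, lineariseLocal_some_iff, lineariseLocal_none_iff,
      State.run.injEq, hv]
    constructor
    · exact fun h => ⟨α, L, ⟨rfl, rfl⟩, h⟩
    · rintro ⟨_, _, ⟨rfl, rfl⟩, h⟩
      exact h
  | _ => simp [SearchStep, SearchStepCode]

theorem RE.searchStepCode (δ : ℚ) (p : ℕ) {rnd : ℚ → ℤ} (hrnd : Computable rnd)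
    {α : Type*} [Primcodable α] {n : α → ℕ} {nl : α → List NCode} {ord : α → List ℕ}
    {S S' : α → State} (hn : Primrec n) (hnl : Primrec nl) (hord : Primrec ord) (hS : Primrec S)
    (hS' : Primrec S') :
    RE fun x => SearchStepCode δ p rnd (n x) (nl x) (ord x) (S x) (S' x) := by
  unfold SearchStepCode
  refine exists_ (exists_ (and ?_ (or ?_ (or ?_ (or ?_ (or ?_ (and ?_ (and ?_ (or
    (exists_ (and ?_ (exists_ (and (lineariseCode δ p hrnd ?_ ?_ ?_) ?_))))
    (and (forall_mem ?_ (lineariseCodeNone δ p hrnd ?_ ?_)) ?_))))))))))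
  all_goals fun_prop

/-- The entries of a run, as justified by the preceding entries. -/
def RunStep (δ : ℚ) (p : ℕ) (rnd : ℚ → ℤ) (I : FCode × List ℕ) (h : List State)
    (S : State) : Prop :=
  (h = [] ∧ ∃ L : List Clause, linCode L = I.1.2.1 ∧ S = .run [] L) ∨
  ∃ S0, h[h.length - 1]? = some S0 ∧ SearchStepCode δ p rnd I.1.1 I.1.2.2 I.2 S0 S

/-- The relation between the input of the algorithm and its output. -/
def RunCodes (δ : ℚ) (p : ℕ) (rnd : ℚ → ℤ) (I : FCode × List ℕ) (c : List SCode) : Prop :=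
  ∃ run : List State, Hist (RunStep δ p rnd I) run ∧ c = run.map State.code ∧
    ∃ S, run[run.length - 1]? = some S ∧ (S = .sat ∨ S = .deltaSat ∨ S = .unsat)

theorem RE.runStep (δ : ℚ) (p : ℕ) {rnd : ℚ → ℤ} (hrnd : Computable rnd) :
    RE fun x : (FCode × List ℕ) × List State × State => RunStep δ p rnd x.1 x.2.1 x.2.2 := by
  unfold RunStep
  refine or (and ?_ (exists_ (and ?_ ?_))) (exists_ (and
    (eq (Prim.getElem? (Prim.natSub ?_ ?_) ?_) ?_) (searchStepCode δ p hrnd ?_ ?_ ?_ ?_ ?_)))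
  all_goals fun_prop

theorem RE.runCodes (δ : ℚ) (p : ℕ) {rnd : ℚ → ℤ} (hrnd : Computable rnd) :
    RE fun x : (FCode × List ℕ) × List SCode => RunCodes δ p rnd x.1 x.2 := by
  unfold RunCodes
  refine exists_ (and (hist (J := fun y : ((FCode × List ℕ) × List SCode) × List State =>
    RunStep δ p rnd y.1.1) (by fun_prop) ((runStep δ p hrnd).comp
      (f := fun y : (((FCode × List ℕ) × List SCode) × List State) × List State × State =>
        (y.1.1.1, y.2)) (by fun_prop))) (and ?_ (exists_ (and
        (eq (Prim.getElem? (Prim.natSub ?_ ?_) ?_) ?_) ?_))))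
  all_goals fun_prop

/-! ### Decoding of inputs, and correctness and existence of finished runs -/

theorem ratOfCode_ratCode (q : ℚ) : ratOfCode (ratCode q) = q := q.num_div_den

theorem computable_of_codes {rnd : ℚ → ℤ} (h : Computable fun c : RCode => rnd (ratOfCode c)) :
    Computable rnd :=
  (h.comp (show Primrec fun q : ℚ => ratCode q by fun_prop).to_comp).of_eq fun q => by
    rw [ratOfCode_ratCode]

/-- Ensures that the initial clauses recovered from the code are those of the formula itself. -/
theorem linCode_injective : Function.Injective linCode := by
  have h1 : Function.Injective ratCode := fun a b h => by
    rw [← ratOfCode_ratCode a, h, ratOfCode_ratCode]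
  refine List.map_injective_iff.mpr (List.map_injective_iff.mpr fun a b h => ?_)
  cases a
  cases b
  simp only [Atom.code, Prod.mk.injEq] at h
  simp [h1 h.1, List.map_injective_iff.mpr h1 h.2.1, h.2.2]

section

variable {F : Formula} {ord : List ℕ} {δ : ℚ} {p : ℕ} {rnd : ℚ → ℤ}

/-- A list of states justified by `RunStep` is a run from the initial state. -/
theorem Hist.isRun (hδ : 0 < δ) (hp : (1 / 2 : ℝ) ^ p ≤ δ / 4)
    (hrnd : ∀ q : ℚ, |(rnd q : ℚ) - q| ≤ 1 / 2) (hF : F.IsBounded)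
    (hord : ord.Perm (List.range F.n)) {run : List State}
    (h : Hist (RunStep δ p rnd (F.code, ord)) run) (hne : run ≠ []) :
    run.head? = some F.init ∧ run.IsChain (LocalStep F ord δ p rnd) ∧
      ∀ S ∈ run, Invariant F ord δ S := by
  induction run using List.reverseRecOn with
  | nil => exact absurd rfl hne
  | append_singleton l S ih =>
    rw [hist_snoc] at h
    rcases h.2 with ⟨rfl, L, hL, rfl⟩ | ⟨S0, hS0, hs⟩
    · have : L = F.lin := linCode_injective hL
      subst this
      refine ⟨rfl, by simp, ?_⟩
      exact fun T hT => by rw [List.mem_singleton.mp hT]; exact invariant_init F ord δ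
    · have hl : l ≠ [] := by rintro rfl; simp at hS0
      obtain ⟨h1, h2, h3⟩ := ih h.1 hl
      have hstep : LocalStep F ord δ p rnd S0 S :=
        (searchStep_iff.mpr hs).localStep hord
      have hmem : S0 ∈ l := List.mem_of_getElem? hS0
      rw [← List.getLast?_eq_getElem?] at hS0
      refine ⟨by rw [List.head?_append, h1]; rfl, ?_, fun T hT => ?_⟩
      · rw [List.isChain_append]
        refine ⟨h2, by simp, fun x hx y hy => ?_⟩
        rw [hS0, Option.mem_some_iff] at hx
        simp only [List.head?_cons, Option.mem_some_iff] at hy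
        rw [← hx, ← hy]
        exact hstep
      · rcases List.mem_append.mp hT with hT | hT
        · exact h3 T hT
        · rw [List.mem_singleton.mp hT]
          exact (h3 S0 hmem).step hδ hp hrnd hF hord hstep

/-- Chosen search steps are iterated from the initial state. Termination gives a first state without
a search step, and by progress it is not of the form `run α L`. -/
theorem exists_runCodes (hδ : 0 < δ) (hp : (1 / 2 : ℝ) ^ p ≤ δ / 4)
    (hrnd : ∀ q : ℚ, |(rnd q : ℚ) - q| ≤ 1 / 2) (hF : F.IsBounded)
    (hord : ord.Perm (List.range F.n)) : ∃ c, RunCodes δ p rnd (F.code, ord) c := by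
  classical
  have hnext : ∀ S, ∃ S', (∃ T, SearchStep F ord δ p rnd S T) → SearchStep F ord δ p rnd S S' := by
    intro S
    by_cases h : ∃ T, SearchStep F ord δ p rnd S T
    · exact ⟨h.choose, fun _ => h.choose_spec⟩
    · exact ⟨S, fun h' => absurd h' h⟩
  choose next hnext using hnext
  set run : ℕ → State := fun i => next^[i] F.init with hrun
  have hsucc : ∀ i, run (i + 1) = next (run i) := fun i => Function.iterate_succ_apply' _ _ _
  have hex : ∃ i, ¬ ∃ T, SearchStep F ord δ p rnd (run i) T := by
    by_contra hcon
    push Not at hcon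
    exact no_infinite_run hδ hp hrnd hF hord ⟨run, rfl, fun i => by
      rw [hsucc]
      exact (hnext _ (hcon i)).localStep hord⟩
  set N := Nat.find hex with hN
  have hstep : ∀ i < N, SearchStep F ord δ p rnd (run i) (run (i + 1)) := fun i hi => by
    rw [hsucc]
    exact hnext _ (not_not.mp (Nat.find_min hex hi))
  have hhist : ∀ i ≤ N, Hist (RunStep δ p rnd (F.code, ord)) ((List.range (i + 1)).map run) := by
    intro i
    induction i with
    | zero => exact fun _ => hist_snoc (l := []).mpr ⟨.nil _, Or.inl ⟨rfl, F.lin, rfl, rfl⟩⟩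
    | succ i ih =>
      intro hi
      rw [List.range_succ, List.map_append, List.map_singleton, hist_snoc]
      exact ⟨ih (by omega), Or.inr ⟨run i, by simp, searchStep_iff.mp (hstep i (by omega))⟩⟩
  have hinv : ∀ i ≤ N, Invariant F ord δ (run i) := by
    intro i
    induction i with
    | zero => exact fun _ => invariant_init F ord δ
    | succ i ih => 
      exact fun hi => (ih (by omega)).step hδ hp hrnd hF hord
        ((hstep i (by omega)).localStep hord)
  refine ⟨_, _, hhist N le_rfl, rfl, run N, by simp, ?_⟩
  have hfin := Nat.find_spec hex
  have hI := hinv N le_rfl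
  change ¬ ∃ T, SearchStep F ord δ p rnd (run N) T at hfin
  cases hR : run N with
  | run α L =>
    rw [hR] at hI hfin
    exact absurd (hI.exists_searchStep δ p hrnd hF hord) hfin
  | _ => simp

theorem Invariant.correctAnswer {S : State} (h : Invariant F ord δ S)
    (hS : ∀ α L, S ≠ .run α L) : CorrectAnswer F δ S := by
  cases S with
  | run α L => exact absurd rfl (hS α L)
  | _ => exact h

end

end Ksmt

/-! ### The decision procedure -/

theorem mainTheorem3
    (δ : ℚ) (hδ : 0 < δ)
    (p : ℕ) (hp : -⌊Real.logb 2 (min 1 ((δ : ℝ) / 4))⌋ ≤ (p : ℤ))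
    (rnd : ℚ → ℤ) (hrnd : ∀ q : ℚ, |(rnd q : ℚ) - q| ≤ 1 / 2)
    (hrnd_computable : Computable fun c : Ksmt.RCode => rnd (Ksmt.ratOfCode c)) :
    (∀ (F : Ksmt.Formula) (ord : List ℕ), F.IsBounded → ord.Perm (List.range F.n) →
      (∀ S S' : Ksmt.State,
        Relation.ReflTransGen (Ksmt.LocalStep F ord δ p rnd) F.init S →
        Ksmt.LocalStep F ord δ p rnd S S' → Ksmt.DeltaKsmtStep F δ S S') ∧
      (¬ ∃ run : ℕ → Ksmt.State, run 0 = F.init ∧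
        ∀ i, Ksmt.LocalStep F ord δ p rnd (run i) (run (i + 1))) ∧
      (∀ S : Ksmt.State,
        Relation.ReflTransGen (Ksmt.LocalStep F ord δ p rnd) F.init S →
        (∀ S', ¬ Ksmt.LocalStep F ord δ p rnd S S') → Ksmt.CorrectAnswer F δ S)) ∧
    ∃ solve : Ksmt.FCode × List ℕ →. List Ksmt.SCode, Partrec solve ∧
      ∀ (F : Ksmt.Formula) (ord : List ℕ), F.IsBounded → ord.Perm (List.range F.n) →
        ∃ run : List Ksmt.State, run.map Ksmt.State.code ∈ solve (F.code, ord) ∧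
          run.head? = some F.init ∧
          run.IsChain (Ksmt.LocalStep F ord δ p rnd) ∧
          ∃ S, run.getLast? = some S ∧ Ksmt.CorrectAnswer F δ S := by
  have hp' := Ksmt.half_pow_le hδ hp
  refine ⟨fun F ord hF hord => ?_, ?_⟩
  · have hinv : ∀ S, Relation.ReflTransGen (Ksmt.LocalStep F ord δ p rnd) F.init S →
        Ksmt.Invariant F ord δ S := by
      intro S h
      induction h with
      | refl => exact Ksmt.invariant_init F ord δ
      | tail _ hs ih => exact ih.step hδ hp' hrnd hF hord hs
    refine ⟨fun S S' h hs => (hinv S h).deltaKsmtStep hδ hp' hrnd hF hs,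
      Ksmt.no_infinite_run hδ hp' hrnd hF hord, fun S h hno => ?_⟩
    refine (hinv S h).correctAnswer ?_
    rintro α L rfl
    obtain ⟨S', hS'⟩ := (hinv _ h).exists_searchStep δ p hrnd hF hord
    exact hno S' (hS'.localStep hord)
  -- The search is fixed before `F` and the order are given, hence uniform in them. It may return a
  -- run other than the one that shows existence; `Hist.isRun` applies to whichever is found.
  · obtain ⟨solve, hsolve, hsound, hcomplete⟩ := Ksmt.RE.exists_partrec
      (Ksmt.RE.runCodes δ p (Ksmt.computable_of_codes hrnd_computable))
    refine ⟨solve, hsolve, fun F ord hF hord => ?_⟩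
    obtain ⟨c, hc⟩ := hcomplete _ (Ksmt.exists_runCodes hδ hp' hrnd hF hord)
    obtain ⟨run, hrun, rfl, S, hS, hfin⟩ := hsound _ _ hc
    have hne : run ≠ [] := by rintro rfl; simp at hS
    obtain ⟨h1, h2, h3⟩ := hrun.isRun hδ hp' hrnd hF hord hne
    refine ⟨run, hc, h1, h2, S, by rw [List.getLast?_eq_getElem?]; exact hS,
      (h3 S (List.mem_of_getElem? hS)).correctAnswer ?_⟩
    rintro α L rfl
    rcases hfin with h | h | h <;> cases h
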